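/- **Setting.** Let $\mathfrak g$ be a finite-dimensional complex simple Lie algebra, $\mathfrak h\subset\mathfrak g$ a Cartan subalgebra, $R$ its root system and $\Delta=\{\alpha_1,\dots,\alpha_r\}$ a base of $R$. Let $(\cdot,\cdot)$ be the form on $\mathfrak h^*$ induced by the Killing form, $d_i=(\alpha_i,\alpha_i)/2$, $a_{ij}=d_i^{-1}(\alpha_i,\alpha_j)=\alpha_j(H_i)$ with $H_i\in\mathfrak h$ the coroots, $Q$ the root lattice, $P=\bigoplus_i\mathbb Z\varpi_i$ the weight lattice with its fundamental weights, and $W$ the Weyl group with simple reflections $s_i$ and length function $l(w)=\#(R^+\cap wR^-)$. For a subset $S\subset\Delta$ (identified with its set of indices) let $W_S=\langle s_i : i\in S\rangle$ and $W^S=\{w\in W : l(ws_i)>l(w)\ \text{for all } i\in S\}$. A reduced word of $w$ is a sequence $(i_1,\dots,i_l)$ with $w=s_{i_1}\cdots s_{i_l}$ and $l=l(w)$. Fix $q\in(0,1)$ and put $q_i=q^{d_i}$. $U_q(\mathfrak g)$ is the unital $\mathbb C$-algebra with generators $K_i^{\pm1},X_i^\pm$ $(1\le i\le r)$ and relations $K_iK_j=K_jK_i$,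 $K_iK_i^{-1}=K_i^{-1}K_i=1$, $K_iX_j^\pm K_i^{-1}=q_i^{\pm a_{ij}}X_j^\pm$, $X_i^+X_j^--X_j^-X_i^+=\delta_{ij}\frac{K_i-K_i^{-1}}{q_i-q_i^{-1}}$ and, for $i\ne j$, $\sum_{s=0}^{1-a_{ij}}(-1)^s\binom{1-a_{ij}}{s}_{q_i}(X_i^\pm)^{1-a_{ij}-s}X_j^\pm (X_i^\pm)^s=0$. Its counit is given by $\varepsilon(K_i^{\pm1})=1$, $\varepsilon(X_i^\pm)=0$. A vector $v$ has weight $\mu\in P$ if $K_iv=q_i^{\mu(H_i)}v$ for all $i$. $\mathbb C_q[U]\subset U_q(\mathfrak g)^*$ is the span of the matrix coefficients of the finite-dimensional irreducible representations that are sums of weight spaces with weights in $P$; it has the comultiplication $\Delta(\phi)(X\otimes Y)=\phi(XY)$ and the counit $\phi\mapsto\phi(1)$. Let $U_q(\mathfrak l_S)\subset U_q(\mathfrak g)$ be the subalgebra generated by all $K_i^{\pm1}$ and the $X_i^\pm$ with $i\in S$, and $$\mathbb C_q[U/K_S]=\{\phi\in\mathbb C_q[U] : \phi(YX)=\varepsilon(X)\phi(Y)\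 \text{for all } X\in U_q(\mathfrak l_S),\ Y\in U_q(\mathfrak g)\}.$$ **Representations.** Let $p\in(0,1)$. Let $U_p(\mathfrak{sl}(2))$ be the algebra with generators $K^{\pm1},X^\pm$ and relations $KK^{-1}=K^{-1}K=1$, $KX^\pm K^{-1}=p^{\pm2}X^\pm$, $X^+X^--X^-X^+=\frac{K-K^{-1}}{p-p^{-1}}$, and comultiplication $\Delta(K)=K\otimes K$, $\Delta(X^+)=X^+\otimes1+K\otimes X^+$, $\Delta(X^-)=X^-\otimes K^{-1}+1\otimes X^-$. Let $t_{ij}$ $(i,j\in\{1,2\})$ be the matrix coefficients $X\mapsto(Xv_j,v_i)$ of its two-dimensional representation with orthonormal basis $v_1,v_2$ for which $Kv_1=pv_1$, $Kv_2=p^{-1}v_2$, $X^+v_2=v_1$, $X^+v_1=0$, $X^-v_1=v_2$, $X^-v_2=0$, and let $\mathbb C_p[SU(2)]$ be the subalgebra generated by the $t_{ij}$ in the dual of $U_p(\mathfrak{sl}(2))$, with the product $(\phi\psi)(X)=(\phi\otimes\psi)(\Delta X)$. Let $\pi_p:\mathbb C_p[SU(2)]\to\mathcal B(\ell_2(\mathbb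 Z_{\ge0}))$ be the representation determined by $$\pi_p(t_{11})e_j=\sqrt{1-p^{2j}}\,e_{j-1},\quad \pi_p(t_{12})e_j=-p^{j+1}e_j,\quad \pi_p(t_{21})e_j=p^je_j,\quad \pi_p(t_{22})e_j=\sqrt{1-p^{2(j+1)}}\,e_{j+1}$$ (with $\pi_p(t_{11})e_0=0$). For each $i$ let $\phi_i^*:\mathbb C_q[U]\to\mathbb C_{q_i}[SU(2)]$ be the dual of the homomorphism $\phi_i:U_{q_i}(\mathfrak{sl}(2))\to U_q(\mathfrak g)$, $K^{\pm1}\mapsto K_i^{\pm1}$, $X^\pm\mapsto X_i^\pm$, and put $\pi_i=\pi_{q_i}\circ\phi_i^*$. Tensor products of representations of $\mathbb C_q[U]$ are formed by means of $\Delta$. For a reduced word $(i_1,\dots,i_l)$ of $w\in W$ put $\pi_w=\pi_{i_1}\otimes\cdots\otimes\pi_{i_l}$, acting on $\ell_2(\mathbb Z_{\ge0})^{\otimes l}$; the empty word gives the counit. For $t=(t_1,\dots,t_r)\in T\simeq\mathbb T^r$, where $\mathbb T\subset\mathbb C$ is the unit circle, $\tau_t$ is the one-dimensional representation of $\mathbb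 C_q[U]$ which is the composite of the restriction of functionals to the span $U_q(\mathfrak h)$ of the elements $K^\sigma=\prod_iK_i^{k_i}$ $(\sigma=\sum_ik_i\alpha_i\in Q)$ with the linear map $\phi_\mu\mapsto t^\mu:=\prod_it_i^{m_i}$ $(\mu=\sum_im_i\varpi_i\in P)$, where $\phi_\mu(K^\sigma)=q^{(\mu,\sigma)}$. **Proposition.** Let $S\subset\Delta$ and $\sigma\in W$, and let $\sigma=uv$ with $u\in W^S$ and $v\in W_S$. Choose any reduced words of $u$ and of $v$, and let $\pi_u$, $\pi_v$ be the corresponding representations. Then the concatenation of the two words is a reduced word of $\sigma$, and for the representation $\pi_\sigma$ formed with it one has $\pi_\sigma=\pi_u\otimes\pi_v$ (under the identification $\ell_2(\mathbb Z_{\ge0})^{\otimes(l(u)+l(v))}=\ell_2(\mathbb Z_{\ge0})^{\otimes l(u)}\otimes\ell_2(\mathbb Z_{\ge0})^{\otimes l(v)}$). Moreover $$(\pi_\sigma\otimes\tau_t)(a)=\pi_u(a)\otimes\mathrm{id}^{\otimes l(v)}\qquad\text{for all } t\in T \text{ and } a\in\mathbb C_q[U/K_S].$$ In particular the restriction of $\pi_\sigma\otimes\tau_t$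 to $\mathbb C_q[U/K_S]$ factors through $\pi_u$: there is a $*$-homomorphism $\Theta:\mathcal B(\ell_2(\mathbb Z_{\ge0})^{\otimes l(u)})\to\mathcal B(\ell_2(\mathbb Z_{\ge0})^{\otimes l(u)}\otimes\ell_2(\mathbb Z_{\ge0})^{\otimes l(v)})$ such that $(\pi_\sigma\otimes\tau_t)(a)=\Theta(\pi_u(a))$ for all $t\in T$ and $a\in\mathbb C_q[U/K_S]$. -/

import Mathlib

open scoped TensorProduct

noncomputable section
namespace QFlag

/-- Cartan integers `a i j = α_j(H_i)` together with the deformation parameters `q i = q^{d_i}`. -/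
structure Datum (ι : Type*) where
  a : ι → ι → ℤ
  q : ι → Set.Ioo (0 : ℝ) 1
  a_self : ∀ i, a i i = 2

/-- The generators `K_i`, `K_i⁻¹`, `X_i⁺ = E_i`, `X_i⁻ = F_i`. -/
inductive Gen (ι : Type*)
  | K (i : ι)
  | Kinv (i : ι)
  | E (i : ι)
  | F (i : ι)

/-- `[n]_x = (x^n - x^{-n}) / (x - x^{-1})`. -/
def qInt (x : ℂ) (n : ℕ) : ℂ := (x ^ n - x⁻¹ ^ n) / (x - x⁻¹)

/-- `[n]_x! = [n]_x [n-1]_x ⋯ [1]_x`. -/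
def qFact (x : ℂ) (n : ℕ) : ℂ := ∏ k ∈ Finset.range n, qInt x (k + 1)

def qBinom (x : ℂ) (n k : ℕ) : ℂ := qFact x n / (qFact x (n - k) * qFact x k)

section
variable {ι : Type*} (D : Datum ι)

/-- The parameter `q_i` as a complex number. -/
def Datum.qc (i : ι) : ℂ := ((D.q i : ℝ) : ℂ)

/-- The left hand side of the quantum Serre relation. -/
def serre (D : Datum ι) (X : ι → FreeAlgebra ℂ (Gen ι)) (i j : ι) : FreeAlgebra ℂ (Gen ι) :=
  ∑ s ∈ Finset.range ((1 - D.a i j).toNat + 1),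
    ((-1) ^ s * qBinom (D.qc i) (1 - D.a i j).toNat s) •
      (X i ^ ((1 - D.a i j).toNat - s) * X j * X i ^ s)

/-- The defining relations of the quantized universal enveloping algebra. -/
inductive Rel : FreeAlgebra ℂ (Gen ι) → FreeAlgebra ℂ (Gen ι) → Prop
  | KK (i j : ι) : Rel (.ι ℂ (.K i) * .ι ℂ (.K j)) (.ι ℂ (.K j) * .ι ℂ (.K i))
  | KKinv (i : ι) : Rel (.ι ℂ (.K i) * .ι ℂ (.Kinv i)) 1
  | KinvK (i : ι) : Rel (.ι ℂ (.Kinv i) * .ι ℂ (.K i)) 1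
  | KE (i j : ι) : Rel (.ι ℂ (.K i) * .ι ℂ (.E j) * .ι ℂ (.Kinv i))
      (D.qc i ^ D.a i j • .ι ℂ (.E j))
  | KF (i j : ι) : Rel (.ι ℂ (.K i) * .ι ℂ (.F j) * .ι ℂ (.Kinv i))
      (D.qc i ^ (-D.a i j) • .ι ℂ (.F j))
  | EF_self (i : ι) : Rel (.ι ℂ (.E i) * .ι ℂ (.F i) - .ι ℂ (.F i) * .ι ℂ (.E i))
      ((D.qc i - (D.qc i)⁻¹)⁻¹ • (.ι ℂ (.K i) - .ι ℂ (.Kinv i)))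
  | EF_ne (i j : ι) (h : i ≠ j) : Rel (.ι ℂ (.E i) * .ι ℂ (.F j) - .ι ℂ (.F j) * .ι ℂ (.E i)) 0
  | serreE (i j : ι) (h : i ≠ j) : Rel (serre D (fun k => .ι ℂ (.E k)) i j) 0
  | serreF (i j : ι) (h : i ≠ j) : Rel (serre D (fun k => .ι ℂ (.F k)) i j) 0

/-- The quantized universal enveloping algebra. -/
def Uq : Type _ := RingQuot (Rel D)

instance : Ring (Uq D) := inferInstanceAs (Ring (RingQuot (Rel D)))
instance : Algebra ℂ (Uq D) := inferInstanceAs (Algebra ℂ (RingQuot (Rel D)))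

/-- The class of a generator in the quantized universal enveloping algebra. -/
def Uq.gen (x : Gen ι) : Uq D := RingQuot.mkAlgHom ℂ (Rel D) (.ι ℂ x)

/-- An assignment on the generators respecting the relations. -/
def Uq.lift {A : Type*} [Ring A] [Algebra ℂ A] (f : Gen ι → A)
    (hf : ∀ ⦃x y⦄, Rel D x y → FreeAlgebra.lift ℂ f x = FreeAlgebra.lift ℂ f y) : Uq D →ₐ[ℂ] A :=
  RingQuot.liftAlgHom ℂ ⟨FreeAlgebra.lift ℂ f, hf⟩

@[simp] lemma Uq.lift_gen {A : Type*} [Ring A] [Algebra ℂ A] (f : Gen ι → A)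
    (hf : ∀ ⦃x y⦄, Rel D x y → FreeAlgebra.lift ℂ f x = FreeAlgebra.lift ℂ f y) (x : Gen ι) :
    Uq.lift D f hf (Uq.gen D x) = f x := by
  unfold Uq.lift Uq.gen
  erw [RingQuot.liftAlgHom_mkAlgHom_apply]
  simp

variable {D} in
lemma Uq.hom_ext {A : Type*} [Semiring A] [Algebra ℂ A] {f g : Uq D →ₐ[ℂ] A}
    (h : ∀ x, f (Uq.gen D x) = g (Uq.gen D x)) : f = g := by
  refine RingQuot.ringQuot_ext' ℂ f g ?_
  ext x
  exact h x

variable {D} in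
lemma Uq.map_serre {A : Type*} [Ring A] [Algebra ℂ A] (f : FreeAlgebra ℂ (Gen ι) →ₐ[ℂ] A)
   (X : ι → FreeAlgebra ℂ (Gen ι)) (i j : ι) : f (serre D X i j) =
   ∑ s ∈ Finset.range ((1 - D.a i j).toNat + 1),
    ((-1) ^ s * qBinom (D.qc i) (1 - D.a i j).toNat s) •
      (f (X i) ^ ((1 - D.a i j).toNat - s) * f (X j) * f (X i) ^ s) := by
  simp [serre, map_sum]

/-- The counit `ε`. -/
def Uq.counit : Uq D →ₐ[ℂ] ℂ :=
  Uq.lift D (fun x => match x with | .K _ => 1 | .Kinv _ => 1 | .E _ => 0 | .F _ => 0) <| by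
    intro x y h
    cases h <;> simp [Uq.map_serre]


lemma Datum.qc_ne (i : ι) : D.qc i ≠ 0 := by
  have := (D.q i).2.1
  simp [Datum.qc, this.ne']

/-! ### Relations among the generators -/

lemma Uq.rel {x y : FreeAlgebra ℂ (Gen ι)} (h : Rel D x y) :
    RingQuot.mkAlgHom ℂ (Rel D) x = RingQuot.mkAlgHom ℂ (Rel D) y :=
  RingQuot.mkAlgHom_rel ℂ h

lemma Uq.K_comm (i j : ι) : Uq.gen D (.K i) * Uq.gen D (.K j) = Uq.gen D (.K j) * Uq.gen D (.K i) := by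
  have := Uq.rel D (.KK i j)
  rwa [map_mul, map_mul] at this

lemma Uq.K_Kinv (i : ι) : Uq.gen D (.K i) * Uq.gen D (.Kinv i) = 1 := by
  have := Uq.rel D (.KKinv i)
  rwa [map_mul, map_one] at this

lemma Uq.Kinv_K (i : ι) : Uq.gen D (.Kinv i) * Uq.gen D (.K i) = 1 := by
  have := Uq.rel D (.KinvK i)
  rwa [map_mul, map_one] at this

lemma Uq.KE (i j : ι) : Uq.gen D (.K i) * Uq.gen D (.E j) * Uq.gen D (.Kinv i) =
    D.qc i ^ D.a i j • Uq.gen D (.E j) := by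
  have := Uq.rel D (.KE i j)
  rwa [map_mul, map_mul, map_smul] at this

lemma Uq.KF (i j : ι) : Uq.gen D (.K i) * Uq.gen D (.F j) * Uq.gen D (.Kinv i) =
    D.qc i ^ (-D.a i j) • Uq.gen D (.F j) := by
  have := Uq.rel D (.KF i j)
  rwa [map_mul, map_mul, map_smul] at this

lemma Uq.EF (i : ι) : Uq.gen D (.E i) * Uq.gen D (.F i) - Uq.gen D (.F i) * Uq.gen D (.E i) =
    (D.qc i - (D.qc i)⁻¹)⁻¹ • (Uq.gen D (.K i) - Uq.gen D (.Kinv i)) := by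
  have := Uq.rel D (.EF_self i)
  rwa [map_sub, map_mul, map_mul, map_smul, map_sub] at this

/-! ### The quantized function algebra -/

variable {D} in
/-- A finite-dimensional representation is irreducible if the space is nonzero and has no invariant
subspaces other than `0` and itself. -/
def IsIrred {V : Type*} [AddCommGroup V] [Module ℂ V] (ρ : Uq D →ₐ[ℂ] Module.End ℂ V) : Prop :=
  Nontrivial V ∧ ∀ W : Submodule ℂ V, (∀ X, ∀ w ∈ W, ρ X w ∈ W) → W = ⊥ ∨ W = ⊤

variable {D} in
/-- The weight space of weight `∑ i, μ i • ϖ_i`: the `K_i` act by `q_i ^ μ(H_i)`. -/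
def weightSpace {V : Type*} [AddCommGroup V] [Module ℂ V] (ρ : Uq D →ₐ[ℂ] Module.End ℂ V)
    (μ : ι → ℤ) : Submodule ℂ V :=
  ⨅ i, Module.End.eigenspace (ρ (Uq.gen D (.K i))) (D.qc i ^ μ i)

variable {D} in
/-- `V` is the sum of its weight spaces with weights in the weight lattice. -/
def IsPWeighted {V : Type*} [AddCommGroup V] [Module ℂ V] (ρ : Uq D →ₐ[ℂ] Module.End ℂ V) : Prop :=
  ⨆ μ, weightSpace ρ μ = ⊤

variable {D} in
/-- The matrix coefficient `X ↦ f (X v)`. -/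
def matCoeff {V : Type*} [AddCommGroup V] [Module ℂ V] (ρ : Uq D →ₐ[ℂ] Module.End ℂ V)
    (f : Module.Dual ℂ V) (v : V) : Module.Dual ℂ (Uq D) :=
  f ∘ₗ LinearMap.applyₗ v ∘ₗ ρ.toLinearMap

@[simp] lemma matCoeff_apply {V : Type*} [AddCommGroup V] [Module ℂ V]
    (ρ : Uq D →ₐ[ℂ] Module.End ℂ V) (f : Module.Dual ℂ V) (v : V) (X : Uq D) :
    matCoeff ρ f v X = f (ρ X v) := rfl

/-- The matrix coefficients of the finite-dimensional irreducible representations with weights in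
the weight lattice. -/
def coeffSet : Set (Module.Dual ℂ (Uq D)) :=
  {φ | ∃ (n : ℕ) (ρ : Uq D →ₐ[ℂ] Module.End ℂ (Fin n → ℂ)) (f : Module.Dual ℂ (Fin n → ℂ))
    (v : Fin n → ℂ), IsIrred ρ ∧ IsPWeighted ρ ∧ φ = matCoeff ρ f v}

/-- The quantized function algebra `ℂ_q[U]`, a subspace of the linear dual. -/
def Fun : Submodule ℂ (Module.Dual ℂ (Uq D)) := Submodule.span ℂ (coeffSet D)

/-- The map `(φ ⊗ ψ) ↦ ((X, Y) ↦ φ(X) ψ(Y))`. -/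
def pairDual : Fun D ⊗[ℂ] Fun D →ₗ[ℂ] Uq D →ₗ[ℂ] Uq D →ₗ[ℂ] ℂ :=
  TensorProduct.lift <| LinearMap.mk₂ ℂ
    (fun φ ψ => LinearMap.mk₂ ℂ (fun X Y => φ.1 X * ψ.1 Y)
      (fun _ _ _ => by simp [add_mul]) (fun _ _ _ => by simp [mul_assoc])
      (fun _ _ _ => by simp [mul_add]) (fun _ _ _ => by simp [mul_left_comm]))
    (fun _ _ _ => by ext; simp [add_mul]) (fun _ _ _ => by ext; simp [mul_assoc])
    (fun _ _ _ => by ext; simp [mul_add]) (fun _ _ _ => by ext; simp [mul_left_comm])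

@[simp] lemma pairDual_tmul (φ ψ : Fun D) (X Y : Uq D) :
    pairDual D (φ ⊗ₜ ψ) X Y = φ.1 X * ψ.1 Y := rfl

lemma pairDual_injective : Function.Injective (pairDual D) := by
  classical
  refine (injective_iff_map_eq_zero _).2 fun x hx => ?_
  let b := Module.Basis.ofVectorSpace ℂ (Fun D)
  have key : ∀ (X : Uq D) (y : Fun D ⊗[ℂ] Fun D),
      ((TensorProduct.equivFinsuppOfBasisRight b y).sum fun k h => h.1 X • b k).1 = pairDual D y X := by
    intro X y
    induction y using TensorProduct.induction_on with
    | zero => simp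
    | add y z hy hz =>
      rw [map_add, Finsupp.sum_add_index', Submodule.coe_add, hy, hz, map_add, LinearMap.add_apply]
      · intro k; simp
      · intro k h h'; simp [add_smul]
    | tmul φ ψ =>
      ext Y
      rw [pairDual_tmul]
      have h1 : (b.repr ψ).sum (fun k c => c • b k) = ψ := b.linearCombination_repr ψ
      have h2 : (TensorProduct.equivFinsuppOfBasisRight b (φ ⊗ₜ[ℂ] ψ)) =
          (b.repr ψ).mapRange (fun c => c • φ) (by simp) := by
        ext k; simp
      rw [h2, Finsupp.sum_mapRange_index (by simp)]
      conv_rhs => rw [← h1]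
      simp [Finsupp.sum, Finset.mul_sum, mul_assoc, mul_comm]
  apply (TensorProduct.equivFinsuppOfBasisRight b).injective
  rw [map_zero]
  ext1 k
  ext X
  have h := key X x
  rw [hx, LinearMap.zero_apply, Submodule.coe_eq_zero] at h
  have h' := congrArg (fun z => b.repr z k) h
  by_cases h0 : TensorProduct.equivFinsuppOfBasisRight b x k = 0
  · rw [h0]; rfl
  · have h2 : ¬ TensorProduct.equivFinsuppOfBasisRight b x k = 0 →
        (TensorProduct.equivFinsuppOfBasisRight b x k).1 X = 0 := by
      simpa [Finsupp.sum, Finsupp.single_apply] using h'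
    exact h2 h0

/-- For every `φ` in the function algebra, `(X, Y) ↦ φ(XY)` is given by a tensor. -/
lemma exists_comul (φ : Fun D) : ∃ y, ∀ X Y, pairDual D y X Y = φ.1 (X * Y) := by
  obtain ⟨φ, hφ⟩ := φ
  induction hφ using Submodule.span_induction with
  | zero => exact ⟨0, by simp⟩
  | add φ ψ _ _ h1 h2 =>
    obtain ⟨y, hy⟩ := h1
    obtain ⟨z, hz⟩ := h2
    exact ⟨y + z, fun X Y => by simp [hy, hz]⟩
  | smul c φ _ h =>
    obtain ⟨y, hy⟩ := h
    exact ⟨c • y, fun X Y => by simp [hy]⟩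
  | mem φ h =>
    obtain ⟨n, ρ, f, v, h1, h2, rfl⟩ := h
    let b := Pi.basisFun ℂ (Fin n)
    have hm : ∀ f v, matCoeff ρ f v ∈ Fun D := fun f v =>
      Submodule.subset_span ⟨n, ρ, f, v, h1, h2, rfl⟩
    refine ⟨∑ k, (⟨matCoeff ρ f (b k), hm _ _⟩ : Fun D) ⊗ₜ ⟨matCoeff ρ (b.coord k) v, hm _ _⟩, ?_⟩
    intro X Y
    simp only [map_sum, LinearMap.sum_apply, pairDual_tmul, matCoeff_apply]
    rw [map_mul, Module.End.mul_apply]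
    conv_rhs => rw [← b.sum_repr (ρ Y v)]
    rw [map_sum, map_sum]
    refine Finset.sum_congr rfl fun k _ => ?_
    simp [mul_comm]

/-- The comultiplication `Δ`, determined by `Δ(φ)(X ⊗ Y) = φ(XY)`. -/
def comul : Fun D →ₗ[ℂ] Fun D ⊗[ℂ] Fun D where
  toFun φ := (exists_comul D φ).choose
  map_add' φ ψ := by
    refine pairDual_injective D ?_
    ext X Y
    rw [map_add, LinearMap.add_apply, LinearMap.add_apply, (exists_comul D _).choose_spec,
      (exists_comul D _).choose_spec, (exists_comul D _).choose_spec]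
    rfl
  map_smul' c φ := by
    refine pairDual_injective D ?_
    ext X Y
    rw [RingHom.id_apply, map_smul, LinearMap.smul_apply, LinearMap.smul_apply,
      (exists_comul D _).choose_spec, (exists_comul D _).choose_spec]
    rfl

lemma pairDual_comul (φ : Fun D) (X Y : Uq D) : pairDual D (comul D φ) X Y = φ.1 (X * Y) :=
  (exists_comul D φ).choose_spec X Y

/-- The counit `φ ↦ φ(1)` of the function algebra. -/
def funCounit : Fun D →ₗ[ℂ] ℂ := LinearMap.applyₗ 1 ∘ₗ (Fun D).subtype

/-- The subalgebra of the Levi factor, generated by all `K_i^{±1}` and the `X_i^±` with `i ∈ S`. -/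
def levi (S : Set ι) : Subalgebra ℂ (Uq D) :=
  Algebra.adjoin ℂ (Uq.gen D '' {x | match x with
    | .K _ => True
    | .Kinv _ => True
    | .E i => i ∈ S
    | .F i => i ∈ S})

/-- The quantized function algebra `ℂ_q[U/K_S]`: those `φ` with `X.φ = ε(X) φ` for all `X` in the
Levi subalgebra, where `(X.φ)(Y) = φ(YX)`. -/
def flagFun (S : Set ι) : Submodule ℂ (Fun D) where
  carrier := {φ | ∀ X ∈ levi D S, ∀ Y, φ.1 (Y * X) = Uq.counit D X * φ.1 Y}
  zero_mem' := by intro X _ Y; simp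
  add_mem' := by
    intro φ ψ h1 h2 X hX Y
    simp [h1 X hX Y, h2 X hX Y, mul_add]
  smul_mem' := by
    intro c φ h X hX Y
    simp [h X hX Y, mul_left_comm]

/-! ### The one-dimensional representations -/

section torus

/-- The invertible element `K_i`. -/
def Uq.Kunit (i : ι) : (Uq D)ˣ :=
  ⟨Uq.gen D (.K i), Uq.gen D (.Kinv i), Uq.K_Kinv D i, Uq.Kinv_K D i⟩

lemma Uq.commute_Kunit : Pairwise fun i j => ∀ x y : Multiplicative ℤ,
    Commute (zpowersHom (Uq D)ˣ (Uq.Kunit D i) x) (zpowersHom (Uq D)ˣ (Uq.Kunit D j) y) := by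
  intro i j _ x y
  have : Commute (Uq.Kunit D i) (Uq.Kunit D j) := Units.ext (Uq.K_comm D i j)
  exact this.zpow_zpow _ _

variable [Fintype ι]

/-- The homomorphism `σ = ∑ n_i α_i ↦ K^σ = ∏ K_i^{n_i}` from the root lattice. -/
def torusHom : (ι → Multiplicative ℤ) →* Uq D :=
  (Units.coeHom (Uq D)).comp <|
    MonoidHom.noncommPiCoprod (fun i => zpowersHom (Uq D)ˣ (Uq.Kunit D i)) (Uq.commute_Kunit D)

/-- The character `φ_μ(K^σ) = q^{(μ,σ)}`, i.e. `∏ K_i^{n_i} ↦ ∏ q_i^{μ(H_i) n_i}`. -/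
def torusChar (μ : ι → ℤ) : (ι → Multiplicative ℤ) →* ℂ where
  toFun n := ∏ i, (D.qc i ^ μ i) ^ (n i).toAdd
  map_one' := by simp
  map_mul' n m := by
    rw [← Finset.prod_mul_distrib]
    refine Finset.prod_congr rfl fun i _ => ?_
    rw [Pi.mul_apply, toAdd_mul, zpow_add₀ (zpow_ne_zero _ (D.qc_ne i))]

lemma torusChar_injective : Function.Injective (torusChar D) := by
  classical
  intro μ ν h
  funext i
  have h1 := DFunLike.congr_fun h (Pi.mulSingle i (Multiplicative.ofAdd 1))
  simp only [torusChar, MonoidHom.coe_mk, OneHom.coe_mk] at h1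
  rw [Finset.prod_eq_single i, Finset.prod_eq_single i] at h1
  · simp only [Pi.mulSingle_eq_same, toAdd_ofAdd, zpow_one, Datum.qc] at h1
    have h2 : ((D.q i : ℝ)) ^ μ i = (D.q i : ℝ) ^ ν i := by exact_mod_cast h1
    exact zpow_right_injective₀ (D.q i).2.1 (D.q i).2.2.ne h2
  all_goals simp +contextual [Pi.mulSingle_eq_of_ne]

lemma linearIndependent_torusChar :
    LinearIndependent ℂ (fun μ : ι → ℤ => (torusChar D μ : (ι → Multiplicative ℤ) → ℂ)) :=
  (linearIndependent_monoidHom (ι → Multiplicative ℤ) ℂ).comp _ (torusChar_injective D)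

/-- The space `ℂ_q[T]` spanned by the characters `φ_μ`. -/
def torusFun : Submodule ℂ ((ι → Multiplicative ℤ) → ℂ) :=
  Submodule.span ℂ (Set.range fun μ : ι → ℤ => (torusChar D μ : (ι → Multiplicative ℤ) → ℂ))

lemma torusHom_apply_weight {V : Type*} [AddCommGroup V] [Module ℂ V]
    (ρ : Uq D →ₐ[ℂ] Module.End ℂ V) {μ : ι → ℤ} {v : V} (hv : v ∈ weightSpace ρ μ)
    (g : ι → Multiplicative ℤ) : ρ (torusHom D g) v = torusChar D μ g • v := by
  classical
  have hK : ∀ i (k : ℤ), ρ (((Uq.Kunit D i) ^ k : (Uq D)ˣ) : Uq D) v = (D.qc i ^ μ i) ^ k • v := by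
    intro i
    have h1 : ρ (Uq.Kunit D i : Uq D) v = D.qc i ^ μ i • v :=
      Module.End.mem_eigenspace_iff.1 ((Submodule.mem_iInf _).1 hv i)
    have hne : D.qc i ^ μ i ≠ 0 := zpow_ne_zero _ (D.qc_ne i)
    have h2 : ρ (((Uq.Kunit D i)⁻¹ : (Uq D)ˣ) : Uq D) v = (D.qc i ^ μ i)⁻¹ • v := by
      have h3 : ρ (((Uq.Kunit D i)⁻¹ : (Uq D)ˣ) : Uq D) (ρ (Uq.Kunit D i : Uq D) v) = v := by
        rw [← Module.End.mul_apply, ← map_mul, Units.inv_mul, map_one, Module.End.one_apply]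
      rw [h1, map_smul] at h3
      rw [← h3, smul_smul, inv_mul_cancel₀ hne, one_smul, h3]
    intro k
    induction k using Int.induction_on with
    | zero => simp
    | succ k ih =>
      rw [zpow_add, zpow_one, Units.val_mul, map_mul, Module.End.mul_apply, h1, map_smul, ih,
        smul_smul, zpow_add₀ hne, zpow_one, mul_comm]
    | pred k ih =>
      rw [zpow_sub, zpow_one, Units.val_mul, map_mul, Module.End.mul_apply, h2, map_smul, ih,
        smul_smul, zpow_sub₀ hne, zpow_one, div_eq_mul_inv, mul_comm]
  have main : ∀ g : ι → Multiplicative ℤ, ∀ s : Finset ι,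
      ρ (torusHom D (∏ i ∈ s, Pi.mulSingle i (g i))) v =
        torusChar D μ (∏ i ∈ s, Pi.mulSingle i (g i)) • v := by
    intro g s
    induction s using Finset.induction_on with
    | empty => simp
    | insert i s hi ih =>
      rw [Finset.prod_insert hi, map_mul, map_mul, map_mul, Module.End.mul_apply, ih, map_smul]
      have e1 : torusHom D (Pi.mulSingle i (g i)) =
          (((Uq.Kunit D i) ^ (g i).toAdd : (Uq D)ˣ) : Uq D) := by
        exact congrArg Units.val (MonoidHom.noncommPiCoprod_mulSingle
          (fun i => zpowersHom (Uq D)ˣ (Uq.Kunit D i)) (hcomm := Uq.commute_Kunit D) i (g i))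
      have e2 : torusChar D μ (Pi.mulSingle i (g i)) = (D.qc i ^ μ i) ^ (g i).toAdd := by
        simp only [torusChar, MonoidHom.coe_mk, OneHom.coe_mk]
        rw [Finset.prod_eq_single i]
        · simp
        all_goals simp +contextual [Pi.mulSingle_eq_of_ne]
      rw [e1, hK, e2, smul_smul, mul_comm]
  have := main g Finset.univ
  rwa [Finset.univ_prod_mulSingle] at this

/-- The restriction map `ι_T^* : ℂ_q[U] → ℂ_q[T]`. -/
def resTorus : Fun D →ₗ[ℂ] torusFun D :=
  LinearMap.codRestrict (torusFun D)
    ((LinearMap.pi fun g => LinearMap.applyₗ (torusHom D g)) ∘ₗ (Fun D).subtype) <| by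
    rintro ⟨φ, hφ⟩
    induction hφ using Submodule.span_induction with
    | zero => exact (torusFun D).zero_mem
    | add φ ψ _ _ h1 h2 => exact (torusFun D).add_mem h1 h2
    | smul c φ _ h => exact (torusFun D).smul_mem c h
    | mem φ h =>
      obtain ⟨n, ρ, f, v, -, h2, rfl⟩ := h
      have hv : v ∈ ⨆ μ, weightSpace ρ μ := by
        rw [show (⨆ μ, weightSpace ρ μ) = ⊤ from h2]
        trivial
      change (fun g => f (ρ (torusHom D g) v)) ∈ torusFun D
      induction hv using Submodule.iSup_induction' with
      | zero =>
        convert (torusFun D).zero_mem using 1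
        ext g; simp
      | add v w _ _ h1 h2 =>
        convert (torusFun D).add_mem h1 h2 using 1
        ext g; simp
      | mem μ v hv =>
        have : (fun g => f (ρ (torusHom D g) v)) = f v • (torusChar D μ : (ι → Multiplicative ℤ) → ℂ) := by
          funext g
          rw [torusHom_apply_weight D ρ hv, map_smul]
          simp [mul_comm]
        rw [this]
        exact (torusFun D).smul_mem _ (Submodule.subset_span ⟨μ, rfl⟩)

/-- The one-dimensional representation `φ_μ ↦ t^μ = ∏ t_i^{m_i}` (`μ = ∑ m_i ϖ_i`) of `ℂ_q[T]`. -/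
def torusEval (t : ι → Circle) : torusFun D →ₗ[ℂ] ℂ :=
  (Module.Basis.span (linearIndependent_torusChar D)).constr ℂ fun μ => ∏ i, (t i : ℂ) ^ μ i

/-- The one-dimensional representation `τ_t` of `ℂ_q[U]`. -/
def tau (t : ι → Circle) : Fun D →ₗ[ℂ] ℂ := torusEval D t ∘ₗ resTorus D

end torus

end

/-! ### The case of `𝔰𝔩₂` -/

section sl2

/-- The relations between the operators `K`, `K⁻¹`, `E`, `F` of quantized `𝔰𝔩₂`. -/
structure IsTriple (q : ℂ) {A : Type*} [Ring A] [Algebra ℂ A] (k k' e f : A) : Prop where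
  kk' : k * k' = 1
  k'k : k' * k = 1
  ke : k * e = q ^ 2 • (e * k)
  kf : k * f = q⁻¹ ^ 2 • (f * k)
  ef : e * f - f * e = (q - q⁻¹)⁻¹ • (k - k')

section triple
variable {q : ℂ} {A : Type*} [Ring A] [Algebra ℂ A] {k k' e f : A}

lemma IsTriple.k'e (h : IsTriple q k k' e f) (hq : q ≠ 0) : k' * e = q⁻¹ ^ 2 • (e * k') := by
  have h1 : k' * (k * e) * k' = k' * (q ^ 2 • (e * k)) * k' := by rw [h.ke]
  rw [← mul_assoc, h.k'k, one_mul, mul_smul_comm, smul_mul_assoc, ← mul_assoc, mul_assoc _ k k',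
    h.kk', mul_one] at h1
  rw [h1, smul_smul, ← mul_pow, inv_mul_cancel₀ hq, one_pow, one_smul]

lemma IsTriple.k'f (h : IsTriple q k k' e f) (hq : q ≠ 0) : k' * f = q ^ 2 • (f * k') := by
  have h1 : k' * (k * f) * k' = k' * (q⁻¹ ^ 2 • (f * k)) * k' := by rw [h.kf]
  rw [← mul_assoc, h.k'k, one_mul, mul_smul_comm, smul_mul_assoc, ← mul_assoc, mul_assoc _ k k',
    h.kk', mul_one] at h1
  rw [h1, smul_smul, ← mul_pow, mul_inv_cancel₀ hq, one_pow, one_smul]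

lemma IsTriple.symm (h : IsTriple q k k' e f) (hq : q ≠ 0) : IsTriple q k' k f e where
  kk' := h.k'k
  k'k := h.kk'
  ke := h.k'f hq
  kf := h.k'e hq
  ef := by rw [← neg_sub, h.ef, ← smul_neg, neg_sub]

lemma IsTriple.map (h : IsTriple q k k' e f) {B : Type*} [Ring B] [Algebra ℂ B] (φ : A →ₐ[ℂ] B) :
    IsTriple q (φ k) (φ k') (φ e) (φ f) where
  kk' := by rw [← map_mul, h.kk', map_one]
  k'k := by rw [← map_mul, h.k'k, map_one]
  ke := by rw [← map_mul, h.ke, map_smul, map_mul]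
  kf := by rw [← map_mul, h.kf, map_smul, map_mul]
  ef := by rw [← map_mul, ← map_mul, ← map_sub, h.ef, map_smul, map_sub]

open Algebra.TensorProduct in
lemma IsTriple.tensor (h : IsTriple q k k' e f) (hq : q ≠ 0) :
    IsTriple q (k ⊗ₜ[ℂ] k) (k' ⊗ₜ[ℂ] k') (e ⊗ₜ[ℂ] (1 : A) + k ⊗ₜ e) (f ⊗ₜ[ℂ] k' + (1 : A) ⊗ₜ f) where
  kk' := by rw [tmul_mul_tmul, h.kk']; rfl
  k'k := by rw [tmul_mul_tmul, h.k'k]; rfl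
  ke := by
    simp only [mul_add, add_mul, tmul_mul_tmul, h.ke, smul_add, mul_one, one_mul,
      TensorProduct.smul_tmul', TensorProduct.tmul_smul]
  kf := by
    simp only [mul_add, add_mul, tmul_mul_tmul, h.kf, h.kk', h.k'k, smul_add, mul_one, one_mul,
      TensorProduct.smul_tmul', TensorProduct.tmul_smul]
  ef := by
    have h1 : (k * f) ⊗ₜ[ℂ] (e * k') = (f * k) ⊗ₜ[ℂ] (k' * e) := by
      rw [h.kf, h.k'e hq, ← TensorProduct.smul_tmul', TensorProduct.tmul_smul]
    have h2 : e * f = f * e + (q - q⁻¹)⁻¹ • (k - k') := by rw [← h.ef]; abel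
    simp only [mul_add, add_mul, tmul_mul_tmul, mul_one, one_mul, h1, h2, TensorProduct.add_tmul,
      TensorProduct.tmul_add, TensorProduct.sub_tmul, TensorProduct.tmul_sub,
      ← TensorProduct.smul_tmul', TensorProduct.tmul_smul, smul_sub]
    abel

end triple

lemma Uq.triple {ι : Type*} (D : Datum ι) (i : ι) : IsTriple (D.qc i) (Uq.gen D (.K i))
    (Uq.gen D (.Kinv i)) (Uq.gen D (.E i)) (Uq.gen D (.F i)) where
  kk' := Uq.K_Kinv D i
  k'k := Uq.Kinv_K D i
  ke := by
    have h := congrArg (· * Uq.gen D (.K i)) (Uq.KE D i i)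
    simpa only [mul_assoc, Uq.Kinv_K, mul_one, D.a_self, smul_mul_assoc, zpow_ofNat] using h
  kf := by
    have h := congrArg (· * Uq.gen D (.K i)) (Uq.KF D i i)
    simpa only [mul_assoc, Uq.Kinv_K, mul_one, D.a_self, smul_mul_assoc, zpow_neg, zpow_ofNat,
      ← inv_pow] using h
  ef := Uq.EF D i

/-- The datum of `𝔰𝔩₂`. -/
def sl2 (q : Set.Ioo (0 : ℝ) 1) : Datum Unit := ⟨fun _ _ => 2, fun _ => q, fun _ => rfl⟩

/-- A quadruple of elements satisfying the relations of quantized `𝔰𝔩₂` defines a homomorphism. -/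
def sl2Lift {q : Set.Ioo (0 : ℝ) 1} {A : Type*} [Ring A] [Algebra ℂ A] {k k' e f : A}
    (h : IsTriple ((q : ℝ) : ℂ) k k' e f) : Uq (sl2 q) →ₐ[ℂ] A :=
  Uq.lift (sl2 q) (fun x => match x with | .K _ => k | .Kinv _ => k' | .E _ => e | .F _ => f) <| by
    intro x y hxy
    have hq : (sl2 q).qc () = ((q : ℝ) : ℂ) := rfl
    cases hxy with
    | KK => simp
    | KKinv => simp [h.kk']
    | KinvK => simp [h.k'k]
    | KE =>
      rw [map_mul, map_mul, map_smul]
      simp only [FreeAlgebra.lift_ι_apply]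
      rw [h.ke, smul_mul_assoc, mul_assoc, h.kk', mul_one]
      exact congrArg (· • e) (zpow_ofNat _ 2).symm
    | KF =>
      rw [map_mul, map_mul, map_smul]
      simp only [FreeAlgebra.lift_ι_apply]
      rw [h.kf, smul_mul_assoc, mul_assoc, h.kk', mul_one]
      refine congrArg (· • f) ?_
      change _ = ((q : ℝ) : ℂ) ^ (-2 : ℤ)
      rw [zpow_neg, zpow_ofNat, inv_pow]
    | EF_self => simp [h.ef, hq]
    | EF_ne i j hij => exact absurd rfl hij
    | serreE i j hij => exact absurd rfl hij
    | serreF i j hij => exact absurd rfl hij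

section lift
variable {q : Set.Ioo (0 : ℝ) 1} {A : Type*} [Ring A] [Algebra ℂ A] {k k' e f : A}
    (h : IsTriple ((q : ℝ) : ℂ) k k' e f)

@[simp] lemma sl2Lift_K : sl2Lift h (Uq.gen (sl2 q) (.K ())) = k := Uq.lift_gen _ _ _ _
@[simp] lemma sl2Lift_Kinv : sl2Lift h (Uq.gen (sl2 q) (.Kinv ())) = k' := Uq.lift_gen _ _ _ _
@[simp] lemma sl2Lift_E : sl2Lift h (Uq.gen (sl2 q) (.E ())) = e := Uq.lift_gen _ _ _ _
@[simp] lemma sl2Lift_F : sl2Lift h (Uq.gen (sl2 q) (.F ())) = f := Uq.lift_gen _ _ _ _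

end lift

variable (q : Set.Ioo (0 : ℝ) 1)

lemma sl2_hom_ext {A : Type*} [Semiring A] [Algebra ℂ A] {f g : Uq (sl2 q) →ₐ[ℂ] A}
    (hK : f (Uq.gen _ (.K ())) = g (Uq.gen _ (.K ())))
    (hK' : f (Uq.gen _ (.Kinv ())) = g (Uq.gen _ (.Kinv ())))
    (hE : f (Uq.gen _ (.E ())) = g (Uq.gen _ (.E ())))
    (hF : f (Uq.gen _ (.F ())) = g (Uq.gen _ (.F ()))) : f = g := by
  refine Uq.hom_ext fun x => ?_
  cases x <;> assumption

lemma qc_ne_zero : ((q : ℝ) : ℂ) ≠ 0 := by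
  have := q.2.1
  exact_mod_cast this.ne'

lemma sl2_triple : IsTriple ((q : ℝ) : ℂ) (Uq.gen (sl2 q) (.K ())) (Uq.gen (sl2 q) (.Kinv ()))
    (Uq.gen (sl2 q) (.E ())) (Uq.gen (sl2 q) (.F ())) := Uq.triple (sl2 q) ()

/-- The comultiplication: `Δ(K) = K ⊗ K`, `Δ(E) = E ⊗ 1 + K ⊗ E`, `Δ(F) = F ⊗ K⁻¹ + 1 ⊗ F`. -/
def sl2Comul : Uq (sl2 q) →ₐ[ℂ] Uq (sl2 q) ⊗[ℂ] Uq (sl2 q) :=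
  sl2Lift ((sl2_triple q).tensor (qc_ne_zero q))

lemma sl2Comul_K : sl2Comul q (Uq.gen (sl2 q) (.K ())) =
    Uq.gen (sl2 q) (.K ()) ⊗ₜ Uq.gen (sl2 q) (.K ()) := sl2Lift_K _
lemma sl2Comul_Kinv : sl2Comul q (Uq.gen (sl2 q) (.Kinv ())) =
    Uq.gen (sl2 q) (.Kinv ()) ⊗ₜ Uq.gen (sl2 q) (.Kinv ()) := sl2Lift_Kinv _
lemma sl2Comul_E : sl2Comul q (Uq.gen (sl2 q) (.E ())) =
    Uq.gen (sl2 q) (.E ()) ⊗ₜ 1 + Uq.gen (sl2 q) (.K ()) ⊗ₜ Uq.gen (sl2 q) (.E ()) := sl2Lift_E _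
lemma sl2Comul_F : sl2Comul q (Uq.gen (sl2 q) (.F ())) =
    Uq.gen (sl2 q) (.F ()) ⊗ₜ Uq.gen (sl2 q) (.Kinv ()) + 1 ⊗ₜ Uq.gen (sl2 q) (.F ()) := sl2Lift_F _

@[simp] lemma counit_K {ι : Type*} (D : Datum ι) (i : ι) : Uq.counit D (Uq.gen D (.K i)) = 1 :=
  Uq.lift_gen _ _ _ _
@[simp] lemma counit_Kinv {ι : Type*} (D : Datum ι) (i : ι) :
    Uq.counit D (Uq.gen D (.Kinv i)) = 1 := Uq.lift_gen _ _ _ _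
@[simp] lemma counit_E {ι : Type*} (D : Datum ι) (i : ι) : Uq.counit D (Uq.gen D (.E i)) = 0 :=
  Uq.lift_gen _ _ _ _
@[simp] lemma counit_F {ι : Type*} (D : Datum ι) (i : ι) : Uq.counit D (Uq.gen D (.F i)) = 0 :=
  Uq.lift_gen _ _ _ _

instance : Bialgebra ℂ (Uq (sl2 q)) :=
  Bialgebra.ofAlgHom (sl2Comul q) (Uq.counit (sl2 q))
    (by
      apply sl2_hom_ext <;>
        simp [sl2Comul_K, sl2Comul_Kinv, sl2Comul_E, sl2Comul_F, TensorProduct.add_tmul,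
          TensorProduct.tmul_add, Algebra.TensorProduct.one_def, add_assoc])
    (by
      apply sl2_hom_ext <;>
        simp [sl2Comul_K, sl2Comul_Kinv, sl2Comul_E, sl2Comul_F])
    (by
      apply sl2_hom_ext <;>
        simp [sl2Comul_K, sl2Comul_Kinv, sl2Comul_E, sl2Comul_F])

lemma comul_eq (X : Uq (sl2 q)) : Coalgebra.comul (R := ℂ) X = sl2Comul q X := rfl
lemma counit_eq (X : Uq (sl2 q)) : Coalgebra.counit (R := ℂ) X = Uq.counit (sl2 q) X := rfl

/-- The linear dual of quantized `𝔰𝔩₂`, with the product `(φψ)(X) = (φ ⊗ ψ)(Δ X)`. -/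
abbrev SlDual : Type := WithConv (Uq (sl2 q) →ₗ[ℂ] ℂ)

/-- The two-dimensional irreducible representation `V(ϖ₁)` in a basis of weight vectors of weights
`ϖ₁`, `-ϖ₁`. -/
def vecRep : Uq (sl2 q) →ₐ[ℂ] Matrix (Fin 2) (Fin 2) ℂ :=
  sl2Lift (k := !![((q : ℝ) : ℂ), 0; 0, ((q : ℝ) : ℂ)⁻¹])
    (k' := !![((q : ℝ) : ℂ)⁻¹, 0; 0, ((q : ℝ) : ℂ)]) (e := !![0, 1; 0, 0]) (f := !![0, 0; 1, 0]) <| by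
    have hq := qc_ne_zero q
    have hq2 : ((q : ℝ) : ℂ) - ((q : ℝ) : ℂ)⁻¹ ≠ 0 := by
      intro h
      have h0 := q.2.1
      have h1 := q.2.2
      have h2 : (q : ℝ) - (q : ℝ)⁻¹ = 0 := by exact_mod_cast h
      have h3 : 1 < (q : ℝ)⁻¹ := (one_lt_inv₀ h0).2 h1
      linarith
    constructor
    · ext i j; fin_cases i <;> fin_cases j <;> simp [hq]
    · ext i j; fin_cases i <;> fin_cases j <;> simp [hq]
    · ext i j; fin_cases i <;> fin_cases j <;> simp
      field_simp
    · ext i j; fin_cases i <;> fin_cases j <;> simp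
      field_simp
    · ext i j; fin_cases i <;> fin_cases j <;> simp
      · rw [inv_mul_cancel₀ hq2]
      · rw [eq_comm, inv_mul_eq_iff_eq_mul₀ hq2]; ring

/-- The matrix coefficient `t_{ij}` of the two-dimensional representation. -/
def tCoeff (i j : Fin 2) : SlDual q :=
  WithConv.toConv ((Matrix.entryLinearMap ℂ ℂ i j) ∘ₗ (vecRep q).toLinearMap)

end sl2

section dual
variable (q : Set.Ioo (0 : ℝ) 1)

lemma Uq.adjoin_gen {ι : Type*} (D : Datum ι) : Algebra.adjoin ℂ (Set.range (Uq.gen D)) = ⊤ := by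
  have h : Set.range (Uq.gen D) = RingQuot.mkAlgHom ℂ (Rel D) '' Set.range (FreeAlgebra.ι ℂ) := by
    rw [← Set.range_comp]; rfl
  rw [h]
  refine (AlgHom.map_adjoin (RingQuot.mkAlgHom ℂ (Rel D)) _).symm.trans ?_
  rw [FreeAlgebra.adjoin_range_ι, Algebra.map_top]
  exact (AlgHom.range_eq_top _).2 (RingQuot.mkAlgHom_surjective ℂ (Rel D))

variable {q} in
lemma sl2_mem (S : Subalgebra ℂ (Uq (sl2 q))) (hK : Uq.gen _ (.K ()) ∈ S)
    (hK' : Uq.gen _ (.Kinv ()) ∈ S) (hE : Uq.gen _ (.E ()) ∈ S) (hF : Uq.gen _ (.F ()) ∈ S)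
    (X : Uq (sl2 q)) : X ∈ S := by
  have : (⊤ : Subalgebra ℂ (Uq (sl2 q))) ≤ S := by
    rw [← Uq.adjoin_gen, Algebra.adjoin_le_iff]
    rintro _ ⟨x, rfl⟩
    cases x <;> assumption
  exact this trivial

/-- The left action `(X.φ)(Y) = φ(YX)`. -/
def lact : Uq (sl2 q) →ₐ[ℂ] Module.End ℂ (SlDual q) :=
  AlgHom.ofLinearMap
    (LinearMap.mk₂ ℂ (fun X φ => WithConv.toConv (φ.ofConv ∘ₗ LinearMap.mulRight ℂ X))
      (fun _ _ _ => by ext; simp [mul_add]) (fun _ _ _ => by ext; simp)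
      (fun _ _ _ => by ext; simp) (fun _ _ _ => by ext; simp))
    (by ext; simp) (fun X Y => by ext; simp [mul_assoc])

/-- The right action `(φ.X)(Y) = φ(XY)`. -/
def ract (X : Uq (sl2 q)) : SlDual q →ₗ[ℂ] SlDual q where
  toFun φ := WithConv.toConv (φ.ofConv ∘ₗ LinearMap.mulLeft ℂ X)
  map_add' _ _ := by ext; simp
  map_smul' _ _ := by ext; simp

variable {q}

@[simp] lemma lact_apply (X Y : Uq (sl2 q)) (φ : SlDual q) : lact q X φ Y = φ (Y * X) := rfl
@[simp] lemma ract_apply (X Y : Uq (sl2 q)) (φ : SlDual q) : ract q X φ Y = φ (X * Y) := rfl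

lemma dual_mul_apply (φ ψ : SlDual q) (X : Uq (sl2 q)) : (φ * ψ) X =
    LinearMap.mul' ℂ ℂ (TensorProduct.map φ.ofConv ψ.ofConv (sl2Comul q X)) := rfl

lemma pair_mul_tmul (φ ψ : SlDual q) (T : Uq (sl2 q) ⊗[ℂ] Uq (sl2 q)) (X Y : Uq (sl2 q)) :
    LinearMap.mul' ℂ ℂ (TensorProduct.map φ.ofConv ψ.ofConv (T * X ⊗ₜ Y)) =
    LinearMap.mul' ℂ ℂ (TensorProduct.map (lact q X φ).ofConv (lact q Y ψ).ofConv T) := by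
  induction T using TensorProduct.induction_on with
  | zero => simp
  | add S T h1 h2 => simp only [add_mul, map_add, h1, h2]
  | tmul a b => rw [Algebra.TensorProduct.tmul_mul_tmul]; rfl

lemma pair_tmul_mul (φ ψ : SlDual q) (T : Uq (sl2 q) ⊗[ℂ] Uq (sl2 q)) (X Y : Uq (sl2 q)) :
    LinearMap.mul' ℂ ℂ (TensorProduct.map φ.ofConv ψ.ofConv (X ⊗ₜ Y * T)) =
    LinearMap.mul' ℂ ℂ (TensorProduct.map (ract q X φ).ofConv (ract q Y ψ).ofConv T) := by
  induction T using TensorProduct.induction_on with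
  | zero => simp
  | add S T h1 h2 => simp only [mul_add, map_add, h1, h2]
  | tmul a b => rw [Algebra.TensorProduct.tmul_mul_tmul]; rfl

lemma lact_one_apply (X : Uq (sl2 q)) (φ : SlDual q) : lact q X φ 1 = φ X := by simp

local notation "sK" => Uq.gen (sl2 q) (Gen.K ())
local notation "sL" => Uq.gen (sl2 q) (Gen.Kinv ())
local notation "sE" => Uq.gen (sl2 q) (Gen.E ())
local notation "sF" => Uq.gen (sl2 q) (Gen.F ())

lemma dual_mul_one_apply (φ ψ : SlDual q) : (φ * ψ) 1 = φ 1 * ψ 1 := by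
  rw [dual_mul_apply, map_one, Algebra.TensorProduct.one_def]; rfl

lemma dual_one_apply (X : Uq (sl2 q)) : (1 : SlDual q) X = Uq.counit _ X := rfl

lemma lact_K_mul (φ ψ : SlDual q) : lact q sK (φ * ψ) = lact q sK φ * lact q sK ψ := by
  ext X
  change (φ * ψ) (X * sK) = _
  rw [dual_mul_apply, map_mul, sl2Comul_K, pair_mul_tmul]; rfl

lemma lact_K'_mul (φ ψ : SlDual q) : lact q sL (φ * ψ) = lact q sL φ * lact q sL ψ := by
  ext X
  change (φ * ψ) (X * sL) = _
  rw [dual_mul_apply, map_mul, sl2Comul_Kinv, pair_mul_tmul]; rfl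

lemma lact_E_mul (φ ψ : SlDual q) :
    lact q sE (φ * ψ) = lact q sE φ * ψ + lact q sK φ * lact q sE ψ := by
  ext X
  change (φ * ψ) (X * sE) = _
  rw [dual_mul_apply, map_mul, sl2Comul_E, mul_add, map_add, map_add, pair_mul_tmul,
    pair_mul_tmul, map_one]; rfl

lemma lact_F_mul (φ ψ : SlDual q) :
    lact q sF (φ * ψ) = lact q sF φ * lact q sL ψ + φ * lact q sF ψ := by
  ext X
  change (φ * ψ) (X * sF) = _
  rw [dual_mul_apply, map_mul, sl2Comul_F, mul_add, map_add, map_add, pair_mul_tmul,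
    pair_mul_tmul, map_one]; rfl

lemma ract_one (φ : SlDual q) : ract q 1 φ = φ := by ext; simp

lemma ract_K_mul (φ ψ : SlDual q) : ract q sK (φ * ψ) = ract q sK φ * ract q sK ψ := by
  ext X
  change (φ * ψ) (sK * X) = _
  rw [dual_mul_apply, map_mul, sl2Comul_K, pair_tmul_mul]; rfl

lemma ract_K'_mul (φ ψ : SlDual q) : ract q sL (φ * ψ) = ract q sL φ * ract q sL ψ := by
  ext X
  change (φ * ψ) (sL * X) = _
  rw [dual_mul_apply, map_mul, sl2Comul_Kinv, pair_tmul_mul]; rfl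

lemma ract_E_mul (φ ψ : SlDual q) :
    ract q sE (φ * ψ) = ract q sE φ * ψ + ract q sK φ * ract q sE ψ := by
  ext X
  change (φ * ψ) (sE * X) = _
  rw [dual_mul_apply, map_mul, sl2Comul_E, add_mul, map_add, map_add, pair_tmul_mul,
    pair_tmul_mul, ract_one]; rfl

lemma ract_F_mul (φ ψ : SlDual q) :
    ract q sF (φ * ψ) = ract q sF φ * ract q sL ψ + φ * ract q sF ψ := by
  ext X
  change (φ * ψ) (sF * X) = _
  rw [dual_mul_apply, map_mul, sl2Comul_F, add_mul, map_add, map_add, pair_tmul_mul,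
    pair_tmul_mul, ract_one]; rfl

lemma tCoeff_apply (i j : Fin 2) (X : Uq (sl2 q)) : tCoeff q i j X = vecRep q X i j := rfl

@[simp] lemma tCoeff_one (i j : Fin 2) : tCoeff q i j 1 = if i = j then 1 else 0 := by
  rw [tCoeff_apply, map_one, Matrix.one_apply]

lemma vecRep_K : vecRep q sK = !![((q : ℝ) : ℂ), 0; 0, ((q : ℝ) : ℂ)⁻¹] := sl2Lift_K _
lemma vecRep_K' : vecRep q sL = !![((q : ℝ) : ℂ)⁻¹, 0; 0, ((q : ℝ) : ℂ)] := sl2Lift_Kinv _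
lemma vecRep_E : vecRep q sE = !![0, 1; 0, 0] := sl2Lift_E _
lemma vecRep_F : vecRep q sF = !![0, 0; 1, 0] := sl2Lift_F _

lemma lact_K_0 (i : Fin 2) : lact q sK (tCoeff q i 0) = ((q : ℝ) : ℂ) • tCoeff q i 0 := by
  ext X; change vecRep q (X * _) i 0 = _ * vecRep q X i 0
  rw [map_mul, vecRep_K]; simp [Matrix.mul_apply, mul_comm]
lemma lact_K_1 (i : Fin 2) : lact q sK (tCoeff q i 1) = ((q : ℝ) : ℂ)⁻¹ • tCoeff q i 1 := by
  ext X; change vecRep q (X * _) i 1 = _ * vecRep q X i 1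
  rw [map_mul, vecRep_K]; simp [Matrix.mul_apply, mul_comm]
lemma lact_K'_0 (i : Fin 2) : lact q sL (tCoeff q i 0) = ((q : ℝ) : ℂ)⁻¹ • tCoeff q i 0 := by
  ext X; change vecRep q (X * _) i 0 = _ * vecRep q X i 0
  rw [map_mul, vecRep_K']; simp [Matrix.mul_apply, mul_comm]
lemma lact_K'_1 (i : Fin 2) : lact q sL (tCoeff q i 1) = ((q : ℝ) : ℂ) • tCoeff q i 1 := by
  ext X; change vecRep q (X * _) i 1 = _ * vecRep q X i 1
  rw [map_mul, vecRep_K']; simp [Matrix.mul_apply, mul_comm]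
lemma lact_E_0 (i : Fin 2) : lact q sE (tCoeff q i 0) = 0 := by
  ext X; change vecRep q (X * _) i 0 = 0
  rw [map_mul, vecRep_E]; simp [Matrix.mul_apply]
lemma lact_E_1 (i : Fin 2) : lact q sE (tCoeff q i 1) = tCoeff q i 0 := by
  ext X; change vecRep q (X * _) i 1 = vecRep q X i 0
  rw [map_mul, vecRep_E]; simp [Matrix.mul_apply]
lemma lact_F_0 (i : Fin 2) : lact q sF (tCoeff q i 0) = tCoeff q i 1 := by
  ext X; change vecRep q (X * _) i 0 = vecRep q X i 1
  rw [map_mul, vecRep_F]; simp [Matrix.mul_apply]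
lemma lact_F_1 (i : Fin 2) : lact q sF (tCoeff q i 1) = 0 := by
  ext X; change vecRep q (X * _) i 1 = 0
  rw [map_mul, vecRep_F]; simp [Matrix.mul_apply]

lemma ract_K_0 (j : Fin 2) : ract q sK (tCoeff q 0 j) = ((q : ℝ) : ℂ) • tCoeff q 0 j := by
  ext X; change vecRep q (_ * X) 0 j = _ * vecRep q X 0 j
  rw [map_mul, vecRep_K]; simp [Matrix.mul_apply]
lemma ract_K_1 (j : Fin 2) : ract q sK (tCoeff q 1 j) = ((q : ℝ) : ℂ)⁻¹ • tCoeff q 1 j := by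
  ext X; change vecRep q (_ * X) 1 j = _ * vecRep q X 1 j
  rw [map_mul, vecRep_K]; simp [Matrix.mul_apply]
lemma ract_K'_0 (j : Fin 2) : ract q sL (tCoeff q 0 j) = ((q : ℝ) : ℂ)⁻¹ • tCoeff q 0 j := by
  ext X; change vecRep q (_ * X) 0 j = _ * vecRep q X 0 j
  rw [map_mul, vecRep_K']; simp [Matrix.mul_apply]
lemma ract_K'_1 (j : Fin 2) : ract q sL (tCoeff q 1 j) = ((q : ℝ) : ℂ) • tCoeff q 1 j := by
  ext X; change vecRep q (_ * X) 1 j = _ * vecRep q X 1 j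
  rw [map_mul, vecRep_K']; simp [Matrix.mul_apply]
lemma ract_E_0 (j : Fin 2) : ract q sE (tCoeff q 0 j) = tCoeff q 1 j := by
  ext X; change vecRep q (_ * X) 0 j = vecRep q X 1 j
  rw [map_mul, vecRep_E]; simp [Matrix.mul_apply]
lemma ract_E_1 (j : Fin 2) : ract q sE (tCoeff q 1 j) = 0 := by
  ext X; change vecRep q (_ * X) 1 j = 0
  rw [map_mul, vecRep_E]; simp [Matrix.mul_apply]
lemma ract_F_0 (j : Fin 2) : ract q sF (tCoeff q 0 j) = 0 := by
  ext X; change vecRep q (_ * X) 0 j = 0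
  rw [map_mul, vecRep_F]; simp [Matrix.mul_apply]
lemma ract_F_1 (j : Fin 2) : ract q sF (tCoeff q 1 j) = tCoeff q 0 j := by
  ext X; change vecRep q (_ * X) 1 j = vecRep q X 0 j
  rw [map_mul, vecRep_F]; simp [Matrix.mul_apply]

lemma eq_of_lact {φ : SlDual q} (hK : lact q sK φ = φ) (hK' : lact q sL φ = φ)
    (hE : lact q sE φ = 0) (hF : lact q sF φ = 0) : φ = φ 1 • 1 := by
  let S : Subalgebra ℂ (Uq (sl2 q)) :=
    { carrier := {X | lact q X φ = Uq.counit _ X • φ}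
      mul_mem' := fun {X Y} hX hY => by
        change _ = _ at hX hY
        change _ = _
        rw [map_mul, Module.End.mul_apply, hY, map_smul, hX, smul_smul, map_mul, mul_comm]
      add_mem' := fun {X Y} hX hY => by
        change _ = _ at hX hY
        change _ = _
        rw [map_add, LinearMap.add_apply, hX, hY, map_add, add_smul]
      algebraMap_mem' := fun c => by
        change _ = _
        rw [AlgHom.commutes, AlgHom.commutes]; rfl }
  have h := sl2_mem S (by change _ = _; simpa using hK) (by change _ = _; simpa using hK')
    (by change _ = _; simpa using hE) (by change _ = _; simpa using hF)
  ext X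
  have h1 : lact q X φ = Uq.counit _ X • φ := h X
  have h2 := congrArg (fun ψ : SlDual q => ψ 1) h1
  simp only [lact_one_apply] at h2
  rw [h2]
  exact mul_comm _ _

lemma eq_of_ract {φ : SlDual q} (hK : ract q sK φ = φ) (hK' : ract q sL φ = φ)
    (hE : ract q sE φ = 0) (hF : ract q sF φ = 0) : φ = φ 1 • 1 := by
  let S : Subalgebra ℂ (Uq (sl2 q)) :=
    { carrier := {X | ∀ Y, φ (X * Y) = Uq.counit _ X * φ Y}
      mul_mem' := fun {X Y} hX hY => by
        intro Z
        rw [mul_assoc, hX, hY, map_mul, mul_assoc]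
      add_mem' := fun {X Y} hX hY => by
        intro Z
        have : φ ((X + Y) * Z) = φ (X * Z) + φ (Y * Z) := by
          rw [add_mul]; exact map_add φ.ofConv _ _
        rw [this, hX, hY, map_add, add_mul]
      algebraMap_mem' := fun c => by
        intro Z
        rw [AlgHom.commutes, ← Algebra.smul_def]
        exact map_smul φ.ofConv _ _ }
  have h := sl2_mem S
    (fun Y => by
      rw [counit_K, one_mul]; exact congrArg (fun ψ : SlDual q => ψ Y) hK)
    (fun Y => by
      rw [counit_Kinv, one_mul]; exact congrArg (fun ψ : SlDual q => ψ Y) hK')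
    (fun Y => by
      rw [counit_E, zero_mul]; exact congrArg (fun ψ : SlDual q => ψ Y) hE)
    (fun Y => by
      rw [counit_F, zero_mul]; exact congrArg (fun ψ : SlDual q => ψ Y) hF)
  ext X
  have h1 := h X 1
  rw [mul_one] at h1
  rw [h1]
  exact mul_comm _ _

lemma tCoeff_rel_row (i k : Fin 2) : tCoeff q i 0 * tCoeff q k 1 -
    ((q : ℝ) : ℂ) • (tCoeff q i 1 * tCoeff q k 0) =
    (((if i = 0 ∧ k = 1 then 1 else 0) - if i = 1 ∧ k = 0 then ((q : ℝ) : ℂ) else 0) : ℂ) • 1 := by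
  have hq := qc_ne_zero q
  have h := eq_of_lact (φ := tCoeff q i 0 * tCoeff q k 1 -
    ((q : ℝ) : ℂ) • (tCoeff q i 1 * tCoeff q k 0))
    (by simp [lact_K_mul, lact_K_0, lact_K_1, -Complex.coe_smul, smul_smul, hq])
    (by simp [lact_K'_mul, lact_K'_0, lact_K'_1, -Complex.coe_smul, smul_smul, hq])
    (by simp [lact_E_mul, lact_E_0, lact_E_1, lact_K_0, lact_K_1, -Complex.coe_smul, smul_smul, hq])
    (by simp [lact_F_mul, lact_F_0, lact_F_1, lact_K'_0, lact_K'_1, -Complex.coe_smul, smul_smul, hq])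
  rw [h]
  congr 1
  change (tCoeff q i 0 * tCoeff q k 1) 1 - ((q : ℝ) : ℂ) * (tCoeff q i 1 * tCoeff q k 0) 1 = _
  rw [dual_mul_one_apply, dual_mul_one_apply]
  fin_cases i <;> fin_cases k <;> simp

lemma tCoeff_rel_col (j l : Fin 2) : tCoeff q 0 j * tCoeff q 1 l -
    ((q : ℝ) : ℂ) • (tCoeff q 1 j * tCoeff q 0 l) =
    (((if j = 0 ∧ l = 1 then 1 else 0) - if j = 1 ∧ l = 0 then ((q : ℝ) : ℂ) else 0) : ℂ) • 1 := by
  have hq := qc_ne_zero q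
  have h := eq_of_ract (φ := tCoeff q 0 j * tCoeff q 1 l -
    ((q : ℝ) : ℂ) • (tCoeff q 1 j * tCoeff q 0 l))
    (by simp [ract_K_mul, ract_K_0, ract_K_1, -Complex.coe_smul, smul_smul, hq])
    (by simp [ract_K'_mul, ract_K'_0, ract_K'_1, -Complex.coe_smul, smul_smul, hq])
    (by simp [ract_E_mul, ract_E_0, ract_E_1, ract_K_0, ract_K_1, -Complex.coe_smul, smul_smul, hq])
    (by simp [ract_F_mul, ract_F_0, ract_F_1, ract_K'_0, ract_K'_1, -Complex.coe_smul, smul_smul, hq])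
  rw [h]
  congr 1
  change (tCoeff q 0 j * tCoeff q 1 l) 1 - ((q : ℝ) : ℂ) * (tCoeff q 1 j * tCoeff q 0 l) 1 = _
  rw [dual_mul_one_apply, dual_mul_one_apply]
  fin_cases j <;> fin_cases l <;> simp

end dual

/-! ### Operators on `ℓ²` -/

/-- The Hilbert space `ℓ²(X)`. -/
abbrev L2 (X : Type) : Type := lp (fun _ : X => ℂ) 2

open Classical in
/-- The standard orthonormal basis vectors of `ℓ²(X)`. -/
def L2.e {X : Type} (x : X) : L2 X := lp.single 2 x (1 : ℂ)

lemma L2.single_eq {X : Type} [DecidableEq X] (x : X) (c : ℂ) :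
    (lp.single 2 x c : L2 X) = c • L2.e x := by
  ext y
  unfold L2.e
  simp only [lp.coeFn_smul, Pi.smul_apply, lp.single_apply, Pi.single_apply, smul_eq_mul]
  split_ifs <;> simp

lemma L2.op_ext {X : Type} {F : Type*} [NormedAddCommGroup F] [NormedSpace ℂ F]
    {A B : L2 X →L[ℂ] F} (h : ∀ x, A (L2.e x) = B (L2.e x)) : A = B := by
  classical
  refine lp.ext_continuousLinearMap (by simp) fun i => ?_
  refine ContinuousLinearMap.ext_ring ?_
  have := h i
  simp only [L2.e] at this
  convert this using 1 <;> simp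

lemma L2.orthonormal_e (X : Type) : Orthonormal ℂ (L2.e : X → L2 X) := by
  classical
  rw [orthonormal_iff_ite]
  intro i j
  unfold L2.e
  rw [lp.inner_single_left]
  by_cases h : i = j
  · subst h; simp
  · simp [h, lp.single_apply]

lemma L2.ext_inner {X : Type} {f g : L2 X} (h : ∀ x, inner ℂ (L2.e x) f = inner ℂ (L2.e x) g) :
    f = g := by
  classical
  ext x
  have := h x
  unfold L2.e at this
  rw [lp.inner_single_left, lp.inner_single_left] at this
  simpa using this

lemma L2.summable_sq {X : Type} (f : L2 X) : Summable fun x => ‖f x‖ ^ 2 := by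
  have := (lp.memℓp f).summable (by simp)
  simpa using this

lemma L2.memlp {X : Type} {f : X → ℂ} (h : Summable fun x => ‖f x‖ ^ 2) :
    Memℓp f 2 := by
  refine memℓp_gen ?_
  simpa using h

/-- The bilinear map `(f, g) ↦ ((x, y) ↦ f(x) g(y))`. -/
def L2.mulMap (X Y : Type) : L2 X →ₗ[ℂ] L2 Y →ₗ[ℂ] L2 (X × Y) :=
  LinearMap.mk₂ ℂ
    (fun f g => ⟨fun p => f p.1 * g p.2, L2.memlp <| by
      have := (L2.summable_sq f).mul_of_nonneg (L2.summable_sq g)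
        (fun _ => by positivity) (fun _ => by positivity)
      simpa [mul_pow] using this⟩)
    (fun f₁ f₂ g => by ext p; exact add_mul _ _ _)
    (fun c f g => by ext p; simp [mul_assoc])
    (fun f g₁ g₂ => by ext p; exact mul_add _ _ _)
    (fun c f g => by ext p; simp [mul_left_comm])

lemma L2.mulMap_apply {X Y : Type} (f : L2 X) (g : L2 Y) (p : X × Y) :
    L2.mulMap X Y f g p = f p.1 * g p.2 := rfl

lemma L2.mulMap_e {X Y : Type} (x : X) (y : Y) :
    L2.mulMap X Y (L2.e x) (L2.e y) = L2.e (x, y) := by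
  classical
  ext ⟨x', y'⟩
  rw [L2.mulMap_apply]
  unfold L2.e
  simp only [lp.single_apply, Pi.single_apply, Prod.mk.injEq]
  split_ifs <;> simp_all

lemma L2.inner_mulMap {X Y : Type} (f f' : L2 X) (g g' : L2 Y) :
    inner ℂ (L2.mulMap X Y f g) (L2.mulMap X Y f' g') = inner ℂ f f' * inner ℂ g g' := by
  have hs : ∀ {Z : Type} (u v : L2 Z), Summable fun z : Z => ‖(inner ℂ (u z) (v z) : ℂ)‖ := by
    intro Z u v
    refine Summable.of_nonneg_of_le (fun _ => norm_nonneg _)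
      (fun z => norm_inner_le_norm (𝕜 := ℂ) (u z) (v z)) ?_
    refine Summable.of_nonneg_of_le (fun _ => by positivity) (fun z => ?_)
      ((L2.summable_sq u).add (L2.summable_sq v))
    nlinarith [sq_nonneg (‖u z‖ - ‖v z‖), sq_nonneg (‖u z‖), sq_nonneg (‖v z‖)]
  rw [lp.inner_eq_tsum (𝕜 := ℂ) (L2.mulMap X Y f g) (L2.mulMap X Y f' g'),
    lp.inner_eq_tsum (𝕜 := ℂ) f f', lp.inner_eq_tsum (𝕜 := ℂ) g g',
    tsum_mul_tsum_of_summable_norm (hs f f') (hs g g')]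
  refine tsum_congr fun p => ?_
  simp [L2.mulMap_apply]
  ring

/-- The isometry of the algebraic tensor product `ℓ²(X) ⊗ ℓ²(Y)` into `ℓ²(X × Y)`, by which
`ℓ²(X × Y)` is the Hilbert space tensor product of `ℓ²(X)` and `ℓ²(Y)`. -/
def L2.tens (X Y : Type) : L2 X ⊗[ℂ] L2 Y →ₗᵢ[ℂ] L2 (X × Y) :=
  (TensorProduct.lift (L2.mulMap X Y)).isometryOfInner <| by
    intro u v
    induction u using TensorProduct.induction_on with
    | zero => simp
    | add u₁ u₂ h₁ h₂ => simp only [map_add, inner_add_left, h₁, h₂]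
    | tmul f g =>
      induction v using TensorProduct.induction_on with
      | zero => simp
      | add v₁ v₂ h₁ h₂ => simp only [map_add, inner_add_right, h₁, h₂]
      | tmul f' g' => simp [L2.inner_mulMap]

@[simp] lemma L2.tens_tmul {X Y : Type} (f : L2 X) (g : L2 Y) :
    L2.tens X Y (f ⊗ₜ g) = L2.mulMap X Y f g := rfl

lemma L2.denseRange_tens (X Y : Type) : DenseRange (L2.tens X Y) := by
  classical
  intro f
  have h := lp.hasSum_single (p := 2) (by simp) f
  refine mem_closure_of_tendsto h (Filter.Eventually.of_forall fun s => ?_)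
  refine ⟨∑ p ∈ s, f p • (L2.e p.1 ⊗ₜ L2.e p.2), ?_⟩
  rw [map_sum]
  refine Finset.sum_congr rfl fun p _ => ?_
  rw [map_smul, L2.tens_tmul, L2.mulMap_e]
  exact (L2.single_eq p (f p)).symm

/-- The tensor product `A ⊗ B` of bounded operators, acting on `ℓ²(X × Y)`. -/
def opTensor {X Y : Type} (A : L2 X →L[ℂ] L2 X) (B : L2 Y →L[ℂ] L2 Y) :
    L2 (X × Y) →L[ℂ] L2 (X × Y) :=
  ((L2.tens X Y).toContinuousLinearMap ∘L TensorProduct.mapL A B).extend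
    (L2.tens X Y).toContinuousLinearMap

lemma opTensor_tens {X Y : Type} (A : L2 X →L[ℂ] L2 X) (B : L2 Y →L[ℂ] L2 Y)
    (u : L2 X ⊗[ℂ] L2 Y) :
    opTensor A B (L2.tens X Y u) = L2.tens X Y (TensorProduct.mapL A B u) :=
  ContinuousLinearMap.extend_eq _ (L2.denseRange_tens X Y)
    (L2.tens X Y).isometry.isUniformInducing u

lemma opTensor_unique {X Y : Type} {A : L2 X →L[ℂ] L2 X} {B : L2 Y →L[ℂ] L2 Y}
    {C : L2 (X × Y) →L[ℂ] L2 (X × Y)}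
    (h : ∀ f g, C (L2.mulMap X Y f g) = L2.mulMap X Y (A f) (B g)) : C = opTensor A B := by
  refine L2.op_ext fun p => ?_
  have := opTensor_tens A B (L2.e p.1 ⊗ₜ L2.e p.2)
  rw [L2.tens_tmul, L2.mulMap_e] at this
  rw [← L2.mulMap_e, h, L2.mulMap_e, this]
  simp

lemma opTensor_mulMap {X Y : Type} (A : L2 X →L[ℂ] L2 X) (B : L2 Y →L[ℂ] L2 Y)
    (f : L2 X) (g : L2 Y) :
    opTensor A B (L2.mulMap X Y f g) = L2.mulMap X Y (A f) (B g) := by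
  have := opTensor_tens A B (f ⊗ₜ g)
  simpa using this

/-- `A ⊗ B` as a bilinear function of `A` and `B`. -/
def opTensorMap (X Y : Type) : (L2 X →L[ℂ] L2 X) →ₗ[ℂ] (L2 Y →L[ℂ] L2 Y) →ₗ[ℂ]
    (L2 (X × Y) →L[ℂ] L2 (X × Y)) :=
  LinearMap.mk₂ ℂ opTensor
    (fun A A' B => (opTensor_unique fun f g => by simp [opTensor_mulMap]).symm)
    (fun c A B => (opTensor_unique fun f g => by simp [opTensor_mulMap]).symm)
    (fun A B B' => (opTensor_unique fun f g => by simp [opTensor_mulMap]).symm)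
    (fun c A B => (opTensor_unique fun f g => by simp [opTensor_mulMap]).symm)

/-- The unitary `ℓ²(X) ≃ ℓ²(Y)` induced by a bijection `X ≃ Y`. -/
def L2.reindex {X Y : Type} (φ : X ≃ Y) : L2 X ≃ₗᵢ[ℂ] L2 Y where
  toFun f := ⟨fun y => f (φ.symm y), L2.memlp (φ.symm.summable_iff.2 (L2.summable_sq f))⟩
  invFun g := ⟨fun x => g (φ x), L2.memlp (φ.summable_iff.2 (L2.summable_sq g))⟩
  map_add' f g := by ext; rfl
  map_smul' c f := by ext; simp
  left_inv f := by ext; simp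
  right_inv g := by ext; simp
  norm_map' f := by
    simp only [LinearEquiv.coe_mk, LinearMap.coe_mk, AddHom.coe_mk]
    rw [lp.norm_eq_tsum_rpow (by simp), lp.norm_eq_tsum_rpow (by simp)]
    congr 1
    exact φ.symm.tsum_eq (fun x => ‖f x‖ ^ (2 : ENNReal).toReal)

/-- The diagonal operator `e_j ↦ w_j e_j` for a sequence `w` bounded by `1`. -/
def diagOp (w : ℕ → ℂ) (hw : ∀ j, ‖w j‖ ≤ 1) : L2 ℕ →L[ℂ] L2 ℕ :=
  lp.mapCLM 2 (fun j => w j • ContinuousLinearMap.id ℂ ℂ) zero_le_one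
    (fun j => by rw [norm_smul, ContinuousLinearMap.norm_id, mul_one]; exact hw j)

@[simp] lemma diagOp_e (w : ℕ → ℂ) (hw : ∀ j, ‖w j‖ ≤ 1) (j : ℕ) :
    diagOp w hw (L2.e j) = w j • L2.e j := by
  classical
  ext k
  unfold L2.e diagOp
  simp only [lp.mapCLM_apply_coe, lp.coeFn_smul, Pi.smul_apply, lp.single_apply, Pi.single_apply]
  by_cases h : k = j
  · subst h; simp
  · simp [h]

/-- The unilateral shift `e_j ↦ e_{j+1}`. -/
def shiftOp : L2 ℕ →L[ℂ] L2 ℕ :=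
  (((L2.orthonormal_e ℕ).comp _ (add_left_injective 1)).orthogonalFamily.linearIsometry
    ).toContinuousLinearMap

@[simp] lemma shiftOp_e (j : ℕ) : shiftOp (L2.e j) = L2.e (j + 1) := by
  classical
  unfold shiftOp
  conv_lhs => unfold L2.e
  simp only [LinearIsometry.coe_toContinuousLinearMap]
  have := ((L2.orthonormal_e ℕ).comp _ (add_left_injective 1)).orthogonalFamily.linearIsometry_apply_single (i := j) (1 : ℂ)
  convert this using 1
  · congr!
  · simp

section
variable (q : Set.Ioo (0 : ℝ) 1)

lemma norm_q_pow_le (j : ℕ) : ‖((q : ℝ) : ℂ) ^ j‖ ≤ 1 := by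
  have h0 := q.2.1
  have h1 := q.2.2
  rw [norm_pow, Complex.norm_real, Real.norm_of_nonneg h0.le]
  exact pow_le_one₀ h0.le h1.le

lemma norm_sqrt_le (j : ℕ) : ‖((Real.sqrt (1 - (q : ℝ) ^ (2 * j)) : ℝ) : ℂ)‖ ≤ 1 := by
  have h0 := q.2.1
  rw [Complex.norm_real, Real.norm_of_nonneg (Real.sqrt_nonneg _)]
  refine Real.sqrt_le_one.2 ?_
  have : 0 ≤ (q : ℝ) ^ (2 * j) := by positivity
  linarith

/-- `π_q(t₂₂) e_j = √(1 - q^{2(j+1)}) e_{j+1}` -/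
def opD : L2 ℕ →L[ℂ] L2 ℕ :=
  shiftOp ∘L diagOp (fun j => ((Real.sqrt (1 - (q : ℝ) ^ (2 * (j + 1))) : ℝ) : ℂ))
    (fun j => norm_sqrt_le q (j + 1))

/-- `π_q(t₁₁) e_j = √(1 - q^{2j}) e_{j-1}`, the adjoint of `π_q(t₂₂)`. -/
def opA : L2 ℕ →L[ℂ] L2 ℕ := ContinuousLinearMap.adjoint (opD q)

/-- `π_q(t₁₂) e_j = -q^{j+1} e_j` -/
def opB : L2 ℕ →L[ℂ] L2 ℕ :=
  diagOp (fun j => -((q : ℝ) : ℂ) ^ (j + 1)) (fun j => by simpa using norm_q_pow_le q (j + 1))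

/-- `π_q(t₂₁) e_j = q^j e_j` -/
def opC : L2 ℕ →L[ℂ] L2 ℕ := diagOp (fun j => ((q : ℝ) : ℂ) ^ j) (norm_q_pow_le q)

@[simp] lemma opD_e (j : ℕ) :
    opD q (L2.e j) = ((Real.sqrt (1 - (q : ℝ) ^ (2 * (j + 1))) : ℝ) : ℂ) • L2.e (j + 1) := by
  simp only [opD, ContinuousLinearMap.comp_apply, diagOp_e, map_smul, shiftOp_e]

@[simp] lemma opB_e (j : ℕ) : opB q (L2.e j) = (-((q : ℝ) : ℂ) ^ (j + 1)) • L2.e j := by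
  simp [opB]

@[simp] lemma opC_e (j : ℕ) : opC q (L2.e j) = ((q : ℝ) : ℂ) ^ j • L2.e j := by
  simp [opC]

lemma opA_e_zero : opA q (L2.e 0) = 0 := by
  refine L2.ext_inner fun k => ?_
  rw [opA, ContinuousLinearMap.adjoint_inner_right, opD_e, inner_smul_left,
    orthonormal_iff_ite.1 (L2.orthonormal_e ℕ)]
  simp

@[simp] lemma opA_e_succ (j : ℕ) :
    opA q (L2.e (j + 1)) = ((Real.sqrt (1 - (q : ℝ) ^ (2 * (j + 1))) : ℝ) : ℂ) • L2.e j := by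
  refine L2.ext_inner fun k => ?_
  rw [opA, ContinuousLinearMap.adjoint_inner_right, opD_e, inner_smul_left, inner_smul_right,
    orthonormal_iff_ite.1 (L2.orthonormal_e ℕ), orthonormal_iff_ite.1 (L2.orthonormal_e ℕ)]
  by_cases h : k = j
  · subst h; simp [Complex.conj_ofReal]
  · simp [h]

lemma opA_e (j : ℕ) :
    opA q (L2.e j) = ((Real.sqrt (1 - (q : ℝ) ^ (2 * j)) : ℝ) : ℂ) • L2.e (j - 1) := by
  cases j with
  | zero => simp [opA_e_zero]
  | succ j => simp

end

section osu2

/-- The defining relations of the generators `t_{ij}` of `ℂ_q[SU(2)]`. -/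
structure IsSU2 (q : ℂ) {A : Type*} [Ring A] [Algebra ℂ A] (t : Fin 2 → Fin 2 → A) : Prop where
  row : ∀ k, t k 0 * t k 1 = q • (t k 1 * t k 0)
  col : ∀ k, t 0 k * t 1 k = q • (t 1 k * t 0 k)
  comm : t 0 1 * t 1 0 = t 1 0 * t 0 1
  comm' : t 0 0 * t 1 1 - t 1 1 * t 0 0 = (q - q⁻¹) • (t 0 1 * t 1 0)
  det : t 0 0 * t 1 1 - q • (t 0 1 * t 1 0) = 1

/-- The same relations in the free algebra. -/
inductive ORel (q : ℂ) : FreeAlgebra ℂ (Fin 2 × Fin 2) → FreeAlgebra ℂ (Fin 2 × Fin 2) → Prop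
  | row (k : Fin 2) : ORel q (.ι ℂ (k, 0) * .ι ℂ (k, 1)) (q • (.ι ℂ (k, 1) * .ι ℂ (k, 0)))
  | col (k : Fin 2) : ORel q (.ι ℂ (0, k) * .ι ℂ (1, k)) (q • (.ι ℂ (1, k) * .ι ℂ (0, k)))
  | comm : ORel q (.ι ℂ (0, 1) * .ι ℂ (1, 0)) (.ι ℂ (1, 0) * .ι ℂ (0, 1))
  | comm' : ORel q (.ι ℂ (0, 0) * .ι ℂ (1, 1) - .ι ℂ (1, 1) * .ι ℂ (0, 0))
      ((q - q⁻¹) • (.ι ℂ (0, 1) * .ι ℂ (1, 0)))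
  | det : ORel q (.ι ℂ (0, 0) * .ι ℂ (1, 1) - q • (.ι ℂ (0, 1) * .ι ℂ (1, 0))) 1

/-- The algebra presented by the generators `t_{ij}` and their relations. -/
abbrev OSU2 (q : ℂ) : Type := RingQuot (ORel q)

/-- The generators of the presented algebra. -/
def OSU2.t (q : ℂ) (i j : Fin 2) : OSU2 q := RingQuot.mkAlgHom ℂ (ORel q) (.ι ℂ (i, j))

lemma OSU2.isSU2 (q : ℂ) : IsSU2 q (OSU2.t q) where
  row k := by
    have := RingQuot.mkAlgHom_rel ℂ (ORel.row (q := q) k)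
    rwa [map_mul, map_smul, map_mul] at this
  col k := by
    have := RingQuot.mkAlgHom_rel ℂ (ORel.col (q := q) k)
    rwa [map_mul, map_smul, map_mul] at this
  comm := by
    have := RingQuot.mkAlgHom_rel ℂ (ORel.comm (q := q))
    rwa [map_mul, map_mul] at this
  comm' := by
    have := RingQuot.mkAlgHom_rel ℂ (ORel.comm' (q := q))
    rwa [map_sub, map_mul, map_mul, map_smul, map_mul] at this
  det := by
    have := RingQuot.mkAlgHom_rel ℂ (ORel.det (q := q))
    rwa [map_sub, map_mul, map_smul, map_mul, map_one] at this

section lift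
variable {q : ℂ} {A : Type*} [Ring A] [Algebra ℂ A] {t : Fin 2 → Fin 2 → A}

/-- Elements satisfying the relations define a homomorphism. -/
def OSU2.lift (h : IsSU2 q t) : OSU2 q →ₐ[ℂ] A :=
  RingQuot.liftAlgHom ℂ ⟨FreeAlgebra.lift ℂ fun p => t p.1 p.2, by
    intro x y hxy
    cases hxy with
    | row k => simp [h.row k]
    | col k => simp [h.col k]
    | comm => simp [h.comm]
    | comm' => simp [h.comm']
    | det => simp [h.det]⟩

@[simp] lemma OSU2.lift_t (h : IsSU2 q t) (i j : Fin 2) :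
    OSU2.lift h (OSU2.t q i j) = t i j := by
  unfold OSU2.lift OSU2.t
  rw [RingQuot.liftAlgHom_mkAlgHom_apply]
  simp

lemma OSU2.adjoin_t (q : ℂ) :
    Algebra.adjoin ℂ (Set.range fun p : Fin 2 × Fin 2 => OSU2.t q p.1 p.2) = ⊤ := by
  have h : (Set.range fun p : Fin 2 × Fin 2 => OSU2.t q p.1 p.2) =
      RingQuot.mkAlgHom ℂ (ORel q) '' Set.range (FreeAlgebra.ι ℂ) := by
    rw [← Set.range_comp]; rfl
  rw [h]
  refine (AlgHom.map_adjoin (RingQuot.mkAlgHom ℂ (ORel q)) _).symm.trans ?_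
  rw [FreeAlgebra.adjoin_range_ι, Algebra.map_top]
  exact (AlgHom.range_eq_top _).2 (RingQuot.mkAlgHom_surjective ℂ (ORel q))

/-! Ordered monomials. -/

lemma IsSU2.ba (h : IsSU2 q t) (hq : q ≠ 0) : t 0 1 * t 0 0 = q⁻¹ • (t 0 0 * t 0 1) := by
  rw [h.row 0, smul_smul, inv_mul_cancel₀ hq, one_smul]

lemma IsSU2.ca (h : IsSU2 q t) (hq : q ≠ 0) : t 1 0 * t 0 0 = q⁻¹ • (t 0 0 * t 1 0) := by
  rw [h.col 0, smul_smul, inv_mul_cancel₀ hq, one_smul]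

lemma IsSU2.da (h : IsSU2 q t) : t 1 1 * t 0 0 = 1 + q⁻¹ • (t 0 1 * t 1 0) := by
  have h1 := h.comm'
  have h2 := h.det
  rw [sub_eq_iff_eq_add] at h1 h2
  rw [h2, sub_smul] at h1
  have h3 : t 1 1 * t 0 0 = 1 + q • (t 0 1 * t 1 0) - (q • (t 0 1 * t 1 0) - q⁻¹ • (t 0 1 * t 1 0)) := by
    rw [h1]; abel
  rw [h3]; abel

lemma pow_comm_of {x y : A} {r : ℂ} (h : y * x = r • (x * y)) (n : ℕ) :
    y * x ^ n = r ^ n • (x ^ n * y) := by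
  induction n with
  | zero => simp
  | succ n ih =>
    rw [pow_succ x, ← mul_assoc, ih, smul_mul_assoc, mul_assoc, h, mul_smul_comm, smul_smul,
      ← mul_assoc, pow_succ r]

lemma pow_comm_of' {x y : A} {r : ℂ} (h : y * x = r • (x * y)) (n : ℕ) :
    y ^ n * x = r ^ n • (x * y ^ n) := by
  induction n with
  | zero => simp
  | succ n ih =>
    rw [pow_succ' y, mul_assoc, ih, mul_smul_comm, ← mul_assoc, h, smul_mul_assoc, smul_smul,
      mul_assoc, pow_succ r]

/-- The monomial `t₁₁^α t₁₂^β t₂₁^γ`. -/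
def mono (t : Fin 2 → Fin 2 → A) (p : ℕ × ℕ × ℕ) : A :=
  t 0 0 ^ p.1 * t 0 1 ^ p.2.1 * t 1 0 ^ p.2.2

lemma IsSU2.a_mono (p : ℕ × ℕ × ℕ) : t 0 0 * mono t p = mono t (p.1 + 1, p.2) := by
  simp only [mono, pow_succ', mul_assoc]

lemma IsSU2.mono_a (h : IsSU2 q t) (hq : q ≠ 0) (p : ℕ × ℕ × ℕ) :
    mono t p * t 0 0 = (q⁻¹ ^ p.2.2 * q⁻¹ ^ p.2.1) • mono t (p.1 + 1, p.2) := by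
  simp only [mono]
  rw [mul_assoc, pow_comm_of' (h.ca hq), mul_smul_comm, ← mul_assoc, mul_assoc (t 0 0 ^ p.1),
    pow_comm_of' (h.ba hq), mul_smul_comm, smul_mul_assoc, smul_smul, ← mul_assoc, ← pow_succ]

lemma IsSU2.b_mono (h : IsSU2 q t) (hq : q ≠ 0) (p : ℕ × ℕ × ℕ) :
    t 0 1 * mono t p = q⁻¹ ^ p.1 • mono t (p.1, p.2.1 + 1, p.2.2) := by
  simp only [mono]
  rw [← mul_assoc, ← mul_assoc, pow_comm_of (h.ba hq), smul_mul_assoc, smul_mul_assoc,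
    mul_assoc (t 0 0 ^ p.1), ← pow_succ']

lemma IsSU2.c_mono (h : IsSU2 q t) (hq : q ≠ 0) (p : ℕ × ℕ × ℕ) :
    t 1 0 * mono t p = q⁻¹ ^ p.1 • mono t (p.1, p.2.1, p.2.2 + 1) := by
  simp only [mono]
  have h1 : t 1 0 * t 0 1 ^ p.2.1 = t 0 1 ^ p.2.1 * t 1 0 := (Commute.pow_right h.comm.symm _)
  rw [← mul_assoc, ← mul_assoc, pow_comm_of (h.ca hq), smul_mul_assoc, smul_mul_assoc,
    mul_assoc (t 0 0 ^ p.1), h1, ← mul_assoc, mul_assoc, ← pow_succ']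

lemma IsSU2.d_mono (h : IsSU2 q t) (hq : q ≠ 0) (p : ℕ × ℕ × ℕ) :
    t 1 1 * mono t (p.1 + 1, p.2) =
      mono t p + (q⁻¹ * q⁻¹ ^ p.1 * q⁻¹ ^ p.1) • mono t (p.1, p.2.1 + 1, p.2.2 + 1) := by
  rw [← IsSU2.a_mono, ← mul_assoc, h.da, add_mul, one_mul, smul_mul_assoc, mul_assoc,
    h.c_mono hq, mul_smul_comm, h.b_mono hq, smul_smul, smul_smul, mul_assoc]

end lift

lemma OSU2.exists_mul_pow (q : ℂ) (hq : q ≠ 0) (x : OSU2 q) : ∃ N : ℕ,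
    x * OSU2.t q 0 0 ^ N ∈ Submodule.span ℂ (Set.range (mono (OSU2.t q))) := by
  have h := OSU2.isSU2 q
  set M := Submodule.span ℂ (Set.range (mono (OSU2.t q)))
  have hm : ∀ p, mono (OSU2.t q) p ∈ M := fun p => Submodule.subset_span ⟨p, rfl⟩
  have key : ∀ f : OSU2 q →ₗ[ℂ] OSU2 q, (∀ p, f (mono (OSU2.t q) p) ∈ M) → ∀ m ∈ M, f m ∈ M := by
    intro f hf m hmM
    have : M ≤ M.comap f := Submodule.span_le.2 (by rintro _ ⟨p, rfl⟩; exact hf p)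
    exact this hmM
  have hMa : ∀ m ∈ M, m * OSU2.t q 0 0 ∈ M :=
    key (LinearMap.mulRight ℂ _) fun p => by
      rw [LinearMap.mulRight_apply, h.mono_a hq]; exact M.smul_mem _ (hm _)
  have hMN : ∀ (n : ℕ), ∀ m ∈ M, m * OSU2.t q 0 0 ^ n ∈ M := by
    intro n
    induction n with
    | zero => intro m hm; simpa using hm
    | succ n ih => intro m hm; rw [pow_succ', ← mul_assoc]; exact ih _ (hMa m hm)
  let P : Submodule ℂ (OSU2 q) :=
    { carrier := {x | ∃ N : ℕ, x * OSU2.t q 0 0 ^ N ∈ M}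
      zero_mem' := ⟨0, by simp⟩
      add_mem' := by
        rintro x y ⟨N, hN⟩ ⟨N', hN'⟩
        refine ⟨N + N', ?_⟩
        rw [add_mul]
        refine M.add_mem ?_ ?_
        · rw [pow_add, ← mul_assoc]; exact hMN _ _ hN
        · rw [add_comm, pow_add, ← mul_assoc]; exact hMN _ _ hN'
      smul_mem' := by
        rintro c x ⟨N, hN⟩
        exact ⟨N, by rw [smul_mul_assoc]; exact M.smul_mem _ hN⟩ }
  let S : Subalgebra ℂ (OSU2 q) :=
    { carrier := {y | ∀ x ∈ P, y * x ∈ P}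
      mul_mem' := fun {y z} hy hz x hx => by rw [mul_assoc]; exact hy _ (hz _ hx)
      add_mem' := fun {y z} hy hz x hx => by rw [add_mul]; exact P.add_mem (hy _ hx) (hz _ hx)
      algebraMap_mem' := fun c x hx => by rw [← Algebra.smul_def]; exact P.smul_mem _ hx }
  have hS : ∀ i j, OSU2.t q i j ∈ S := by
    intro i j x hx
    obtain ⟨N, hN⟩ := hx
    fin_cases i <;> fin_cases j
    · refine ⟨N, ?_⟩
      rw [mul_assoc]
      exact key (LinearMap.mulLeft ℂ _)
        (fun p => by
          change OSU2.t q 0 0 * mono _ p ∈ M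
          rw [IsSU2.a_mono]; exact hm _) _ hN
    · refine ⟨N, ?_⟩
      rw [mul_assoc]
      exact key (LinearMap.mulLeft ℂ _)
        (fun p => by rw [LinearMap.mulLeft_apply]; exact (h.b_mono hq p) ▸ M.smul_mem _ (hm _)) _ hN
    · refine ⟨N, ?_⟩
      rw [mul_assoc]
      exact key (LinearMap.mulLeft ℂ _)
        (fun p => by rw [LinearMap.mulLeft_apply]; exact (h.c_mono hq p) ▸ M.smul_mem _ (hm _)) _ hN
    · refine ⟨N + 1, ?_⟩
      rw [mul_assoc, pow_succ, ← mul_assoc x]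
      exact key (LinearMap.mulLeft ℂ (OSU2.t q 1 1) ∘ₗ LinearMap.mulRight ℂ (OSU2.t q 0 0))
        (fun p => by
          rw [LinearMap.comp_apply, LinearMap.mulRight_apply, LinearMap.mulLeft_apply,
            h.mono_a hq, mul_smul_comm, h.d_mono hq]
          exact M.smul_mem _ (M.add_mem (hm _) (M.smul_mem _ (hm _)))) _ hN
  have hx : x ∈ S := by
    have : (⊤ : Subalgebra ℂ (OSU2 q)) ≤ S := by
      rw [← OSU2.adjoin_t, Algebra.adjoin_le_iff]
      rintro _ ⟨p, rfl⟩
      exact hS _ _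
    exact this trivial
  have h1 : (1 : OSU2 q) ∈ P := ⟨0, by simpa [mono] using hm (0, 0, 0)⟩
  have h2 := hx 1 h1
  rw [mul_one] at h2
  exact h2

end osu2

section piq
variable (q : Set.Ioo (0 : ℝ) 1)

lemma tCoeff_isSU2 : IsSU2 ((q : ℝ) : ℂ) (tCoeff q) := by
  have hq := qc_ne_zero q
  have r := tCoeff_rel_row (q := q)
  have c := tCoeff_rel_col (q := q)
  have r01 := r 0 1
  have r10 := r 1 0
  have c01 := c 0 1
  have c10 := c 1 0
  simp only [Fin.isValue, zero_ne_one, one_ne_zero, and_self, if_true, if_false, sub_zero,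
    zero_sub, one_smul, neg_smul] at r01 r10 c01 c10
  have hcomm : tCoeff q 0 1 * tCoeff q 1 0 = tCoeff q 1 0 * tCoeff q 0 1 := by
    have : ((q : ℝ) : ℂ) • (tCoeff q 0 1 * tCoeff q 1 0) =
        ((q : ℝ) : ℂ) • (tCoeff q 1 0 * tCoeff q 0 1) := by
      have h1 := r01.trans c01.symm
      exact sub_right_injective h1
    exact smul_right_injective _ hq this
  refine ⟨fun k => ?_, fun k => ?_, hcomm, ?_, r01⟩
  · have h := r k k
    have h0 : ¬ (k = 0 ∧ k = 1) := by omega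
    have h1 : ¬ (k = 1 ∧ k = 0) := by omega
    rw [if_neg h0, if_neg h1, sub_zero, zero_smul, sub_eq_zero] at h
    exact h
  · have h := c k k
    have h0 : ¬ (k = 0 ∧ k = 1) := by omega
    have h1 : ¬ (k = 1 ∧ k = 0) := by omega
    rw [if_neg h0, if_neg h1, sub_zero, zero_smul, sub_eq_zero] at h
    exact h
  · have h1 : tCoeff q 1 1 * tCoeff q 0 0 = 1 + ((q : ℝ) : ℂ)⁻¹ • (tCoeff q 0 1 * tCoeff q 1 0) := by
      refine smul_right_injective (SlDual q) hq ?_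
      change ((q : ℝ) : ℂ) • _ = ((q : ℝ) : ℂ) • _
      rw [smul_add, smul_smul, mul_inv_cancel₀ hq, one_smul, hcomm, sub_eq_iff_eq_add.1 r10]
      abel
    rw [h1, sub_eq_iff_eq_add.1 r01, sub_smul]
    abel

/-- The operators `π_q(t_{ij})`. -/
def tOp (i j : Fin 2) : L2 ℕ →L[ℂ] L2 ℕ := !![opA q, opB q; opC q, opD q] i j

lemma tOp_isSU2 : IsSU2 ((q : ℝ) : ℂ) (tOp q) := by
  have hq := qc_ne_zero q
  have hs : ∀ j : ℕ, (((Real.sqrt (1 - (q : ℝ) ^ (2 * (j + 1))) : ℝ) : ℂ)) *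
      ((Real.sqrt (1 - (q : ℝ) ^ (2 * (j + 1))) : ℝ) : ℂ) = 1 - ((q : ℝ) : ℂ) ^ (2 * (j + 1)) := by
    intro j
    rw [← Complex.ofReal_mul, Real.mul_self_sqrt]
    · push_cast; rfl
    · have := pow_le_one₀ (n := 2 * (j + 1)) q.2.1.le q.2.2.le
      linarith
  have hmul : ∀ (S T : L2 ℕ →L[ℂ] L2 ℕ) (v : L2 ℕ), (S * T) v = S (T v) := fun _ _ _ => rfl
  have e00 : tOp q 0 0 = opA q := rfl
  have e01 : tOp q 0 1 = opB q := rfl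
  have e10 : tOp q 1 0 = opC q := rfl
  have e11 : tOp q 1 1 = opD q := rfl
  constructor
  · intro k
    refine L2.op_ext fun j => ?_
    fin_cases k <;> cases j <;>
      simp [-Complex.coe_smul, e00, e01, e10, e11, opA_e_zero, smul_smul] <;> ring_nf
  · intro k
    refine L2.op_ext fun j => ?_
    fin_cases k <;> cases j <;>
      simp [-Complex.coe_smul, e00, e01, e10, e11, opA_e_zero, smul_smul] <;> ring_nf
  · refine L2.op_ext fun j => ?_
    simp [-Complex.coe_smul, e00, e01, e10, e11, smul_smul]; ring_nf
  · refine L2.op_ext fun j => ?_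
    cases j with
    | zero =>
      simp only [e00, e01, e10, e11, opA_e_zero, sub_apply,
        hmul, smul_apply, opD_e, opC_e, opB_e,
        map_smul, opA_e_succ, smul_smul, map_zero, hs, sub_zero]
      congr 1
      field_simp
      ring
    | succ j =>
      simp only [e00, e01, e10, e11, sub_apply,
        hmul, smul_apply, opD_e, opC_e, opB_e,
        map_smul, opA_e_succ, smul_smul, hs, ← sub_smul]
      congr 1
      field_simp
      ring
  · refine L2.op_ext fun j => ?_
    simp only [e00, e01, e10, e11, sub_apply, one_apply_eq_self,
      hmul, smul_apply, opD_e, opC_e, opB_e,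
      map_smul, opA_e_succ, smul_smul, hs, ← sub_smul]
    conv_rhs => rw [← one_smul ℂ (L2.e j)]
    congr 1
    ring

/-- The pairing of the presented algebra with quantized `𝔰𝔩₂`. -/
def pairing : OSU2 ((q : ℝ) : ℂ) →ₐ[ℂ] SlDual q := OSU2.lift (tCoeff_isSU2 q)

/-- The representation of the presented algebra on `ℓ²(ℕ)`. -/
def opRep : OSU2 ((q : ℝ) : ℂ) →ₐ[ℂ] (L2 ℕ →L[ℂ] L2 ℕ) := OSU2.lift (tOp_isSU2 q)

end piq

section piq2
variable (q : Set.Ioo (0 : ℝ) 1)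

local notation "sK" => Uq.gen (sl2 q) (Gen.K ())
local notation "sL" => Uq.gen (sl2 q) (Gen.Kinv ())
local notation "sE" => Uq.gen (sl2 q) (Gen.E ())
local notation "sF" => Uq.gen (sl2 q) (Gen.F ())

variable {q} in
lemma lact_K_pow {φ : SlDual q} {c : ℂ} (h : lact q sK φ = c • φ) (n : ℕ) :
    lact q sK (φ ^ n) = c ^ n • φ ^ n := by
  induction n with
  | zero =>
    rw [pow_zero, pow_zero, one_smul]
    ext X
    change Uq.counit _ (X * sK) = Uq.counit _ X
    rw [map_mul, counit_K, mul_one]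
  | succ n ih => rw [pow_succ, lact_K_mul, ih, h, smul_mul_smul_comm, ← pow_succ]

variable {q} in
lemma ract_L_pow {φ : SlDual q} {c : ℂ} (h : ract q sL φ = c • φ) (n : ℕ) :
    ract q sL (φ ^ n) = c ^ n • φ ^ n := by
  induction n with
  | zero =>
    rw [pow_zero, pow_zero, one_smul]
    ext X
    change Uq.counit _ (sL * X) = Uq.counit _ X
    rw [map_mul, counit_Kinv, one_mul]
  | succ n ih => rw [pow_succ, ract_K'_mul, ih, h, smul_mul_smul_comm, ← pow_succ]

variable {q} in
lemma lact_E_pow_zero {φ : SlDual q} (h : lact q sE φ = 0) (n : ℕ) : lact q sE (φ ^ n) = 0 := by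
  induction n with
  | zero =>
    rw [pow_zero]
    ext X
    change Uq.counit _ (X * sE) = 0
    rw [map_mul, counit_E, mul_zero]
  | succ n ih => rw [pow_succ, lact_E_mul, ih, h, mul_zero, zero_mul, add_zero]

variable {q} in
lemma ract_F_pow_zero {φ : SlDual q} (h : ract q sF φ = 0) (n : ℕ) : ract q sF (φ ^ n) = 0 := by
  induction n with
  | zero =>
    rw [pow_zero]
    ext X
    change Uq.counit _ (sF * X) = 0
    rw [map_mul, counit_F, zero_mul]
  | succ n ih => rw [pow_succ, ract_F_mul, ih, h, mul_zero, zero_mul, add_zero]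

lemma lact_E_b_pow (n : ℕ) : ∃ s : ℝ, 0 < s ∧ lact q sE (tCoeff q 0 1 ^ (n + 1)) =
    (s : ℂ) • (tCoeff q 0 0 * tCoeff q 0 1 ^ n) := by
  have h := (tCoeff_isSU2 q).ba (qc_ne_zero q)
  have hq := q.2.1
  induction n with
  | zero => exact ⟨1, one_pos, by simp [lact_E_1]⟩
  | succ n ih =>
    obtain ⟨s, hs, e⟩ := ih
    refine ⟨1 + (q : ℝ)⁻¹ * (s * (q : ℝ)⁻¹), by positivity, ?_⟩
    rw [pow_succ', lact_E_mul, e, lact_E_1, lact_K_1, smul_mul_smul_comm, ← mul_assoc, h,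
      smul_mul_assoc, smul_smul, mul_assoc (tCoeff q 0 0), ← pow_succ']
    push_cast
    rw [add_smul, one_smul, mul_assoc]

lemma ract_F_c_pow (n : ℕ) : ∃ s : ℝ, 0 < s ∧ ract q sF (tCoeff q 1 0 ^ (n + 1)) =
    (s : ℂ) • (tCoeff q 0 0 * tCoeff q 1 0 ^ n) := by
  have h := (tCoeff_isSU2 q).ca (qc_ne_zero q)
  have hq := q.2.1
  induction n with
  | zero => exact ⟨1, one_pos, by simp [ract_F_1]⟩
  | succ n ih =>
    obtain ⟨s, hs, e⟩ := ih
    refine ⟨(q : ℝ) ^ (n + 1) + s * (q : ℝ)⁻¹, by positivity, ?_⟩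
    rw [pow_succ', ract_F_mul, e, ract_F_1, ract_L_pow (ract_K'_1 0), mul_smul_comm, mul_smul_comm,
      ← mul_assoc, h, smul_mul_assoc, smul_smul, mul_assoc, ← pow_succ']
    push_cast
    rw [add_smul]

local notation "mon" => mono (tCoeff q)

lemma lact_E_mono_zero (α γ : ℕ) : lact q sE (mon (α, 0, γ)) = 0 := by
  simp only [mono, pow_zero, mul_one]
  rw [lact_E_mul, lact_E_pow_zero (lact_E_0 0), lact_E_pow_zero (lact_E_0 1), zero_mul, mul_zero,
    add_zero]

lemma lact_E_mono_succ (α β γ : ℕ) : ∃ s : ℂ, s ≠ 0 ∧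
    lact q sE (mon (α, β + 1, γ)) = s • mon (α + 1, β, γ) := by
  have hq := qc_ne_zero q
  obtain ⟨s, hs, e⟩ := lact_E_b_pow q β
  refine ⟨((q : ℝ) : ℂ) ^ α * s, by simp [hq, hs.ne'], ?_⟩
  simp only [mono]
  rw [lact_E_mul, lact_E_pow_zero (lact_E_0 1), mul_zero, add_zero, lact_E_mul,
    lact_E_pow_zero (lact_E_0 0), zero_mul, zero_add, lact_K_pow (lact_K_0 0), e,
    smul_mul_smul_comm, smul_mul_assoc, ← mul_assoc, ← pow_succ]

lemma ract_F_ab (α β : ℕ) : ract q sF (tCoeff q 0 0 ^ α * tCoeff q 0 1 ^ β) = 0 := by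
  rw [ract_F_mul, ract_F_pow_zero (ract_F_0 0), ract_F_pow_zero (ract_F_0 1), zero_mul, mul_zero,
    add_zero]

lemma ract_F_mono_zero (α β : ℕ) : ract q sF (mon (α, β, 0)) = 0 := by
  simp only [mono, pow_zero, mul_one]
  exact ract_F_ab q α β

lemma ract_F_mono_succ (α β γ : ℕ) : ∃ s : ℂ, s ≠ 0 ∧
    ract q sF (mon (α, β, γ + 1)) = s • mon (α + 1, β, γ) := by
  have hq := qc_ne_zero q
  obtain ⟨s, hs, e⟩ := ract_F_c_pow q γ
  refine ⟨(s : ℂ) * ((q : ℝ) : ℂ)⁻¹ ^ β, by simp [hq, hs.ne'], ?_⟩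
  simp only [mono]
  rw [ract_F_mul, ract_F_ab, zero_mul, zero_add, e, mul_smul_comm, ← mul_assoc,
    mul_assoc (tCoeff q 0 0 ^ α), pow_comm_of' ((tCoeff_isSU2 q).ba hq), mul_smul_comm,
    smul_mul_assoc, smul_smul, ← mul_assoc, ← pow_succ]

lemma lact_E_iter (l : ℕ) : ∀ α γ, ∃ s : ℂ, s ≠ 0 ∧
    (lact q sE ^ l) (mon (α, l, γ)) = s • mon (α + l, 0, γ) := by
  induction l with
  | zero => intro α γ; exact ⟨1, one_ne_zero, by simp⟩
  | succ l ih =>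
    intro α γ
    obtain ⟨s, hs, e⟩ := lact_E_mono_succ q α l γ
    obtain ⟨s', hs', e'⟩ := ih (α + 1) γ
    refine ⟨s * s', mul_ne_zero hs hs', ?_⟩
    rw [pow_succ, Module.End.mul_apply, e, map_smul, e', smul_smul]
    congr 3
    omega

lemma lact_E_iter_ne (l : ℕ) : ∀ α β γ, β ≠ l → ∃ (s : ℂ) (α' β' : ℕ),
    (lact q sE ^ l) (mon (α, β, γ)) = s • mon (α', β' + 1, γ) := by
  induction l with
  | zero =>
    intro α β γ h
    obtain ⟨β, rfl⟩ := Nat.exists_eq_succ_of_ne_zero h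
    exact ⟨1, α, β, by simp⟩
  | succ l ih =>
    intro α β γ h
    cases β with
    | zero => exact ⟨0, 0, 0, by rw [pow_succ, Module.End.mul_apply, lact_E_mono_zero]; simp⟩
    | succ β =>
      obtain ⟨s, -, e⟩ := lact_E_mono_succ q α β γ
      obtain ⟨s', α', β', e'⟩ := ih (α + 1) β γ (by omega)
      exact ⟨s * s', α', β', by rw [pow_succ, Module.End.mul_apply, e, map_smul, e', smul_smul]⟩

lemma ract_F_iter (l : ℕ) : ∀ α β, ∃ s : ℂ, s ≠ 0 ∧
    ((ract q sF : Module.End ℂ (SlDual q)) ^ l) (mon (α, β, l)) = s • mon (α + l, β, 0) := by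
  induction l with
  | zero => intro α γ; exact ⟨1, one_ne_zero, by simp⟩
  | succ l ih =>
    intro α γ
    obtain ⟨s, hs, e⟩ := ract_F_mono_succ q α γ l
    obtain ⟨s', hs', e'⟩ := ih (α + 1) γ
    refine ⟨s * s', mul_ne_zero hs hs', ?_⟩
    rw [pow_succ, Module.End.mul_apply, e, map_smul, e', smul_smul]
    congr 3
    omega

lemma ract_F_iter_ne (l : ℕ) : ∀ α β γ, γ ≠ l → ∃ (s : ℂ) (α' γ' : ℕ),
    ((ract q sF : Module.End ℂ (SlDual q)) ^ l) (mon (α, β, γ)) = s • mon (α', β, γ' + 1) := by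
  induction l with
  | zero =>
    intro α β γ h
    obtain ⟨γ, rfl⟩ := Nat.exists_eq_succ_of_ne_zero h
    exact ⟨1, α, γ, by simp⟩
  | succ l ih =>
    intro α β γ h
    cases γ with
    | zero => exact ⟨0, 0, 0, by rw [pow_succ, Module.End.mul_apply, ract_F_mono_zero]; simp⟩
    | succ γ =>
      obtain ⟨s, -, e⟩ := ract_F_mono_succ q α β γ
      obtain ⟨s', α', β', e'⟩ := ih (α + 1) β γ (by omega)
      exact ⟨s * s', α', β', by rw [pow_succ, Module.End.mul_apply, e, map_smul, e', smul_smul]⟩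

lemma ract_F_iter_any (l : ℕ) : ∀ α β γ, ∃ (s : ℂ) (α' γ' : ℕ),
    ((ract q sF : Module.End ℂ (SlDual q)) ^ l) (mon (α, β, γ)) = s • mon (α', β, γ') := by
  intro α β γ
  by_cases h : γ = l
  · subst h
    obtain ⟨s, -, e⟩ := ract_F_iter q γ α β
    exact ⟨s, _, _, e⟩
  · obtain ⟨s, a, b, e⟩ := ract_F_iter_ne q l α β γ h
    exact ⟨s, _, _, e⟩

lemma dual_mul_K_pow (φ ψ : SlDual q) (m : ℕ) : (φ * ψ) (sK ^ m) = φ (sK ^ m) * ψ (sK ^ m) := by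
  rw [dual_mul_apply, map_pow, sl2Comul_K, Algebra.TensorProduct.tmul_pow]; rfl

lemma mono_K_pow (p : ℕ × ℕ × ℕ) (m : ℕ) : mon p (sK ^ m) =
    (((q : ℝ) : ℂ) ^ m) ^ p.1 * 0 ^ p.2.1 * 0 ^ p.2.2 := by
  have hp : ∀ (φ : SlDual q) (n : ℕ), (φ ^ n) (sK ^ m) = φ (sK ^ m) ^ n := by
    intro φ n
    induction n with
    | zero => rw [pow_zero, pow_zero, dual_one_apply, map_pow, counit_K, one_pow]
    | succ n ih => rw [pow_succ, dual_mul_K_pow, ih, pow_succ]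
  have hd : ∀ m : ℕ, vecRep q (sK ^ m) = Matrix.diagonal ![((q : ℝ) : ℂ) ^ m, ((q : ℝ) : ℂ)⁻¹ ^ m] := by
    intro m
    have h1 : vecRep q sK = Matrix.diagonal ![((q : ℝ) : ℂ), ((q : ℝ) : ℂ)⁻¹] := by
      rw [vecRep_K]; ext i j; fin_cases i <;> fin_cases j <;> rfl
    rw [map_pow, h1, Matrix.diagonal_pow]
    congr 1
    ext i; fin_cases i <;> rfl
  simp only [mono]
  rw [dual_mul_K_pow, dual_mul_K_pow, hp, hp, hp, tCoeff_apply, tCoeff_apply, tCoeff_apply, hd]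
  simp

/-- The monomials are linearly independent as functionals. -/
lemma linearIndependent_mono : LinearIndependent ℂ (mono (tCoeff q)) := by
  rw [linearIndependent_iff]
  intro c hc
  ext ⟨α₀, l, j⟩
  let T : SlDual q →ₗ[ℂ] SlDual q := ((ract q sF : Module.End ℂ (SlDual q)) ^ j) ∘ₗ (lact q sE ^ l)
  have hT : ∀ α, ∃ s : ℂ, s ≠ 0 ∧ T (mon (α, l, j)) = s • mon (α + l + j, 0, 0) := by
    intro α
    obtain ⟨s, hs, e⟩ := lact_E_iter q l α j
    obtain ⟨s', hs', e'⟩ := ract_F_iter q j (α + l) 0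
    refine ⟨s * s', mul_ne_zero hs hs', ?_⟩
    rw [LinearMap.comp_apply, e, map_smul, e', smul_smul]
  have hT0 : ∀ α β γ, (β, γ) ≠ (l, j) → ∀ m : ℕ, T (mon (α, β, γ)) (sK ^ m) = 0 := by
    intro α β γ h m
    by_cases hβ : β = l
    · subst hβ
      obtain ⟨s, -, e⟩ := lact_E_iter q β α γ
      obtain ⟨s', a', b', e'⟩ := ract_F_iter_ne q j (α + β) 0 γ (by rintro rfl; exact h rfl)
      rw [LinearMap.comp_apply, e, map_smul, e', smul_smul]
      change _ * mon _ _ = _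
      rw [mono_K_pow]
      simp
    · obtain ⟨s, a, b, e⟩ := lact_E_iter_ne q l α β γ hβ
      obtain ⟨s', a', b', e'⟩ := ract_F_iter_any q j a (b + 1) γ
      rw [LinearMap.comp_apply, e, map_smul, e', smul_smul]
      change _ * mon _ _ = _
      rw [mono_K_pow]
      simp
  choose s hs hse using hT
  let P : Polynomial ℂ := c.sum fun p z => if p.2 = (l, j) then Polynomial.C (z * s p.1) *
    Polynomial.X ^ (p.1 + l + j) else 0
  have hP : ∀ m : ℕ, P.eval (((q : ℝ) : ℂ) ^ m) = 0 := by
    intro m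
    have h1 : (T (Finsupp.linearCombination ℂ (mono (tCoeff q)) c)).ofConv (sK ^ m) = 0 := by
      rw [hc, map_zero]; rfl
    rw [← h1]
    simp only [P, Finsupp.linearCombination_apply, Finsupp.sum, map_sum, Polynomial.eval_finsetSum,
      map_smul]
    rw [WithConv.ofConv_sum, LinearMap.sum_apply]
    refine Finset.sum_congr rfl fun p _ => ?_
    obtain ⟨α, β, γ⟩ := p
    change _ = c (α, β, γ) * T (mon (α, β, γ)) (sK ^ m)
    by_cases h : (β, γ) = (l, j)
    · obtain ⟨rfl, rfl⟩ := Prod.mk.inj h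
      rw [if_pos rfl, hse]
      change _ = c (α, β, γ) * (s α * mon _ _)
      rw [mono_K_pow]
      simp [mul_assoc]
    · rw [if_neg h, hT0 α β γ h m]
      simp
  have hinj : Function.Injective fun m : ℕ => ((q : ℝ) : ℂ) ^ m := by
    intro m n h
    simp only at h
    have h' : (q : ℝ) ^ m = (q : ℝ) ^ n := by exact_mod_cast h
    exact (pow_right_injective₀ q.2.1 q.2.2.ne) h'
  have hP0 : P = 0 := Polynomial.eq_zero_of_infinite_isRoot P
    ((Set.infinite_range_of_injective hinj).mono (by rintro _ ⟨m, rfl⟩; exact hP m))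
  have h2 := congrArg (fun Q => Polynomial.coeff Q (α₀ + l + j)) hP0
  simp only [P, Finsupp.sum, Polynomial.finsetSum_coeff, Polynomial.coeff_zero] at h2
  rw [Finset.sum_eq_single (α₀, l, j)] at h2
  · rw [if_pos rfl, Polynomial.coeff_C_mul_X_pow, if_pos rfl] at h2
    exact (mul_eq_zero.1 h2).resolve_right (hs α₀)
  · rintro ⟨α, β, γ⟩ _ hne
    by_cases h : (β, γ) = (l, j)
    · obtain ⟨rfl, rfl⟩ := Prod.mk.inj h
      rw [if_pos rfl, Polynomial.coeff_C_mul_X_pow, if_neg]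
      intro h'
      apply hne
      rw [show α₀ = α by omega]
    · rw [if_neg h, Polynomial.coeff_zero]
  · intro h
    rw [Finsupp.notMem_support_iff.1 h]
    simp

lemma mul_opA_eq_zero {T : L2 ℕ →L[ℂ] L2 ℕ} (h : T * opA q = 0) : T = 0 := by
  refine L2.op_ext fun j => ?_
  have h1 : T (opA q (L2.e (j + 1))) = 0 := congrArg (fun S : L2 ℕ →L[ℂ] L2 ℕ => S (L2.e (j + 1))) h
  rw [opA_e_succ, map_smul] at h1
  refine (smul_eq_zero.1 h1).resolve_left ?_
  have h2 : (q : ℝ) ^ (2 * (j + 1)) < 1 := pow_lt_one₀ q.2.1.le q.2.2 (by omega)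
  have h3 : 0 < Real.sqrt (1 - (q : ℝ) ^ (2 * (j + 1))) := Real.sqrt_pos.2 (by linarith)
  exact_mod_cast h3.ne'

lemma opRep_eq_zero {x : OSU2 ((q : ℝ) : ℂ)} (hx : pairing q x = 0) : opRep q x = 0 := by
  obtain ⟨N, hN⟩ := OSU2.exists_mul_pow _ (qc_ne_zero q) x
  have hmap : ∀ p, pairing q (mono (OSU2.t _) p) = mono (tCoeff q) p := by
    intro p; simp [mono, pairing]
  obtain ⟨c, hc⟩ := (Finsupp.mem_span_range_iff_exists_finsupp).1 hN
  have hc0 : c = 0 := by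
    refine linearIndependent_iff.1 (linearIndependent_mono q) c ?_
    have := congrArg (pairing q) hc
    rw [map_mul, hx, zero_mul] at this
    rw [← this, Finsupp.linearCombination_apply]
    simp [Finsupp.sum, hmap]
  rw [hc0, Finsupp.sum_zero_index] at hc
  have h1 : opRep q x * opA q ^ N = 0 := by
    have h2 : opRep q (OSU2.t _ 0 0) = opA q := OSU2.lift_t _ _ _
    rw [← h2, ← map_pow, ← map_mul, ← hc, map_zero]
  have h3 : ∀ N : ℕ, opRep q x * opA q ^ N = 0 → opRep q x = 0 := by
    intro N
    induction N with
    | zero => intro h; simpa using h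
    | succ N ih =>
      intro h
      rw [pow_succ, ← mul_assoc] at h
      exact ih (mul_opA_eq_zero q h)
  exact h3 N h1

/-- The algebra `ℂ_q[SU(2)]`, generated by the `t_{ij}` in the dual of quantized `𝔰𝔩₂`. -/
def cqSU2 : Subalgebra ℂ (SlDual q) :=
  Algebra.adjoin ℂ (Set.range fun p : Fin 2 × Fin 2 => tCoeff q p.1 p.2)

lemma tCoeff_mem (i j : Fin 2) : tCoeff q i j ∈ cqSU2 q := Algebra.subset_adjoin ⟨(i, j), rfl⟩

lemma pairing_range : (pairing q).range = cqSU2 q := by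
  rw [← Algebra.map_top, ← OSU2.adjoin_t, AlgHom.map_adjoin, ← Set.range_comp, cqSU2]
  congr 2
  funext p
  exact OSU2.lift_t _ _ _

lemma exists_pairing (φ : cqSU2 q) : ∃ x, pairing q x = φ.1 := by
  have h : φ.1 ∈ (pairing q).range := (pairing_range q).symm ▸ φ.2
  exact h

lemma opRep_choose (φ : cqSU2 q) (x : OSU2 ((q : ℝ) : ℂ)) (hx : pairing q x = φ.1) :
    opRep q (exists_pairing q φ).choose = opRep q x := by
  rw [← sub_eq_zero, ← map_sub]
  refine opRep_eq_zero q ?_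
  rw [map_sub, hx, (exists_pairing q φ).choose_spec, sub_self]

/-- The representation `π_q` of `ℂ_q[SU(2)]` on `ℓ²(ℕ)`; it is determined by its values `tOp q i j`
on the generators `t_{ij}`. -/
def piQ : cqSU2 q →ₐ[ℂ] (L2 ℕ →L[ℂ] L2 ℕ) where
  toFun φ := opRep q (exists_pairing q φ).choose
  map_one' := by rw [opRep_choose q 1 1 (map_one _), map_one]
  map_mul' φ ψ := by
    rw [opRep_choose q (φ * ψ) ((exists_pairing q φ).choose * (exists_pairing q ψ).choose), map_mul]
    rw [map_mul, (exists_pairing q φ).choose_spec, (exists_pairing q ψ).choose_spec]; rfl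
  map_zero' := by rw [opRep_choose q 0 0 (map_zero _), map_zero]
  map_add' φ ψ := by
    rw [opRep_choose q (φ + ψ) ((exists_pairing q φ).choose + (exists_pairing q ψ).choose), map_add]
    rw [map_add, (exists_pairing q φ).choose_spec, (exists_pairing q ψ).choose_spec]; rfl
  commutes' c := by
    rw [opRep_choose q (algebraMap ℂ _ c) (algebraMap ℂ _ c) (AlgHom.commutes _ _), AlgHom.commutes]

lemma piQ_t (i j : Fin 2) : piQ q ⟨tCoeff q i j, tCoeff_mem q i j⟩ = tOp q i j := by
  change opRep q _ = _
  rw [opRep_choose q ⟨tCoeff q i j, tCoeff_mem q i j⟩ (OSU2.t _ i j) (OSU2.lift_t _ _ _)]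
  exact OSU2.lift_t _ _ _

end piq2

/-! ### Matrix coefficients of the weight representations of quantized `𝔰𝔩₂` -/

section hw
variable (q : Set.Ioo (0 : ℝ) 1)

lemma zpow_q_injective : Function.Injective fun n : ℤ => ((q : ℝ) : ℂ) ^ n := by
  intro m n h
  simp only at h
  have h' : (q : ℝ) ^ m = (q : ℝ) ^ n := by exact_mod_cast h
  exact zpow_right_injective₀ q.2.1 q.2.2.ne h'

lemma zpow_sub_ne (n : ℤ) (hn : n ≠ 0) : ((q : ℝ) : ℂ) ^ n - ((q : ℝ) : ℂ) ^ (-n) ≠ 0 := by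
  intro h
  have := zpow_q_injective q (sub_eq_zero.1 h)
  omega

section ops
variable {q} {V : Type*} [AddCommGroup V] [Module ℂ V] {k k' e f : Module.End ℂ V}

lemma IsTriple.k_f_pow (h : IsTriple ((q : ℝ) : ℂ) k k' e f) {μ : ℤ} {w : V}
    (hk : k w = ((q : ℝ) : ℂ) ^ μ • w) (j : ℕ) :
    k ((f ^ j) w) = ((q : ℝ) : ℂ) ^ (μ - 2 * j) • (f ^ j) w := by
  have hq := qc_ne_zero q
  induction j with
  | zero => simpa using hk
  | succ j ih =>
    have h1 : k (f ((f ^ j) w)) = ((q : ℝ) : ℂ)⁻¹ ^ 2 • f (k ((f ^ j) w)) := by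
      have := congrArg (fun T : Module.End ℂ V => T ((f ^ j) w)) h.kf
      simpa [-Complex.coe_smul] using this
    rw [pow_succ', Module.End.mul_apply, h1, ih, map_smul, smul_smul]
    congr 1
    rw [show μ - 2 * ((j + 1 : ℕ) : ℤ) = μ - 2 * j - 2 by push_cast; ring,
      zpow_sub₀ hq (μ - 2 * j) 2, inv_pow, div_eq_inv_mul]
    rfl

lemma IsTriple.k'_of_k (h : IsTriple ((q : ℝ) : ℂ) k k' e f) {μ : ℤ} {w : V}
    (hk : k w = ((q : ℝ) : ℂ) ^ μ • w) : k' w = ((q : ℝ) : ℂ) ^ (-μ) • w := by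
  have hq := qc_ne_zero q
  have h1 : k' (k w) = w := by
    have := congrArg (fun T : Module.End ℂ V => T w) h.k'k
    simpa using this
  rw [hk, map_smul] at h1
  rw [← h1, smul_smul, ← zpow_add₀ hq, neg_add_cancel, zpow_zero, one_smul, h1]

lemma IsTriple.e_f_pow (h : IsTriple ((q : ℝ) : ℂ) k k' e f) {μ : ℤ} {w : V}
    (hk : k w = ((q : ℝ) : ℂ) ^ μ • w) (he : e w = 0) (j : ℕ) :
    e ((f ^ (j + 1)) w) = ((((q : ℝ) : ℂ) ^ ((j : ℤ) + 1) - ((q : ℝ) : ℂ) ^ (-((j : ℤ) + 1))) *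
      (((q : ℝ) : ℂ) ^ (μ - j) - ((q : ℝ) : ℂ) ^ (-(μ - j))) /
      (((q : ℝ) : ℂ) - ((q : ℝ) : ℂ)⁻¹) ^ 2) • (f ^ j) w := by
  have hq := qc_ne_zero q
  have hqq : ((q : ℝ) : ℂ) - ((q : ℝ) : ℂ)⁻¹ ≠ 0 := by
    have := zpow_sub_ne q 1 one_ne_zero
    simpa using this
  have hef : ∀ v, e (f v) = f (e v) + (((q : ℝ) : ℂ) - ((q : ℝ) : ℂ)⁻¹)⁻¹ • (k v - k' v) := by
    intro v
    have := congrArg (fun T : Module.End ℂ V => T v) h.ef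
    simp only [LinearMap.sub_apply, LinearMap.smul_apply, Module.End.mul_apply] at this
    rw [← this]; abel
  induction j with
  | zero =>
    rw [zero_add, pow_one, hef, he, map_zero, zero_add, hk, h.k'_of_k hk, ← sub_smul, smul_smul,
      pow_zero, Module.End.one_apply]
    congr 1
    simp only [Nat.cast_zero, zero_add, zpow_one, zpow_neg, sub_zero]
    field_simp
  | succ j ih =>
    rw [pow_succ', Module.End.mul_apply, hef, ih, map_smul, h.k_f_pow hk,
      h.k'_of_k (h.k_f_pow hk (j + 1)), ← Module.End.mul_apply f, ← pow_succ', ← sub_smul, smul_smul,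
      ← add_smul]
    congr 1
    have e1 : ((q : ℝ) : ℂ) ^ μ ≠ 0 := zpow_ne_zero _ hq
    have e2 : ((q : ℝ) : ℂ) ^ j ≠ 0 := pow_ne_zero _ hq
    have e3 : μ - 2 * ((j + 1 : ℕ) : ℤ) = μ - j - j - 2 := by push_cast; ring
    have e4 : μ - ((j + 1 : ℕ) : ℤ) = μ - j - 1 := by push_cast; ring
    have e5 : ((j + 1 : ℕ) : ℤ) + 1 = (j : ℤ) + 2 := by push_cast; ring
    have e6 : ((q : ℝ) : ℂ) ^ (2 : ℤ) = ((q : ℝ) : ℂ) ^ 2 := rfl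
    rw [e3, e4, e5]
    simp only [zpow_neg, zpow_sub₀ hq, zpow_add₀ hq, zpow_natCast, zpow_one, e6]
    generalize ((q : ℝ) : ℂ) ^ μ = y at *
    generalize ((q : ℝ) : ℂ) ^ j = x at *
    generalize ((q : ℝ) : ℂ) = r at *
    have e7 : (r - r⁻¹)⁻¹ * (r - r⁻¹) ^ 2 = r - r⁻¹ := by
      rw [pow_two, ← mul_assoc, inv_mul_cancel₀ hqq, one_mul]
    rw [eq_div_iff (pow_ne_zero 2 hqq), add_mul, div_mul_cancel₀ _ (pow_ne_zero 2 hqq),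
      mul_right_comm, e7]
    field_simp
    ring

variable [FiniteDimensional ℂ V]

lemma exists_eigenspace_bot (k : Module.End ℂ V) (μ : ℕ → ℤ) (hμ : Function.Injective μ) :
    ∃ M, ∀ n ≥ M, k.eigenspace (((q : ℝ) : ℂ) ^ μ n) = ⊥ := by
  have hfin : {n | k.HasEigenvalue (((q : ℝ) : ℂ) ^ μ n)}.Finite :=
    Set.Finite.preimage (((zpow_q_injective q).comp hμ).injOn) (Module.End.finite_hasEigenvalue k)
  obtain ⟨M, hM⟩ := hfin.bddAbove
  refine ⟨M + 1, fun n hn => ?_⟩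
  by_contra hne
  have : n ≤ M := hM hne
  omega

lemma IsTriple.eq_zero_of_neg (h : IsTriple ((q : ℝ) : ℂ) k k' e f) {μ : ℤ} (hμ : μ < 0) {w : V}
    (hk : k w = ((q : ℝ) : ℂ) ^ μ • w) (he : e w = 0) : w = 0 := by
  obtain ⟨M, hM⟩ := exists_eigenspace_bot (q := q) k (fun j => μ - 2 * j)
    (fun a b h => by simp only at h; omega)
  have h1 : ∀ j, (f ^ j) w = 0 → w = 0 := by
    intro j
    induction j with
    | zero => intro h; simpa using h
    | succ j ih =>
      intro h0
      have h2 := h.e_f_pow hk he j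
      rw [h0, map_zero] at h2
      refine ih ((smul_eq_zero.1 h2.symm).resolve_left ?_)
      refine div_ne_zero (mul_ne_zero (zpow_sub_ne q _ (by omega)) (zpow_sub_ne q _ (by omega))) ?_
      have := zpow_sub_ne q 1 one_ne_zero
      exact pow_ne_zero 2 (by simpa using this)
  refine h1 M ?_
  have h2 : (f ^ M) w ∈ k.eigenspace (((q : ℝ) : ℂ) ^ (μ - 2 * M)) :=
    Module.End.mem_eigenspace_iff.2 (h.k_f_pow hk M)
  rw [hM M le_rfl] at h2
  exact h2

lemma IsTriple.f_pow_eq_zero (h : IsTriple ((q : ℝ) : ℂ) k k' e f) {m : ℕ} {w : V}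
    (hk : k w = ((q : ℝ) : ℂ) ^ (m : ℤ) • w) (he : e w = 0) {j : ℕ} (hj : m < j) :
    (f ^ j) w = 0 := by
  have h1 : (f ^ (m + 1)) w = 0 := by
    refine h.eq_zero_of_neg (μ := (m : ℤ) - 2 * ((m + 1 : ℕ) : ℤ)) (by omega)
      (h.k_f_pow hk (m + 1)) ?_
    rw [h.e_f_pow hk he m, sub_self]
    simp
  obtain ⟨d, rfl⟩ := Nat.exists_eq_add_of_lt hj
  rw [show m + d + 1 = d + (m + 1) by omega, pow_add, Module.End.mul_apply, h1, map_zero]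

lemma IsTriple.weight_le (h : IsTriple ((q : ℝ) : ℂ) k k' e f) (P : Submodule ℂ V)
    (hP : ∀ (m : ℕ) (w : V), k w = ((q : ℝ) : ℂ) ^ (m : ℤ) • w → e w = 0 → w ∈ P)
    (hf : ∀ w ∈ P, f w ∈ P) (n : ℕ) : k.eigenspace (((q : ℝ) : ℂ) ^ (n : ℤ)) ≤ P := by
  have hq := qc_ne_zero q
  obtain ⟨M, hM⟩ := exists_eigenspace_bot (q := q) k (fun j => j) (fun a b h => by simpa using h)
  let T : ℕ → Submodule ℂ V := fun n => Submodule.span ℂ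
    {v | ∃ (j : ℕ) (w : V), k w = ((q : ℝ) : ℂ) ^ ((n + 2 * j : ℕ) : ℤ) • w ∧ e w = 0 ∧
      v = (f ^ j) w}
  have hTP : ∀ n, T n ≤ P := by
    intro n
    refine Submodule.span_le.2 ?_
    rintro _ ⟨j, w, h1, h2, rfl⟩
    have : ∀ j, (f ^ j) w ∈ P := by
      intro j
      induction j with
      | zero => simpa using hP _ w h1 h2
      | succ j ih => rw [pow_succ', Module.End.mul_apply]; exact hf _ ih
    exact this j
  have hTV : ∀ n, T n ≤ k.eigenspace (((q : ℝ) : ℂ) ^ (n : ℤ)) := by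
    intro n
    refine Submodule.span_le.2 ?_
    rintro _ ⟨j, w, h1, h2, rfl⟩
    refine Module.End.mem_eigenspace_iff.2 ?_
    rw [h.k_f_pow h1]
    congr 2
    push_cast; ring
  have hTe : ∀ n, T (n + 2) ≤ (T n).map e := by
    intro n
    refine Submodule.span_le.2 ?_
    rintro _ ⟨j, w, h1, h2, rfl⟩
    have h3 := h.e_f_pow h1 h2 j
    set c : ℂ := _ / _ with hc
    have hc0 : c ≠ 0 := by
      refine div_ne_zero (mul_ne_zero (zpow_sub_ne q _ (by omega)) (zpow_sub_ne q _ (by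
        push_cast; omega))) ?_
      have := zpow_sub_ne q 1 one_ne_zero
      exact pow_ne_zero 2 (by simpa using this)
    refine ⟨c⁻¹ • (f ^ (j + 1)) w, (T n).smul_mem _ (Submodule.subset_span ⟨j + 1, w, ?_, h2, rfl⟩), ?_⟩
    · rw [h1]; congr 2; push_cast; ring
    · rw [map_smul, h3, smul_smul, inv_mul_cancel₀ hc0, one_smul]
  have main : ∀ d n, M ≤ n + 2 * d → k.eigenspace (((q : ℝ) : ℂ) ^ (n : ℤ)) ≤ T n := by
    intro d
    induction d with
    | zero => intro n hn; rw [hM n (by omega)]; exact bot_le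
    | succ d ih =>
      intro n hn v hv
      have hk : k v = ((q : ℝ) : ℂ) ^ (n : ℤ) • v := Module.End.mem_eigenspace_iff.1 hv
      have hev : e v ∈ T (n + 2) := by
        refine ih (n + 2) (by omega) (Module.End.mem_eigenspace_iff.2 ?_)
        have h1 : k (e v) = ((q : ℝ) : ℂ) ^ 2 • e (k v) := by
          have := congrArg (fun T : Module.End ℂ V => T v) h.ke
          simpa [-Complex.coe_smul] using this
        rw [h1, hk, map_smul, smul_smul]
        congr 1
        rw [zpow_natCast, zpow_natCast, pow_add, mul_comm]
      obtain ⟨v', hv', he'⟩ := hTe n hev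
      have h4 : v - v' ∈ T n := by
        refine Submodule.subset_span ⟨0, v - v', ?_, ?_, by simp⟩
        · exact Module.End.mem_eigenspace_iff.1 (Submodule.sub_mem _ hv (hTV n hv'))
        · rw [map_sub, he', sub_self]
      have := (T n).add_mem h4 hv'
      rwa [sub_add_cancel] at this
  exact (main M n (by omega)).trans (hTP n)

end ops

end hw

section pull
variable (q : Set.Ioo (0 : ℝ) 1)

local notation "sK" => Uq.gen (sl2 q) (Gen.K ())
local notation "sL" => Uq.gen (sl2 q) (Gen.Kinv ())
local notation "sE" => Uq.gen (sl2 q) (Gen.E ())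
local notation "sF" => Uq.gen (sl2 q) (Gen.F ())

lemma lact_mem (X : Uq (sl2 q)) {φ : SlDual q} (hφ : φ ∈ cqSU2 q) : lact q X φ ∈ cqSU2 q := by
  have h1 : lact q sK (1 : SlDual q) = 1 := by
    ext X; change Uq.counit _ (X * sK) = Uq.counit _ X; rw [map_mul, counit_K, mul_one]
  have h2 : lact q sL (1 : SlDual q) = 1 := by
    ext X; change Uq.counit _ (X * sL) = Uq.counit _ X; rw [map_mul, counit_Kinv, mul_one]
  have h3 : lact q sE (1 : SlDual q) = 0 := by
    ext X; change Uq.counit _ (X * sE) = 0; rw [map_mul, counit_E, mul_zero]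
  have h4 : lact q sF (1 : SlDual q) = 0 := by
    ext X; change Uq.counit _ (X * sF) = 0; rw [map_mul, counit_F, mul_zero]
  have key : ∀ φ ∈ cqSU2 q, lact q sK φ ∈ cqSU2 q ∧ lact q sL φ ∈ cqSU2 q ∧
      lact q sE φ ∈ cqSU2 q ∧ lact q sF φ ∈ cqSU2 q := by
    intro φ hφ
    have hm := tCoeff_mem q
    induction hφ using Algebra.adjoin_induction with
    | mem φ h =>
      obtain ⟨⟨i, j⟩, rfl⟩ := h
      match j with
      | 0 =>
        simp only [lact_K_0, lact_K'_0, lact_E_0, lact_F_0]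
        exact ⟨(cqSU2 q).smul_mem (hm _ _) _, (cqSU2 q).smul_mem (hm _ _) _, (cqSU2 q).zero_mem,
          hm _ _⟩
      | 1 =>
        simp only [lact_K_1, lact_K'_1, lact_E_1, lact_F_1]
        exact ⟨(cqSU2 q).smul_mem (hm _ _) _, (cqSU2 q).smul_mem (hm _ _) _, hm _ _,
          (cqSU2 q).zero_mem⟩
    | algebraMap c =>
      simp only [Algebra.algebraMap_eq_smul_one, map_smul, h1, h2, h3, h4]
      exact ⟨(cqSU2 q).smul_mem (cqSU2 q).one_mem _, (cqSU2 q).smul_mem (cqSU2 q).one_mem _,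
        (cqSU2 q).smul_mem (cqSU2 q).zero_mem _, (cqSU2 q).smul_mem (cqSU2 q).zero_mem _⟩
    | add φ ψ _ _ hφ hψ =>
      simp only [map_add]
      exact ⟨add_mem hφ.1 hψ.1, add_mem hφ.2.1 hψ.2.1, add_mem hφ.2.2.1 hψ.2.2.1,
        add_mem hφ.2.2.2 hψ.2.2.2⟩
    | mul φ ψ hφ' hψ' hφ hψ =>
      rw [lact_K_mul, lact_K'_mul, lact_E_mul, lact_F_mul]
      exact ⟨mul_mem hφ.1 hψ.1, mul_mem hφ.2.1 hψ.2.1,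
        add_mem (mul_mem hφ.2.2.1 hψ') (mul_mem hφ.1 hψ.2.2.1),
        add_mem (mul_mem hφ.2.2.2 hψ.2.1) (mul_mem hφ' hψ.2.2.2)⟩
  let S : Subalgebra ℂ (Uq (sl2 q)) :=
    { carrier := {X | ∀ φ ∈ cqSU2 q, lact q X φ ∈ cqSU2 q}
      mul_mem' := fun {X Y} hX hY φ hφ => by
        rw [map_mul, Module.End.mul_apply]; exact hX _ (hY _ hφ)
      add_mem' := fun {X Y} hX hY φ hφ => by
        rw [map_add, LinearMap.add_apply]; exact add_mem (hX _ hφ) (hY _ hφ)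
      algebraMap_mem' := fun c φ hφ => by
        rw [AlgHom.commutes]; exact (cqSU2 q).smul_mem hφ c }
  exact sl2_mem S (fun φ h => (key φ h).1) (fun φ h => (key φ h).2.1) (fun φ h => (key φ h).2.2.1)
    (fun φ h => (key φ h).2.2.2) X φ hφ

/-- Highest weight functionals are determined by their values on the powers of `F`. -/
lemma hw_unique {φ : SlDual q} {m : ℕ} (hK : lact q sK φ = ((q : ℝ) : ℂ) ^ (m : ℤ) • φ)
    (hE : lact q sE φ = 0) (hF : ∀ j : ℕ, φ (sF ^ j) = 0) : φ = 0 := by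
  have ht := (sl2_triple q).map (lact q)
  let N : Submodule ℂ (SlDual q) := Submodule.span ℂ (Set.range fun j : ℕ => (lact q sF ^ j) φ)
  have hN : ∀ j, (lact q sF ^ j) φ ∈ N := fun j => Submodule.subset_span ⟨j, rfl⟩
  have key : ∀ T : Module.End ℂ (SlDual q), (∀ j : ℕ, T ((lact q sF ^ j) φ) ∈ N) → ∀ ψ ∈ N, T ψ ∈ N := by
    intro T hT ψ hψ
    have : N ≤ N.comap T := Submodule.span_le.2 (by rintro _ ⟨p, rfl⟩; exact hT p)
    exact this hψ
  let S : Subalgebra ℂ (Uq (sl2 q)) :=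
    { carrier := {X | ∀ ψ ∈ N, lact q X ψ ∈ N}
      mul_mem' := fun {X Y} hX hY ψ hψ => by
        rw [map_mul, Module.End.mul_apply]; exact hX _ (hY _ hψ)
      add_mem' := fun {X Y} hX hY ψ hψ => by
        rw [map_add, LinearMap.add_apply]; exact add_mem (hX _ hψ) (hY _ hψ)
      algebraMap_mem' := fun c ψ hψ => by
        rw [AlgHom.commutes]; exact N.smul_mem c hψ }
  ext X
  have hX : lact q X φ ∈ N := by
    refine sl2_mem S (key _ fun j => ?_) (key _ fun j => ?_) (key _ fun j => ?_) (key _ fun j => ?_) X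
      φ (by simpa using hN 0)
    · rw [ht.k_f_pow hK]; exact N.smul_mem _ (hN j)
    · rw [ht.k'_of_k (ht.k_f_pow hK j)]; exact N.smul_mem _ (hN j)
    · cases j with
      | zero => simp [hE]
      | succ j => rw [ht.e_f_pow hK hE]; exact N.smul_mem _ (hN j)
    · rw [← Module.End.mul_apply, ← pow_succ']; exact hN _
  have hN0 : ∀ ψ ∈ N, ψ.ofConv 1 = 0 := by
    intro ψ hψ
    induction hψ using Submodule.span_induction with
    | zero => rfl
    | add ψ χ _ _ h1 h2 => rw [WithConv.ofConv_add, LinearMap.add_apply, h1, h2, add_zero]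
    | smul c ψ _ h1 => rw [WithConv.ofConv_smul, LinearMap.smul_apply, h1, smul_zero]
    | mem ψ h =>
      obtain ⟨j, rfl⟩ := h
      have := hF j
      rw [← lact_one_apply, map_pow] at this
      exact this
  have := hN0 _ hX
  rw [← lact_one_apply]
  exact this

lemma ract_pow_one (j : ℕ) (φ : SlDual q) :
    ((ract q sF : Module.End ℂ (SlDual q)) ^ j) φ 1 = φ (sF ^ j) := by
  induction j generalizing φ with
  | zero => simp
  | succ j ih =>
    rw [pow_succ, Module.End.mul_apply, ih, ract_apply, ← pow_succ']

/-- A functional of highest weight `m` which kills `F^j` for `j > m` is a polynomial in the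
`t_{ij}`. -/
lemma hw_mem {φ : SlDual q} {m : ℕ} (hK : lact q sK φ = ((q : ℝ) : ℂ) ^ (m : ℤ) • φ)
    (hE : lact q sE φ = 0) (hF : ∀ j : ℕ, m < j → φ (sF ^ j) = 0) : φ ∈ cqSU2 q := by
  have hq := qc_ne_zero q
  have hmono : ∀ p, mono (tCoeff q) p ∈ cqSU2 q := fun p =>
    mul_mem (mul_mem (pow_mem (tCoeff_mem q _ _) _) (pow_mem (tCoeff_mem q _ _) _))
      (pow_mem (tCoeff_mem q _ _) _)
  have hone : ∀ p, mono (tCoeff q) p 1 = 0 ^ p.2.1 * 0 ^ p.2.2 := by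
    intro p
    have := mono_K_pow q p 0
    simpa using this
  have hc : ∀ k : ℕ, ∃ s : ℂ, s ≠ 0 ∧ mono (tCoeff q) (m - k, 0, k) (sF ^ k) = s := by
    intro k
    obtain ⟨s, hs, e⟩ := ract_F_iter q k (m - k) 0
    refine ⟨s, hs, ?_⟩
    rw [← ract_pow_one, e]
    change s * mono (tCoeff q) _ 1 = s
    rw [hone]
    simp
  have hc' : ∀ k j : ℕ, k ≠ j → mono (tCoeff q) (m - k, 0, k) (sF ^ j) = 0 := by
    intro k j hkj
    obtain ⟨s, a, b, e⟩ := ract_F_iter_ne q j (m - k) 0 k hkj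
    rw [← ract_pow_one, e]
    change s * mono (tCoeff q) _ 1 = 0
    rw [hone]
    simp
  choose s hs hse using hc
  let ψ : SlDual q := ∑ k ∈ Finset.range (m + 1),
    (φ (sF ^ k) / s k) • mono (tCoeff q) (m - k, 0, k)
  have hψ : ψ ∈ cqSU2 q := sum_mem fun k _ => (cqSU2 q).smul_mem (hmono _) _
  have hψK : lact q sK ψ = ((q : ℝ) : ℂ) ^ (m : ℤ) • ψ := by
    simp only [ψ, map_sum, Finset.smul_sum]
    refine Finset.sum_congr rfl fun k hk => ?_
    rw [map_smul, smul_comm]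
    congr 1
    simp only [mono, pow_zero, mul_one]
    rw [lact_K_mul, lact_K_pow (lact_K_0 0), lact_K_pow (lact_K_0 1), smul_mul_smul_comm, ← pow_add,
      Nat.sub_add_cancel (Nat.lt_succ_iff.1 (Finset.mem_range.1 hk)), zpow_natCast]
  have hψE : lact q sE ψ = 0 := by
    simp only [ψ, map_sum, map_smul, lact_E_mono_zero, smul_zero, Finset.sum_const_zero]
  have hψF : ∀ j : ℕ, ψ (sF ^ j) = φ (sF ^ j) := by
    intro j
    have e1 : ψ (sF ^ j) = ∑ k ∈ Finset.range (m + 1),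
        (φ (sF ^ k) / s k) * mono (tCoeff q) (m - k, 0, k) (sF ^ j) := by
      change ψ.ofConv _ = _
      simp only [ψ]
      rw [WithConv.ofConv_sum, LinearMap.sum_apply]
      rfl
    rw [e1]
    by_cases hj : j < m + 1
    · rw [Finset.sum_eq_single j]
      · rw [hse, div_mul_cancel₀ _ (hs j)]
      · intro k _ hk; rw [hc' k j hk, mul_zero]
      · intro h; exact absurd (Finset.mem_range.2 hj) h
    · rw [hF j (by omega)]
      refine Finset.sum_eq_zero fun k hk => ?_
      rw [hc' k j (by have := Finset.mem_range.1 hk; omega), mul_zero]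
  have h0 : φ - ψ = 0 := by
    refine hw_unique q (m := m) ?_ ?_ ?_
    · rw [map_sub, hK, hψK, smul_sub]
    · rw [map_sub, hE, hψE, sub_zero]
    · intro j
      change φ (sF ^ j) - ψ (sF ^ j) = 0
      rw [hψF, sub_self]
  rw [sub_eq_zero.1 h0]
  exact hψ

/-- The algebra automorphism exchanging `E` with `F` and `K` with `K⁻¹`. -/
def slFlip : Uq (sl2 q) →ₐ[ℂ] Uq (sl2 q) := sl2Lift ((sl2_triple q).symm (qc_ne_zero q))

lemma slFlip_K : slFlip q sK = sL := sl2Lift_K _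
lemma slFlip_L : slFlip q sL = sK := sl2Lift_Kinv _
lemma slFlip_E : slFlip q sE = sF := sl2Lift_E _
lemma slFlip_F : slFlip q sF = sE := sl2Lift_F _

lemma slFlip_slFlip (X : Uq (sl2 q)) : slFlip q (slFlip q X) = X := by
  have : (slFlip q).comp (slFlip q) = AlgHom.id ℂ _ := by
    apply sl2_hom_ext <;> simp [slFlip_K, slFlip_L, slFlip_E, slFlip_F]
  exact congrArg (fun f : Uq (sl2 q) →ₐ[ℂ] Uq (sl2 q) => f X) this

/-- The pullback of functionals under `slFlip`. -/
def flipStar : SlDual q →ₗ[ℂ] SlDual q where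
  toFun φ := WithConv.toConv (φ.ofConv ∘ₗ (slFlip q).toLinearMap)
  map_add' _ _ := by ext; simp
  map_smul' _ _ := by ext; simp

lemma flipStar_apply (φ : SlDual q) (X : Uq (sl2 q)) : flipStar q φ X = φ (slFlip q X) := rfl

lemma flipStar_one : flipStar q 1 = 1 := by
  have : (Uq.counit (sl2 q)).comp (slFlip q) = Uq.counit (sl2 q) := by
    apply sl2_hom_ext <;> simp [slFlip_K, slFlip_L, slFlip_E, slFlip_F]
  ext X
  exact congrArg (fun f : Uq (sl2 q) →ₐ[ℂ] ℂ => f X) this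

lemma flipStar_mul (φ ψ : SlDual q) : flipStar q (φ * ψ) = flipStar q ψ * flipStar q φ := by
  have h1 : (sl2Comul q).comp (slFlip q) =
      ((Algebra.TensorProduct.comm ℂ _ _).toAlgHom.comp
        (Algebra.TensorProduct.map (slFlip q) (slFlip q))).comp (sl2Comul q) := by
    apply sl2_hom_ext <;>
      simp [slFlip_K, slFlip_L, slFlip_E, slFlip_F, sl2Comul_K, sl2Comul_Kinv, sl2Comul_E, sl2Comul_F,
        add_comm]
  ext X
  have h2 := congrArg (fun f : Uq (sl2 q) →ₐ[ℂ] Uq (sl2 q) ⊗[ℂ] Uq (sl2 q) => f X) h1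
  change (φ * ψ) (slFlip q X) = (flipStar q ψ * flipStar q φ) X
  rw [dual_mul_apply, dual_mul_apply]
  change sl2Comul q (slFlip q X) = _ at h2
  rw [h2, AlgHom.comp_apply]
  generalize sl2Comul q X = T
  induction T using TensorProduct.induction_on with
  | zero => simp
  | add S T h1 h2 => simp only [map_add, h1, h2]
  | tmul a b => exact mul_comm _ _

lemma flipStar_t (i j : Fin 2) : flipStar q (tCoeff q i j) = tCoeff q (1 - i) (1 - j) := by
  have h1 : (vecRep q).comp (slFlip q) =
      ((Matrix.reindexAlgEquiv ℂ ℂ (Equiv.subLeft (1 : Fin 2))).toAlgHom).comp (vecRep q) := by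
    apply sl2_hom_ext <;>
      simp [slFlip_K, slFlip_L, slFlip_E, slFlip_F, vecRep_K, vecRep_K', vecRep_E, vecRep_F] <;>
      ext i j <;> fin_cases i <;> fin_cases j <;> rfl
  ext X
  have h2 := congrArg (fun f : Uq (sl2 q) →ₐ[ℂ] Matrix (Fin 2) (Fin 2) ℂ => f X i j) h1
  fin_cases i <;> fin_cases j <;> exact h2

lemma flipStar_mem {φ : SlDual q} (hφ : φ ∈ cqSU2 q) : flipStar q φ ∈ cqSU2 q := by
  induction hφ using Algebra.adjoin_induction with
  | mem φ h =>
    obtain ⟨⟨i, j⟩, rfl⟩ := h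
    change flipStar q (tCoeff q i j) ∈ _
    rw [flipStar_t]
    exact tCoeff_mem q _ _
  | algebraMap c =>
    rw [Algebra.algebraMap_eq_smul_one, map_smul, flipStar_one]
    exact (cqSU2 q).smul_mem (cqSU2 q).one_mem _
  | add φ ψ _ _ hφ hψ => rw [map_add]; exact add_mem hφ hψ
  | mul φ ψ _ _ hφ hψ => rw [flipStar_mul]; exact mul_mem hψ hφ

section coeff
variable {V : Type*} [AddCommGroup V] [Module ℂ V]

/-- The matrix coefficient as a linear function of the vector. -/
def slCoeff (ρ : Uq (sl2 q) →ₐ[ℂ] Module.End ℂ V) (f : Module.Dual ℂ V) : V →ₗ[ℂ] SlDual q where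
  toFun v := WithConv.toConv (matCoeff ρ f v)
  map_add' _ _ := by ext; simp
  map_smul' _ _ := by ext; simp

lemma lact_slCoeff (ρ : Uq (sl2 q) →ₐ[ℂ] Module.End ℂ V) (f : Module.Dual ℂ V) (X : Uq (sl2 q))
    (v : V) : lact q X (slCoeff q ρ f v) = slCoeff q ρ f (ρ X v) := by
  ext Y
  change f (ρ (Y * X) v) = f (ρ Y (ρ X v))
  rw [map_mul, Module.End.mul_apply]

variable [FiniteDimensional ℂ V]

lemma slCoeff_mem_of_nonneg (ρ : Uq (sl2 q) →ₐ[ℂ] Module.End ℂ V) (f : Module.Dual ℂ V) (n : ℕ) {v : V}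
    (hv : v ∈ (ρ sK).eigenspace (((q : ℝ) : ℂ) ^ (n : ℤ))) : slCoeff q ρ f v ∈ cqSU2 q := by
  have ht := (sl2_triple q).map ρ
  refine ht.weight_le ((Subalgebra.toSubmodule (cqSU2 q)).comap (slCoeff q ρ f)) ?_ ?_ n hv
  · intro m w hk he
    refine hw_mem q (m := m) ?_ ?_ ?_
    · rw [lact_slCoeff, hk, map_smul]
    · rw [lact_slCoeff, he, map_zero]
    · intro j hj
      change f (ρ (sF ^ j) w) = 0
      rw [map_pow, ht.f_pow_eq_zero hk he hj, map_zero]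
  · intro w hw
    change slCoeff q ρ f _ ∈ cqSU2 q
    rw [← lact_slCoeff]
    exact lact_mem q _ hw

lemma slCoeff_mem (ρ : Uq (sl2 q) →ₐ[ℂ] Module.End ℂ V) (f : Module.Dual ℂ V)
    (hρ : ⨆ n : ℤ, (ρ sK).eigenspace (((q : ℝ) : ℂ) ^ n) = ⊤) (v : V) :
    slCoeff q ρ f v ∈ cqSU2 q := by
  have hle : (⨆ n : ℤ, (ρ sK).eigenspace (((q : ℝ) : ℂ) ^ n)) ≤
      (Subalgebra.toSubmodule (cqSU2 q)).comap (slCoeff q ρ f) := by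
    refine iSup_le fun n v hv => ?_
    change slCoeff q ρ f v ∈ cqSU2 q
    obtain ⟨m, rfl | rfl⟩ := n.eq_nat_or_neg
    · exact slCoeff_mem_of_nonneg q ρ f m hv
    · have h1 : v ∈ ((ρ.comp (slFlip q)) sK).eigenspace (((q : ℝ) : ℂ) ^ (m : ℤ)) := by
        rw [AlgHom.comp_apply, slFlip_K, Module.End.mem_eigenspace_iff]
        have := ((sl2_triple q).map ρ).k'_of_k (Module.End.mem_eigenspace_iff.1 hv)
        rwa [neg_neg] at this
      have h2 := flipStar_mem q (slCoeff_mem_of_nonneg q (ρ.comp (slFlip q)) f m h1)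
      have h3 : flipStar q (slCoeff q (ρ.comp (slFlip q)) f v) = slCoeff q ρ f v := by
        ext X
        change f (ρ (slFlip q (slFlip q X)) v) = f (ρ X v)
        rw [slFlip_slFlip]
      rwa [h3] at h2
  rw [hρ] at hle
  exact hle trivial

end coeff

end pull

section pull2
variable {ι : Type*} (D : Datum ι)

/-- The homomorphism from quantized `𝔰𝔩₂` attached to a node of the Dynkin diagram. -/
def nodeHom (i : ι) : Uq (sl2 (D.q i)) →ₐ[ℂ] Uq D := sl2Lift (q := D.q i) (Uq.triple D i)

lemma nodeHom_K (i : ι) : nodeHom D i (Uq.gen _ (.K ())) = Uq.gen D (.K i) := sl2Lift_K _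

lemma comp_nodeHom_mem (i : ι) (φ : Fun D) :
    WithConv.toConv (φ.1 ∘ₗ (nodeHom D i).toLinearMap) ∈ cqSU2 (D.q i) := by
  obtain ⟨φ, hφ⟩ := φ
  induction hφ using Submodule.span_induction with
  | zero => exact (cqSU2 (D.q i)).zero_mem
  | add φ ψ _ _ h1 h2 => exact (cqSU2 (D.q i)).add_mem h1 h2
  | smul c φ _ h => exact (cqSU2 (D.q i)).smul_mem h c
  | mem φ h =>
    obtain ⟨n, ρ, f, v, -, h2, rfl⟩ := h
    refine slCoeff_mem (D.q i) (ρ.comp (nodeHom D i)) f ?_ v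
    rw [eq_top_iff, ← h2]
    refine iSup_le fun μ => ?_
    refine (iInf_le _ i).trans ?_
    rw [AlgHom.comp_apply, nodeHom_K]
    exact le_iSup (fun n : ℤ => (ρ (Uq.gen D (.K i))).eigenspace (((D.q i : ℝ) : ℂ) ^ n)) (μ i)

/-- The restriction map `φ_i^* : ℂ_q[U] → ℂ_{q_i}[SU(2)]`. -/
def nodeStar (i : ι) : Fun D →ₗ[ℂ] cqSU2 (D.q i) where
  toFun φ := ⟨_, comp_nodeHom_mem D i φ⟩
  map_add' _ _ := rfl
  map_smul' _ _ := rfl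

/-- The representation `π_i = π_{q_i} ∘ φ_i^*`. -/
def piNode (i : ι) : Fun D →ₗ[ℂ] (L2 ℕ →L[ℂ] L2 ℕ) :=
  (piQ (D.q i)).toLinearMap ∘ₗ nodeStar D i

end pull2

section words
variable {ι : Type*} (D : Datum ι)

/-- The tensor product `(π₁ ⊗ π₂)(a) = ∑ π₁(a₍₁₎) ⊗ π₂(a₍₂₎)` of two representations. -/
def convTensor {X Y : Type} (π₁ : Fun D →ₗ[ℂ] (L2 X →L[ℂ] L2 X))
    (π₂ : Fun D →ₗ[ℂ] (L2 Y →L[ℂ] L2 Y)) : Fun D →ₗ[ℂ] (L2 (X × Y) →L[ℂ] L2 (X × Y)) :=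
  TensorProduct.lift ((opTensorMap X Y).compl₁₂ π₁ π₂) ∘ₗ comul D

/-- The tensor product `(π ⊗ τ_t)(a) = ∑ τ_t(a₍₂₎) π(a₍₁₎)` with a one-dimensional representation. -/
def convTau [Fintype ι] {X : Type} (π : Fun D →ₗ[ℂ] (L2 X →L[ℂ] L2 X)) (t : ι → Circle) :
    Fun D →ₗ[ℂ] (L2 X →L[ℂ] L2 X) :=
  TensorProduct.lift
    ((LinearMap.lsmul ℂ (L2 X →L[ℂ] L2 X)).flip.compl₁₂ π (tau D t)) ∘ₗ comul D

/-- The index set `ℕ^l` of the standard basis of `ℓ²(ℕ)^{⊗ l}`, for a word of length `l`. -/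
def Idx : List ι → Type
  | [] => Unit
  | _ :: w => ℕ × Idx w

/-- The representation `π_{i₁} ⊗ ⋯ ⊗ π_{i_l}` attached to the word `i₁ ⋯ i_l`; for the empty word it
is the counit. -/
def piWord : (w : List ι) → Fun D →ₗ[ℂ] (L2 (Idx w) →L[ℂ] L2 (Idx w))
  | [] => (LinearMap.toSpanSingleton ℂ _ (ContinuousLinearMap.id ℂ _)) ∘ₗ funCounit D
  | i :: w => convTensor D (piNode D i) (piWord w)

/-- The bijection `ℕ^{k+l} ≃ ℕ^k × ℕ^l`. -/
def idxAppend : (w w' : List ι) → Idx (w ++ w') ≃ Idx w × Idx w'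
  | [], w' => (Equiv.punitProd (Idx w')).symm
  | _ :: w, w' => ((Equiv.refl ℕ).prodCongr (idxAppend w w')).trans (Equiv.prodAssoc ℕ _ _).symm

end words

section weyl
variable {ι M N : Type*} {R : Type*} [CommRing R] [AddCommGroup M] [Module R M] [AddCommGroup N]
  [Module R N] {P : RootPairing ι R M N} [CharZero R] [Finite ι] [IsDomain R] [P.IsCrystallographic]
  [P.IsReduced] (b : P.Base)

/-- The length `l(w) = #(R⁺ ∩ w R⁻)`. -/
def weylLength (w : P.weylGroup) : ℕ :=
  {i | b.IsPos i ∧ ¬ b.IsPos (P.weylGroupToPerm w⁻¹ i)}.ncard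

/-- The simple reflection `s_i`. -/
def simpleRefl (i : b.support) : P.weylGroup := RootPairing.weylGroup.ofIdx P i

/-- `W^S = {w | l(w s_α) > l(w) for all α ∈ S}`, the minimal coset representatives. -/
def minimalReps (S : Set b.support) : Set P.weylGroup :=
  {w | ∀ i ∈ S, weylLength b w < weylLength b (w * simpleRefl b i)}

/-- `W_S`, the subgroup generated by the simple reflections in `S`. -/
def parabolic (S : Set b.support) : Subgroup P.weylGroup := Subgroup.closure (simpleRefl b '' S)

/-- `w = s_{i₁} ⋯ s_{i_l}` with `l = l(w)`. -/
def IsReducedWord (w : P.weylGroup) (l : List b.support) : Prop :=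
  (l.map (simpleRefl b)).prod = w ∧ l.length = weylLength b w

end weyl

section lie
open LieAlgebra LieAlgebra.IsKilling

variable {𝔤 : Type*} [LieRing 𝔤] [LieAlgebra ℂ 𝔤] [FiniteDimensional ℂ 𝔤] [LieAlgebra.IsSimple ℂ 𝔤]
  {𝔥 : LieSubalgebra ℂ 𝔤} [𝔥.IsCartanSubalgebra]

/-- `d_α = (α, α) / 2` for the form on `𝔥^*` induced by the Killing form; `(α, α)` is the value of `α`
at the element of `𝔥` which corresponds to `α`. -/
def halfSq (α : 𝔥.root) : ℝ := (α.1 ((cartanEquivDual 𝔥).symm α.1)).re / 2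

/-- `(α, α)` is a positive real number. -/
lemma exists_root_sq (α : 𝔥.root) :
    ∃ c : ℝ, 0 < c ∧ α.1 ((cartanEquivDual 𝔥).symm α.1) = (c : ℂ) := by
  have hα : α.1.IsNonZero := 𝔥.isNonZero_coe_root α
  set z := α.1 ((cartanEquivDual 𝔥).symm α.1) with hz
  have hz0 : z ≠ 0 := root_apply_cartanEquivDual_symm_ne_zero hα
  have h1 : LieModule.traceForm ℂ 𝔥 𝔤 (coroot α.1) (coroot α.1) = 4 * z⁻¹ := by
    rw [traceForm_coroot, root_apply_coroot hα]
    simp only [nsmul_eq_mul, smul_eq_mul, ← hz]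
    push_cast
    ring
  have h2 : LieModule.traceForm ℂ 𝔥 𝔤 (coroot α.1) (coroot α.1) =
      ∑ β ∈ 𝔥.root, β (coroot α.1) * β (coroot α.1) := by
    have h3 := congrArg (fun B : LinearMap.BilinForm ℂ 𝔥 => B (coroot α.1) (coroot α.1))
      (restrict_killingForm_eq_sum (K := ℂ) (L := 𝔤) (H := 𝔥))
    simp only [LinearMap.sum_apply, LinearMap.smulRight_apply, LinearMap.smul_apply, smul_eq_mul] at h3
    exact h3
  have h4 : ∀ β : LieModule.Weight ℂ 𝔥 𝔤, ∃ n : ℤ, β (coroot α.1) = n := fun β =>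
    ⟨_, apply_coroot_eq_cast α.1 β⟩
  choose n hn using h4
  have h5 : 4 * z⁻¹ = ((∑ β ∈ 𝔥.root, (n β : ℝ) * n β : ℝ) : ℂ) := by
    rw [← h1, h2]
    push_cast
    exact Finset.sum_congr rfl fun β _ => by rw [hn]
  have hnn : (0 : ℝ) ≤ ∑ β ∈ 𝔥.root, (n β : ℝ) * n β :=
    Finset.sum_nonneg fun β _ => mul_self_nonneg _
  have hne : (∑ β ∈ 𝔥.root, (n β : ℝ) * n β : ℝ) ≠ 0 := by
    intro h0
    rw [h0] at h5
    simp [hz0] at h5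
  refine ⟨4 / ∑ β ∈ 𝔥.root, (n β : ℝ) * n β, by positivity, ?_⟩
  rw [Complex.ofReal_div, ← h5]
  push_cast
  field_simp

lemma halfSq_pos (α : 𝔥.root) : 0 < halfSq α := by
  obtain ⟨c, hc, h⟩ := exists_root_sq α
  rw [halfSq, h, Complex.ofReal_re]
  positivity

/-- The data defining `U_q(𝔤)`: the Cartan integers `a i j = α_j(H_i)` and `q_i = q^{d_i}`. -/
def lieDatum (b : (rootSystem 𝔥).Base) (q : Set.Ioo (0 : ℝ) 1) : Datum b.support where
  a i j := b.cartanMatrix j i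
  q i := ⟨(q : ℝ) ^ halfSq i.1, Real.rpow_pos_of_pos q.2.1 _,
    Real.rpow_lt_one q.2.1.le q.2.2 (halfSq_pos i.1)⟩
  a_self i := b.cartanMatrix_apply_same i

end lie

end QFlag

end

open QFlag

/-! An element `a` of `ℂ_q[U/K_S]` satisfies `a(YX) = ε(X) a(Y)` for `X` in the Levi subalgebra.
Hence `Δ(a)` and `a ⊗ ε` agree as soon as the second leg is evaluated only on `U_q(𝔩_S)`, and no map
which sees the second leg through its restriction to `U_q(𝔩_S)` can tell them apart
(`lift_comul_of_mem_flagFun`).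

Both `π_v` and `τ_t` are such maps. Each `π_i` factors through restriction along `φ_i`, whose image
lies in the Levi subalgebra when `i ∈ S`; a tensor product of such representations inherits the
property because the Levi subalgebra is closed under multiplication (`piWord_eq_zero`); and `τ_t`
depends only on the values at the elements `K^σ`, which belong to every Levi subalgebra
(`tau_eq_zero`). Both send the functional `ε` to the identity (`piWord_funOne`, `tau_funOne`). So in
`π_u ⊗ π_v ⊗ τ_t` the last two factors contribute only identities, and what remains is `π_u(a) ⊗
id`. The map `Θ` is the amplification `A ↦ A ⊗ id`.

Two facts on the Weyl group enter. Lengths add on `W^S × W_S` (`weylLength_mul_of_mem`), and a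
reduced word of an element of `W_S` uses only letters of `S` (`IsReducedWord.mem_of_mem_parabolic`).
Both come from splitting the positive roots into those inside and those outside the span of `S`: an
element of `W^S` keeps the inside ones positive, an element of `W_S` permutes the outside ones.

That the concatenated word gives `π_u ⊗ π_v` is coassociativity of `Δ` together with the counit
axiom for the empty word (`piWord_append`). -/

noncomputable section
namespace QFlag

/-! ### Inversions and lengths in the Weyl group. -/

section weyl
variable {ι M N : Type*} {R : Type*} [CommRing R] [AddCommGroup M] [Module R M] [AddCommGroup N]
  [Module R N] {P : RootPairing ι R M N} [CharZero R] [Finite ι] [IsDomain R] [P.IsCrystallographic]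
  [P.IsReduced] (b : P.Base)

/-- The positive roots which `w` makes negative. -/
def inversions (w : P.weylGroup) : Set ι := {i | b.IsPos i ∧ ¬ b.IsPos (P.weylGroupToPerm w i)}

omit [Finite ι] [IsDomain R] [P.IsCrystallographic] [P.IsReduced] in
-- Opposite roots are described by an equation between vectors, here and below, because negation of
-- indices comes from `P.indexNeg`, which is introduced by hand inside the proofs that need it.
lemma isPos_of_root_eq_neg {i j : ι} (h : P.root j = - P.root i) :
    b.IsPos j ↔ ¬ b.IsPos i := by
  let := P.indexNeg
  have : j = -i := P.root.injective (by simpa using h)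
  rw [this]
  exact RootPairing.Base.IsPos.neg_iff_not b i

omit [CharZero R] [Finite ι] [IsDomain R] [P.IsCrystallographic] [P.IsReduced] in
lemma exists_root_neg (i : ι) : ∃ j, P.root j = - P.root i := by
  let := P.indexNeg
  exact ⟨-i, by simp⟩

omit [CharZero R] [Finite ι] [IsDomain R] [P.IsCrystallographic] [P.IsReduced] in
lemma root_perm_neg (w : P.weylGroup) {i j : ι} (h : P.root j = - P.root i) :
    P.root (P.weylGroupToPerm w j) = - P.root (P.weylGroupToPerm w i) := by
  rw [← RootPairing.weylGroup_apply_root, ← RootPairing.weylGroup_apply_root, h, smul_neg]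

omit [CharZero R] [Finite ι] [IsDomain R] [P.IsCrystallographic] [P.IsReduced] in
lemma perm_mul (u v : P.weylGroup) (i : ι) :
    P.weylGroupToPerm (u * v) i = P.weylGroupToPerm u (P.weylGroupToPerm v i) := by
  rw [map_mul]; rfl

omit [CharZero R] [Finite ι] [IsDomain R] [P.IsCrystallographic] [P.IsReduced] in
lemma perm_inv_perm (u : P.weylGroup) (i : ι) :
    P.weylGroupToPerm u⁻¹ (P.weylGroupToPerm u i) = i := by
  rw [← perm_mul, inv_mul_cancel, map_one]; rfl

omit [CharZero R] [Finite ι] [IsDomain R] [P.IsCrystallographic] [P.IsReduced] in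
lemma perm_perm_inv (u : P.weylGroup) (i : ι) :
    P.weylGroupToPerm u (P.weylGroupToPerm u⁻¹ i) = i := by
  rw [← perm_mul, mul_inv_cancel, map_one]; rfl

omit [Finite ι] [IsDomain R] [P.IsCrystallographic] [P.IsReduced] in
-- The map `i ↦ -w⁻¹ i` carries `R⁺ ∩ w R⁻` bijectively onto the inversions of `w`. Inversions are
-- the more convenient set, since they involve `w` rather than `w⁻¹`.
lemma weylLength_eq_ncard (w : P.weylGroup) : weylLength b w = (inversions b w).ncard := by
  let := P.indexNeg
  have hneg : ∀ i, P.root (-i) = - P.root i := fun i => by simp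
  have h : inversions b w = (fun i => -P.weylGroupToPerm w⁻¹ i) ''
      {i | b.IsPos i ∧ ¬ b.IsPos (P.weylGroupToPerm w⁻¹ i)} := by
    ext i
    constructor
    · rintro ⟨h1, h2⟩
      refine ⟨-P.weylGroupToPerm w i, ⟨(isPos_of_root_eq_neg b (hneg _)).2 h2, ?_⟩, ?_⟩
      · have := root_perm_neg w⁻¹ (hneg (P.weylGroupToPerm w i))
        rw [perm_inv_perm] at this
        rwa [isPos_of_root_eq_neg b this, not_not]
      · apply P.root.injective
        have := root_perm_neg w⁻¹ (hneg (P.weylGroupToPerm w i))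
        rw [perm_inv_perm] at this
        rw [hneg, this, neg_neg]
    · rintro ⟨j, ⟨h1, h2⟩, rfl⟩
      refine ⟨(isPos_of_root_eq_neg b (hneg _)).2 h2, ?_⟩
      have := root_perm_neg w (hneg (P.weylGroupToPerm w⁻¹ j))
      rw [perm_perm_inv] at this
      rwa [isPos_of_root_eq_neg b this, not_not]
  rw [h, Set.ncard_image_of_injective]
  · rfl
  · intro i j hij
    exact (P.weylGroupToPerm w⁻¹).injective (neg_injective hij)

omit [IsDomain R] [P.IsCrystallographic] [P.IsReduced] in
/-- If `v` carries its inversions to roots whose negatives `u` keeps positive, and `v⁻¹` keeps the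
inversions of `u` positive, then lengths add up. -/
lemma weylLength_mul {u v : P.weylGroup}
    (h1 : ∀ i ∈ inversions b v, ¬ b.IsPos (P.weylGroupToPerm (u * v) i))
    (h2 : ∀ i ∈ inversions b u, b.IsPos (P.weylGroupToPerm v⁻¹ i)) :
    weylLength b (u * v) = weylLength b u + weylLength b v := by
  -- A positive root made negative by `u * v` is an inversion of `v`, or else stays positive under
  -- `v` and is then `v⁻¹` of an inversion of `u`. The hypotheses `h2` and `h1` say that,
  -- conversely, both kinds are inversions of `u * v`.
  have e : inversions b (u * v) = P.weylGroupToPerm v⁻¹ '' inversions b u ∪ inversions b v := by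
    ext i
    constructor
    · rintro ⟨hi, hi'⟩
      by_cases hv : b.IsPos (P.weylGroupToPerm v i)
      · left
        refine ⟨P.weylGroupToPerm v i, ⟨hv, ?_⟩, perm_inv_perm _ _⟩
        rwa [perm_mul] at hi'
      · exact Or.inr ⟨hi, hv⟩
    · rintro (⟨j, hj, rfl⟩ | hi)
      · refine ⟨h2 j hj, ?_⟩
        rw [perm_mul, perm_perm_inv]
        exact hj.2
      · exact ⟨hi.1, h1 i hi⟩
  have hd : Disjoint (P.weylGroupToPerm v⁻¹ '' inversions b u) (inversions b v) := by
    rw [Set.disjoint_left]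
    rintro _ ⟨j, hj, rfl⟩ hi
    refine hi.2 ?_
    rw [perm_perm_inv]
    exact hj.1
  rw [weylLength_eq_ncard, weylLength_eq_ncard, weylLength_eq_ncard, e,
    Set.ncard_union_eq hd (Set.toFinite _) (Set.toFinite _),
    Set.ncard_image_of_injective _ (P.weylGroupToPerm v⁻¹).injective]

omit [CharZero R] [Finite ι] [IsDomain R] [P.IsCrystallographic] [P.IsReduced] in
lemma perm_simpleRefl (i : b.support) (j : ι) :
    P.weylGroupToPerm (simpleRefl b i) j = P.reflectionPerm i j := by
  simp [simpleRefl, RootPairing.weylGroup.ofIdx]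

omit [CharZero R] [Finite ι] [IsDomain R] [P.IsCrystallographic] [P.IsReduced] in
lemma simpleRefl_inv (i : b.support) : (simpleRefl b i)⁻¹ = simpleRefl b i :=
  Subtype.ext (RootPairing.Equiv.reflection_inv P i)

omit [CharZero R] [Finite ι] [IsDomain R] [P.IsCrystallographic] [P.IsReduced] in
lemma simpleRefl_mul_self (i : b.support) : simpleRefl b i * simpleRefl b i = 1 := by
  nth_rw 1 [← simpleRefl_inv b i, inv_mul_cancel]

omit [Finite ι] [IsDomain R] [P.IsCrystallographic] [P.IsReduced] in
lemma not_isPos_simpleRefl (i : b.support) :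
    ¬ b.IsPos (P.weylGroupToPerm (simpleRefl b i) i) := by
  rw [← isPos_of_root_eq_neg b (i := P.weylGroupToPerm (simpleRefl b i) i) (j := i)]
  · exact RootPairing.Base.isPos_of_mem_support i.2
  · rw [perm_simpleRefl]; simp

/-- A simple reflection permutes the positive roots other than its own and negates that one. All
comparisons of lengths below rest on this. -/
lemma inversions_simpleRefl (i : b.support) : inversions b (simpleRefl b i) = {i.1} := by
  ext j
  constructor
  · rintro ⟨hj, hj'⟩
    by_contra hne
    exact hj' (by rw [perm_simpleRefl]; exact hj.reflectionPerm i.2 hne)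
  · rintro rfl
    exact ⟨RootPairing.Base.isPos_of_mem_support i.2, not_isPos_simpleRefl b i⟩

lemma weylLength_simpleRefl (i : b.support) : weylLength b (simpleRefl b i) = 1 := by
  rw [weylLength_eq_ncard, inversions_simpleRefl, Set.ncard_singleton]

/-- The case `v = s_i` of additivity: the only inversion of `s_i` is `α_i`, which `w s_i` sends to
`-w α_i`, and `α_i` is not an inversion of `w`. -/
lemma weylLength_mul_simpleRefl_of_isPos {w : P.weylGroup} {i : b.support}
    (h : b.IsPos (P.weylGroupToPerm w i)) :
    weylLength b (w * simpleRefl b i) = weylLength b w + 1 := by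
  rw [← weylLength_simpleRefl b i]
  refine weylLength_mul b ?_ ?_
  · intro j hj
    rw [inversions_simpleRefl] at hj
    rw [Set.mem_singleton_iff.1 hj, perm_mul,
      isPos_of_root_eq_neg b (root_perm_neg w (i := i) (by rw [perm_simpleRefl]; simp)), not_not]
    exact h
  · intro j hj
    rw [simpleRefl_inv, perm_simpleRefl]
    refine hj.1.reflectionPerm i.2 ?_
    rintro rfl
    exact hj.2 h

/-- Since `w s_i α_i = -w α_i` is positive, the previous lemma applies to `w s_i` in place of `w`.
-/
lemma weylLength_of_not_isPos {w : P.weylGroup} {i : b.support}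
    (h : ¬ b.IsPos (P.weylGroupToPerm w i)) :
    weylLength b w = weylLength b (w * simpleRefl b i) + 1 := by
  have h1 := weylLength_mul_simpleRefl_of_isPos b (w := w * simpleRefl b i) (i := i) <| by
    rwa [perm_mul, isPos_of_root_eq_neg b (root_perm_neg w (i := i) (by rw [perm_simpleRefl]; simp))]
  rwa [mul_assoc, simpleRefl_mul_self, mul_one] at h1

/-- Turns the length condition defining `W^S` into a condition on roots, the only form in which it
is used: were `u α_i` negative, multiplication by `s_i` would shorten `u`. -/
lemma isPos_of_mem_minimalReps {S : Set b.support} {u : P.weylGroup} (hu : u ∈ minimalReps b S)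
    {i : b.support} (hi : i ∈ S) : b.IsPos (P.weylGroupToPerm u i) := by
  by_contra h
  have := weylLength_of_not_isPos b h
  have := hu i hi
  omega

omit [IsDomain R] [P.IsCrystallographic] [P.IsReduced] in
lemma weylLength_one : weylLength b (1 : P.weylGroup) = 0 := by
  rw [weylLength_eq_ncard, Set.ncard_eq_zero]
  ext i
  simp [inversions]

lemma weylLength_mul_simpleRefl_le (w : P.weylGroup) (i : b.support) :
    weylLength b (w * simpleRefl b i) ≤ weylLength b w + 1 := by
  by_cases h : b.IsPos (P.weylGroupToPerm w i)
  · exact (weylLength_mul_simpleRefl_of_isPos b h).le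
  · have := weylLength_of_not_isPos b h
    omega

/-- Each letter lengthens the product by at most one. This bounds the prefix of a reduced word, and
so shows that its last letter does lengthen the product. -/
lemma weylLength_prod_le (l : List b.support) :
    weylLength b (l.map (simpleRefl b)).prod ≤ l.length := by
  induction l using List.reverseRecOn with
  | nil => simp [weylLength_one]
  | append_singleton l i ih =>
    rw [List.map_append, List.prod_append, List.map_singleton, List.prod_singleton,
      List.length_append, List.length_singleton]
    have := weylLength_mul_simpleRefl_le b (l.map (simpleRefl b)).prod i
    omega

/-! ### The parabolic subgroup and the roots in the span of `S`. -/

/-- The span of the simple roots in `S`. -/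
def simpleSpan (S : Set b.support) : Submodule R M :=
  Submodule.span R ((fun j : b.support => P.root j) '' S)

omit [Finite ι] [IsDomain R] [P.IsCrystallographic] [P.IsReduced] in
-- Simple roots are linearly independent, so the coefficients of a vector in the span of `S` are
-- supported on `S`. The coefficients are integers read in `R`; characteristic zero keeps a nonzero
-- one nonzero.
lemma mem_of_sum_mem_simpleSpan {S : Set b.support} {f : ι → ℤ}
    (h : ∑ j ∈ b.support, f j • P.root j ∈ simpleSpan b S) {j : b.support} (hj : f j ≠ 0) :
    j ∈ S := by
  classical
  obtain ⟨l, hl, e⟩ := (Finsupp.mem_span_image_iff_linearCombination R).1 h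
  have hli : LinearIndependent R fun j : b.support => P.root j := b.linearIndepOn_root
  have e2 : Finsupp.linearCombination R (fun j : b.support => P.root j)
      (Finsupp.equivFunOnFinite.symm fun j : b.support => (f j : R)) =
      ∑ j ∈ b.support, f j • P.root j := by
    rw [Finsupp.linearCombination_apply, Finsupp.sum_fintype _ _ (by simp), ← b.support.sum_coe_sort]
    refine Finset.sum_congr rfl fun j _ => ?_
    exact Int.cast_smul_eq_zsmul R _ _
  have e3 := hli (e.trans e2.symm)
  refine hl ?_
  rw [e3]
  simpa using hj

omit [Finite ι] [IsDomain R] [P.IsCrystallographic] [P.IsReduced] in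
lemma mem_of_root_mem_simpleSpan {S : Set b.support} {i : b.support}
    (h : P.root i ∈ simpleSpan b S) : i ∈ S := by
  classical
  refine mem_of_sum_mem_simpleSpan b (f := Pi.single i.1 1) ?_ (by simp)
  rw [Finset.sum_eq_single i.1]
  · simpa using h
  · intro j _ hj
    simp [hj]
  · intro hi
    exact absurd i.2 hi

omit [Finite ι] [IsDomain R] [P.IsCrystallographic] [P.IsReduced] in
-- Height is the sum of the coefficients in the base, hence additive along integral relations; but
-- it is defined on indices of roots only, so each root of the relation has to be expanded in the
-- base first. It serves to prove positivity of a root written as a nonnegative combination of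
-- positive ones.
lemma height_eq_sum_mul {κ : Type*} (s : Finset κ) {g : κ → ι} {f : κ → ℤ} {k : ι}
    (h : P.root k = ∑ x ∈ s, f x • P.root (g x)) : b.height k = ∑ x ∈ s, f x * b.height (g x) := by
  choose F _ _ hF using fun x => b.exists_root_eq_sum_int (g x)
  have e : P.root k = ∑ j ∈ b.support, (∑ x ∈ s, f x * F x j) • P.root j := by
    rw [h]
    simp_rw [Finset.sum_smul, mul_smul]
    rw [Finset.sum_comm]
    refine Finset.sum_congr rfl fun x _ => ?_
    rw [hF x, Finset.smul_sum]
  rw [RootPairing.Base.height_eq_sum e, Finset.sum_comm]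
  refine Finset.sum_congr rfl fun x _ => ?_
  rw [RootPairing.Base.height_eq_sum (hF x), Finset.mul_sum]

omit [Finite ι] [IsDomain R] [P.IsCrystallographic] [P.IsReduced] in
/-- An element which keeps the simple roots of `S` positive does so for the positive roots in their
span. -/
lemma isPos_perm_of_mem_simpleSpan {S : Set b.support} {u : P.weylGroup}
    (hu : ∀ i ∈ S, b.IsPos (P.weylGroupToPerm u (i : b.support))) {k : ι} (hk : b.IsPos k)
    (hkS : P.root k ∈ simpleSpan b S) : b.IsPos (P.weylGroupToPerm u k) := by
  obtain ⟨f, hf, hpos, e⟩ := b.exists_root_eq_sum_int k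
  -- The coefficients of a root have a common sign, and a nonpositive expansion would make the
  -- height of `k` nonpositive.
  have hf0 : 0 < f := by
    refine hpos.resolve_right fun hneg => ?_
    rw [RootPairing.Base.isPos_iff, RootPairing.Base.height_eq_sum e] at hk
    exact absurd hk (not_lt.2 (Finset.sum_nonpos fun j _ => hneg.le j))
  have e2 : P.root (P.weylGroupToPerm u k) =
      ∑ j ∈ b.support, f j • P.root (P.weylGroupToPerm u j) := by
    rw [← RootPairing.weylGroup_apply_root, e, Finset.smul_sum]
    refine Finset.sum_congr rfl fun j _ => ?_
    rw [← RootPairing.weylGroup_apply_root]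
    exact map_zsmul (DistribSMul.toAddMonoidHom M u) _ _
  -- No root has height zero, so a nonnegative height is enough and no strictly positive summand has
  -- to be exhibited.
  rw [RootPairing.Base.isPos_iff', height_eq_sum_mul b _ e2]
  refine Finset.sum_nonneg fun j hj => ?_
  by_cases h0 : f j = 0
  · rw [h0, zero_mul]
  · rw [e] at hkS
    exact mul_nonneg (hf0.le j) (hu _ (mem_of_sum_mem_simpleSpan b hkS (j := ⟨j, hj⟩) h0)).le

omit [CharZero R] [Finite ι] [IsDomain R] [P.IsCrystallographic] [P.IsReduced] in
-- A reflection changes a root by a multiple of `α_i`, which lies in the span.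
lemma root_simpleRefl_mem_simpleSpan_iff {S : Set b.support} {i : b.support} (hi : i ∈ S) (k : ι) :
    P.root (P.weylGroupToPerm (simpleRefl b i) k) ∈ simpleSpan b S ↔
      P.root k ∈ simpleSpan b S := by
  rw [perm_simpleRefl, RootPairing.root_reflectionPerm, RootPairing.reflection_apply]
  exact Submodule.sub_mem_iff_left _
    (Submodule.smul_mem _ _ (Submodule.subset_span ⟨i, hi, rfl⟩))

omit [CharZero R] [Finite ι] [IsDomain R] [P.IsCrystallographic] [P.IsReduced] in
-- Simple reflections are involutions, so `W_S` is generated by them as a monoid and the step for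
-- inverses disappears.
lemma parabolic_induction {S : Set b.support} {p : P.weylGroup → Prop} (one : p 1)
    (mul : ∀ v, ∀ i ∈ S, p v → p (v * simpleRefl b i)) {v : P.weylGroup}
    (hv : v ∈ parabolic b S) : p v := by
  induction hv using Subgroup.closure_induction_right with
  | one => exact one
  | mul_right v _ i hi ih => obtain ⟨i, hi, rfl⟩ := hi; exact mul v i hi ih
  | mul_inv_cancel v _ i hi ih =>
    obtain ⟨i, hi, rfl⟩ := hi
    rw [simpleRefl_inv]
    exact mul v i hi ih

omit [CharZero R] [Finite ι] [IsDomain R] [P.IsCrystallographic] [P.IsReduced] in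
lemma root_parabolic_mem_simpleSpan_iff {S : Set b.support} {v : P.weylGroup}
    (hv : v ∈ parabolic b S) (k : ι) :
    P.root (P.weylGroupToPerm v k) ∈ simpleSpan b S ↔ P.root k ∈ simpleSpan b S := by
  refine parabolic_induction b (p := fun v => ∀ k,
    P.root (P.weylGroupToPerm v k) ∈ simpleSpan b S ↔ P.root k ∈ simpleSpan b S) (by simp) ?_ hv k
  intro v i hi ih k
  rw [perm_mul, ih, root_simpleRefl_mem_simpleSpan_iff b hi]

/-- The elements of `W_S` permute the positive roots outside the span of `S`. -/
lemma isPos_parabolic_of_notMem {S : Set b.support} {v : P.weylGroup} (hv : v ∈ parabolic b S)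
    {k : ι} (hk : b.IsPos k) (hkS : P.root k ∉ simpleSpan b S) :
    b.IsPos (P.weylGroupToPerm v k) := by
  refine parabolic_induction b (p := fun v => ∀ k, b.IsPos k → P.root k ∉ simpleSpan b S →
    b.IsPos (P.weylGroupToPerm v k)) (by simp +contextual) ?_ hv k hk hkS
  intro v i hi ih k hk hkS
  rw [perm_mul]
  -- The reflection acts before `v`. It leaves `k` outside the span, and leaves it positive because
  -- `k`, being outside, is not `α_i`.
  refine ih _ ?_ ((root_simpleRefl_mem_simpleSpan_iff b hi k).not.2 hkS)
  rw [perm_simpleRefl]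
  refine hk.reflectionPerm i.2 ?_
  rintro rfl
  exact hkS (Submodule.subset_span ⟨i, hi, rfl⟩)

/-- The inversions of `v` lie in the span of `S`, since `v` permutes the positive roots outside it;
`v` maps them to negative roots of the span, and `u` keeps those negative. The inversions of `u` lie
outside the span, since `u` keeps the positive roots inside it positive; there `v⁻¹` preserves
positivity. These are the two hypotheses of `weylLength_mul`. -/
lemma weylLength_mul_of_mem {S : Set b.support} {u v : P.weylGroup} (hu : u ∈ minimalReps b S)
    (hv : v ∈ parabolic b S) : weylLength b (u * v) = weylLength b u + weylLength b v := by
  have hu' : ∀ i ∈ S, b.IsPos (P.weylGroupToPerm u (i : b.support)) :=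
    fun i hi => isPos_of_mem_minimalReps b hu hi
  refine weylLength_mul b ?_ ?_
  · intro i hi
    have hiS : P.root i ∈ simpleSpan b S := by
      by_contra h
      exact hi.2 (isPos_parabolic_of_notMem b hv hi.1 h)
    -- The root `j = -v i` is positive and in the span of `S`, so `u j` is positive and `u v i = -u
    -- j` is not.
    obtain ⟨j, hj⟩ := exists_root_neg (P := P) (P.weylGroupToPerm v i)
    rw [perm_mul, ← isPos_of_root_eq_neg b (root_perm_neg u hj)]
    refine isPos_perm_of_mem_simpleSpan b hu' ((isPos_of_root_eq_neg b hj).2 hi.2) ?_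
    rw [hj, Submodule.neg_mem_iff]
    exact (root_parabolic_mem_simpleSpan_iff b hv i).2 hiS
  · intro i hi
    refine isPos_parabolic_of_notMem b (inv_mem hv) hi.1 fun h => ?_
    exact hi.2 (isPos_perm_of_mem_simpleSpan b hu' hi.1 h)

lemma IsReducedWord.append {S : Set b.support} {u v : P.weylGroup} (hu : u ∈ minimalReps b S)
    (hv : v ∈ parabolic b S) {wu wv : List b.support} (hwu : IsReducedWord b u wu)
    (hwv : IsReducedWord b v wv) : IsReducedWord b (u * v) (wu ++ wv) := by
  refine ⟨by rw [List.map_append, List.prod_append, hwu.1, hwv.1], ?_⟩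
  rw [weylLength_mul_of_mem b hu hv, List.length_append, hwu.2, hwv.2]

/-- The letters of a reduced word of an element of `W_S` lie in `S`. -/
lemma IsReducedWord.mem_of_mem_parabolic {S : Set b.support} {v : P.weylGroup}
    (hv : v ∈ parabolic b S) {l : List b.support} (hl : IsReducedWord b v l) :
    ∀ i ∈ l, i ∈ S := by
  induction l using List.reverseRecOn generalizing v with
  | nil => simp
  | append_singleton l i ih =>
    obtain ⟨h1, h2⟩ := hl
    rw [List.map_append, List.prod_append, List.map_singleton, List.prod_singleton] at h1
    rw [List.length_append, List.length_singleton] at h2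
    set w := (l.map (simpleRefl b)).prod with hw
    have hle : weylLength b w ≤ l.length := weylLength_prod_le b l
    have hvi : v * simpleRefl b i = w := by rw [← h1, mul_assoc, simpleRefl_mul_self, mul_one]
    -- Otherwise `w = v s_i` would be longer than `v`, hence longer than the word `l` that
    -- represents it.
    have hneg : ¬ b.IsPos (P.weylGroupToPerm v i) := by
      intro h
      have := weylLength_mul_simpleRefl_of_isPos b h
      rw [hvi] at this
      omega
    have hlen := weylLength_of_not_isPos b hneg
    rw [hvi] at hlen
    -- `v` makes `α_i` negative, which elements of `W_S` never do to a positive root outside the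
    -- span of `S`; linear independence of the simple roots then gives `i ∈ S`.
    have hi : i ∈ S := by
      refine mem_of_root_mem_simpleSpan b ?_
      by_contra h
      exact hneg (isPos_parabolic_of_notMem b hv (RootPairing.Base.isPos_of_mem_support i.2) h)
    have hwS : w ∈ parabolic b S := by
      rw [← hvi]
      exact mul_mem hv (Subgroup.subset_closure ⟨i, hi, rfl⟩)
    -- Now `w = v s_i` lies in `W_S` and has length one less than `v`, so `l` is a reduced word of
    -- it and the induction hypothesis covers the remaining letters.
    intro j hj
    rcases List.mem_append.1 hj with hj | hj
    · exact ih hwS ⟨rfl, by omega⟩ j hj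
    · rwa [List.mem_singleton.1 hj]

end weyl

end QFlag
end


noncomputable section
namespace QFlag

/-! ### Matrix coefficients and the comultiplication. -/

section coefficients
variable {ι : Type*} (D : Datum ι)

variable {D} in
/-- A matrix coefficient as an element of the quantized function algebra. -/
def funCoeff {n : ℕ} {ρ : Uq D →ₐ[ℂ] Module.End ℂ (Fin n → ℂ)} (h1 : IsIrred ρ)
    (h2 : IsPWeighted ρ) (f : Module.Dual ℂ (Fin n → ℂ)) (v : Fin n → ℂ) : Fun D :=
  ⟨matCoeff ρ f v, Submodule.subset_span ⟨n, ρ, f, v, h1, h2, rfl⟩⟩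

variable {D} in
-- Matrix coefficients span the function algebra. Linear identities are checked on them because
-- `comul` has an explicit formula there.
lemma Fun.hom_ext {V : Type*} [AddCommGroup V] [Module ℂ V] {F G : Fun D →ₗ[ℂ] V}
    (h : ∀ (n : ℕ) (ρ : Uq D →ₐ[ℂ] Module.End ℂ (Fin n → ℂ)) (h1 : IsIrred ρ) (h2 : IsPWeighted ρ)
      (f : Module.Dual ℂ (Fin n → ℂ)) (v : Fin n → ℂ),
      F (funCoeff h1 h2 f v) = G (funCoeff h1 h2 f v)) : F = G := by
  ext ⟨φ, hφ⟩
  induction hφ using Submodule.span_induction with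
  | zero => exact (map_zero F).trans (map_zero G).symm
  | add φ ψ h1 h2 e1 e2 =>
    have : (⟨φ + ψ, add_mem h1 h2⟩ : Fun D) = ⟨φ, h1⟩ + ⟨ψ, h2⟩ := rfl
    rw [this, map_add, map_add, e1, e2]
  | smul c φ h1 e1 =>
    have : (⟨c • φ, Submodule.smul_mem _ c h1⟩ : Fun D) = c • ⟨φ, h1⟩ := rfl
    rw [this, map_smul, map_smul, e1]
  | mem φ hφ =>
    obtain ⟨n, ρ, f, v, h1, h2, rfl⟩ := hφ
    exact h n ρ h1 h2 f v

variable {D} in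
-- `comul` is obtained by choice and known only through its pairing with pairs `(X, Y)`. As that
-- pairing is injective, it suffices to insert the expansion of the vector `ρ Y v` in the standard
-- basis into `f (ρ X (ρ Y v))`.
lemma comul_funCoeff {n : ℕ} {ρ : Uq D →ₐ[ℂ] Module.End ℂ (Fin n → ℂ)} (h1 : IsIrred ρ)
    (h2 : IsPWeighted ρ) (f : Module.Dual ℂ (Fin n → ℂ)) (v : Fin n → ℂ) :
    comul D (funCoeff h1 h2 f v) = ∑ k, funCoeff h1 h2 f (Pi.basisFun ℂ (Fin n) k) ⊗ₜ
      funCoeff h1 h2 ((Pi.basisFun ℂ (Fin n)).coord k) v := by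
  refine pairDual_injective D ?_
  ext X Y
  rw [pairDual_comul]
  simp only [map_sum, LinearMap.sum_apply, pairDual_tmul, funCoeff, matCoeff_apply]
  rw [map_mul, Module.End.mul_apply]
  conv_lhs => rw [← (Pi.basisFun ℂ (Fin n)).sum_repr (ρ Y v)]
  rw [map_sum, map_sum]
  refine Finset.sum_congr rfl fun k _ => ?_
  simp [mul_comm]

variable {D} in
lemma convTensor_funCoeff {X Y : Type} (π₁ : Fun D →ₗ[ℂ] (L2 X →L[ℂ] L2 X))
    (π₂ : Fun D →ₗ[ℂ] (L2 Y →L[ℂ] L2 Y)) {n : ℕ} {ρ : Uq D →ₐ[ℂ] Module.End ℂ (Fin n → ℂ)}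
    (h1 : IsIrred ρ) (h2 : IsPWeighted ρ) (f : Module.Dual ℂ (Fin n → ℂ)) (v : Fin n → ℂ) :
    convTensor D π₁ π₂ (funCoeff h1 h2 f v) =
      ∑ k, opTensor (π₁ (funCoeff h1 h2 f (Pi.basisFun ℂ (Fin n) k)))
        (π₂ (funCoeff h1 h2 ((Pi.basisFun ℂ (Fin n)).coord k) v)) := by
  rw [convTensor, LinearMap.comp_apply, comul_funCoeff, map_sum]
  rfl

variable {D} in
-- The counit axiom `(ε ⊗ id) Δ = id`, written on a matrix coefficient.
lemma sum_funCoeff {n : ℕ} {ρ : Uq D →ₐ[ℂ] Module.End ℂ (Fin n → ℂ)} (h1 : IsIrred ρ)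
    (h2 : IsPWeighted ρ) (f : Module.Dual ℂ (Fin n → ℂ)) (v : Fin n → ℂ) :
    ∑ k, funCounit D (funCoeff h1 h2 f (Pi.basisFun ℂ (Fin n) k)) •
      funCoeff h1 h2 ((Pi.basisFun ℂ (Fin n)).coord k) v = funCoeff h1 h2 f v := by
  ext X
  simp only [Submodule.coe_sum, Submodule.coe_smul, LinearMap.sum_apply, LinearMap.smul_apply]
  change ∑ k, f (ρ 1 (Pi.basisFun ℂ (Fin n) k)) • (Pi.basisFun ℂ (Fin n)).coord k (ρ X v) =
    f (ρ X v)
  conv_rhs => rw [← (Pi.basisFun ℂ (Fin n)).sum_repr (ρ X v)]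
  rw [map_sum]
  refine Finset.sum_congr rfl fun k _ => ?_
  simp [mul_comm]

end coefficients

/-! ### Tensor products of operators, amplification and relabelling of bases. -/

section operators

lemma L2.reindex_e {X Y : Type} (φ : X ≃ Y) (x : X) : L2.reindex φ (L2.e x) = L2.e (φ x) := by
  classical
  ext y
  change L2.e x (φ.symm y) = L2.e (φ x) y
  unfold L2.e
  simp only [lp.single_apply, Pi.single_apply, Equiv.symm_apply_eq]

lemma opTensor_id_id (X Y : Type) :
    opTensor (ContinuousLinearMap.id ℂ (L2 X)) (ContinuousLinearMap.id ℂ (L2 Y)) =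
      ContinuousLinearMap.id ℂ (L2 (X × Y)) :=
  (opTensor_unique fun _ _ => rfl).symm

lemma opTensor_comp {X Y : Type} (A A' : L2 X →L[ℂ] L2 X) (B B' : L2 Y →L[ℂ] L2 Y) :
    opTensor (A ∘L A') (B ∘L B') = opTensor A B ∘L opTensor A' B' :=
  (opTensor_unique fun _ _ => by simp [opTensor_mulMap]).symm

/-- Inner products of elementary tensors factor, and it suffices to test against basis vectors,
which are elementary. This makes amplification a `*`-homomorphism. -/
lemma adjoint_opTensor {X Y : Type} (A : L2 X →L[ℂ] L2 X) (B : L2 Y →L[ℂ] L2 Y) :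
    ContinuousLinearMap.adjoint (opTensor A B) =
      opTensor (ContinuousLinearMap.adjoint A) (ContinuousLinearMap.adjoint B) := by
  refine opTensor_unique fun f g => L2.ext_inner fun p => ?_
  rw [ContinuousLinearMap.adjoint_inner_right, ← L2.mulMap_e, opTensor_mulMap, L2.inner_mulMap,
    L2.inner_mulMap, ContinuousLinearMap.adjoint_inner_right,
    ContinuousLinearMap.adjoint_inner_right]

/-- The amplification `A ↦ A ⊗ id`. -/
def amplify (X Y : Type) : (L2 X →L[ℂ] L2 X) →⋆ₐ[ℂ] (L2 (X × Y) →L[ℂ] L2 (X × Y)) where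
  toFun A := opTensor A (ContinuousLinearMap.id ℂ (L2 Y))
  map_one' := opTensor_id_id X Y
  map_mul' A B := opTensor_comp A B (ContinuousLinearMap.id ℂ (L2 Y)) (ContinuousLinearMap.id ℂ (L2 Y))
  map_zero' := LinearMap.map_zero₂ (opTensorMap X Y) _
  map_add' A B := LinearMap.map_add₂ (opTensorMap X Y) A B _
  commutes' c := by
    rw [Algebra.algebraMap_eq_smul_one, Algebra.algebraMap_eq_smul_one]
    refine (LinearMap.map_smul₂ (opTensorMap X Y) c _ _).trans ?_
    exact congrArg (c • ·) (opTensor_id_id X Y)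
  map_star' A := by
    rw [ContinuousLinearMap.star_eq_adjoint, ContinuousLinearMap.star_eq_adjoint, adjoint_opTensor]
    exact congrArg _ (star_one (L2 Y →L[ℂ] L2 Y)).symm

/-- Conjugation by the unitary induced by a bijection of the index sets. -/
def reindexConj {X Y : Type} (φ : X ≃ Y) : (L2 Y →L[ℂ] L2 Y) →ₗ[ℂ] (L2 X →L[ℂ] L2 X) where
  toFun A := ((L2.reindex φ).symm : L2 Y →L[ℂ] L2 X) ∘L A ∘L (L2.reindex φ : L2 X →L[ℂ] L2 Y)
  map_add' A B := by ext; simp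
  map_smul' c A := by ext; simp

lemma reindexConj_apply_e {X Y : Type} (φ : X ≃ Y) (A : L2 Y →L[ℂ] L2 Y) (x : X) :
    reindexConj φ A (L2.e x) = (L2.reindex φ).symm (A (L2.e (φ x))) := by
  rw [← L2.reindex_e]; rfl

/-- Associativity of the tensor product of operators. The bijection on the right is the one by which
`idxAppend` treats a word with one more letter in front. -/
lemma opTensor_reindexConj {X Y Y₁ Y₂ : Type} (φ : Y ≃ Y₁ × Y₂) (A : L2 X →L[ℂ] L2 X)
    (B : L2 Y₁ →L[ℂ] L2 Y₁) (C : L2 Y₂ →L[ℂ] L2 Y₂) :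
    opTensor A (reindexConj φ (opTensor B C)) =
      reindexConj (((Equiv.refl X).prodCongr φ).trans (Equiv.prodAssoc X Y₁ Y₂).symm)
        (opTensor (opTensor A B) C) := by
  refine L2.op_ext fun p => ?_
  rw [reindexConj_apply_e, ← L2.mulMap_e, opTensor_mulMap, reindexConj_apply_e]
  change _ = (L2.reindex _).symm (opTensor (opTensor A B) C (L2.e ((p.1, (φ p.2).1), (φ p.2).2)))
  rw [← L2.mulMap_e, ← L2.mulMap_e, opTensor_mulMap, opTensor_mulMap, ← L2.mulMap_e,
    opTensor_mulMap]
  -- On a basis vector both sides are elementary tensors, so coordinatewise only associativity of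
  -- multiplication in `ℂ` is left.
  ext r
  change _ * (_ * _) = _ * _ * _
  rw [mul_assoc]
  rfl

/-- The space `ℓ²(Unit)` attached to the empty word is `ℂ`, a unit for the tensor product. -/
lemma reindexConj_id_opTensor {Y : Type} (B : L2 Y →L[ℂ] L2 Y) :
    reindexConj (Equiv.punitProd Y).symm (opTensor (ContinuousLinearMap.id ℂ (L2 Unit)) B) = B := by
  refine L2.op_ext fun y => ?_
  rw [reindexConj_apply_e]
  change (L2.reindex _).symm (opTensor _ B (L2.e ((), y))) = _
  rw [← L2.mulMap_e, opTensor_mulMap]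
  ext r
  change L2.e () () * _ = _
  rw [show (L2.e () : L2 Unit) () = 1 by simp [L2.e], one_mul]
  rfl

end operators

/-! ### Concatenation of words. -/

section words
variable {ι : Type*} (D : Datum ι)

/-- Induction on the first word. The empty word acts by the counit, so that case is the counit
axiom; the step is coassociativity of `Δ` combined with associativity of the tensor product of
operators. -/
lemma piWord_append (w w' : List ι) :
    piWord D (w ++ w') =
      reindexConj (idxAppend w w') ∘ₗ convTensor D (piWord D w) (piWord D w') := by
  induction w with
  | nil =>
    refine Fun.hom_ext fun n ρ h1 h2 f v => ?_
    rw [LinearMap.comp_apply, convTensor_funCoeff, map_sum]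
    change piWord D w' (funCoeff h1 h2 f v) = _
    conv_lhs => rw [← sum_funCoeff h1 h2 f v, map_sum]
    refine Finset.sum_congr rfl fun k _ => ?_
    rw [map_smul]
    -- The empty word acts by the scalar `ε`, which bilinearity moves out of the tensor product.
    have : opTensor (piWord D [] (funCoeff h1 h2 f (Pi.basisFun ℂ (Fin n) k)))
        (piWord D w' (funCoeff h1 h2 ((Pi.basisFun ℂ (Fin n)).coord k) v)) =
        funCounit D (funCoeff h1 h2 f (Pi.basisFun ℂ (Fin n) k)) •
          opTensor (ContinuousLinearMap.id ℂ (L2 Unit))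
            (piWord D w' (funCoeff h1 h2 ((Pi.basisFun ℂ (Fin n)).coord k) v)) :=
      LinearMap.map_smul₂ (opTensorMap Unit (Idx w')) _ _ _
    rw [this]
    refine Eq.trans ?_ (map_smul (reindexConj (Equiv.punitProd (Idx w')).symm) _ _).symm
    rw [reindexConj_id_opTensor]
  | cons i w ih =>
    refine Fun.hom_ext fun n ρ h1 h2 f v => ?_
    change convTensor D (piNode D i) (piWord D (w ++ w')) _ =
      reindexConj _ (convTensor D (convTensor D (piNode D i) (piWord D w)) (piWord D w') _)
    rw [ih, convTensor_funCoeff, convTensor_funCoeff]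
    simp only [LinearMap.comp_apply, convTensor_funCoeff, map_sum]
    have e1 : ∀ (A : L2 ℕ →L[ℂ] L2 ℕ) (B : Fin n → (L2 (Idx (w ++ w')) →L[ℂ] L2 (Idx (w ++ w')))),
        opTensor A (∑ k, B k) = ∑ k, opTensor A (B k) :=
      fun A B => map_sum (opTensorMap ℕ (Idx (w ++ w')) A) B _
    have e2 : ∀ (A : Fin n → (L2 (ℕ × Idx w) →L[ℂ] L2 (ℕ × Idx w)))
        (B : L2 (Idx w') →L[ℂ] L2 (Idx w')),
        opTensor (∑ k, A k) B = ∑ k, opTensor (A k) B :=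
      fun A B => map_sum ((opTensorMap (ℕ × Idx w) (Idx w')).flip B) A _
    simp only [e1]
    -- The two bracketings of the iterated comultiplication sum over the same pairs of basis
    -- vectors, with the outer index at the first cut on one side and at the second cut on the
    -- other.
    rw [Finset.sum_comm]
    refine Finset.sum_congr rfl fun k _ => ?_
    rw [e2, map_sum]
    refine Finset.sum_congr rfl fun l _ => ?_
    exact opTensor_reindexConj _ _ _ _

end words

/-! ### Bilinear maps that see a functional only through its restriction to a set. -/

section restriction
variable {ι : Type*} (D : Datum ι)

/-- Evaluation of the second factor at `X`. -/
def evalRight (M : Type*) [AddCommGroup M] [Module ℂ M] (X : Uq D) : M ⊗[ℂ] Fun D →ₗ[ℂ] M :=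
  TensorProduct.lift ((LinearMap.lsmul ℂ M).flip.compl₂ (LinearMap.applyₗ X ∘ₗ (Fun D).subtype))

variable {D}

@[simp] lemma evalRight_tmul {M : Type*} [AddCommGroup M] [Module ℂ M] (X : Uq D) (m : M)
    (φ : Fun D) : evalRight D M X (m ⊗ₜ φ) = φ.1 X • m := rfl

lemma evalRight_apply (T : Fun D ⊗[ℂ] Fun D) (X Y : Uq D) :
    (evalRight D (Fun D) Y T).1 X = pairDual D T X Y := by
  induction T using TensorProduct.induction_on with
  | zero => simp
  | add S T h1 h2 => simp only [map_add, LinearMap.add_apply, Submodule.coe_add, h1, h2]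
  | tmul φ ψ => simp [mul_comm]

lemma evalRight_map {M N : Type*} [AddCommGroup M] [Module ℂ M] [AddCommGroup N] [Module ℂ N]
    (p : M →ₗ[ℂ] N) (X : Uq D) (T : M ⊗[ℂ] Fun D) :
    evalRight D N X (p.rTensor (Fun D) T) = p (evalRight D M X T) := by
  induction T using TensorProduct.induction_on with
  | zero => simp
  | add S T h1 h2 => simp only [map_add, h1, h2]
  | tmul m φ => simp

/-- Write `T = ∑ e_k ⊗ c_k` with linearly independent `e_k`. Vanishing of `∑ c_k(X) e_k` for every
`X ∈ A` forces each `c_k` to vanish on `A`, and `β` kills such functionals. -/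
lemma lift_eq_zero_of_evalRight {M V : Type*} [AddCommGroup M] [Module ℂ M] [AddCommGroup V]
    [Module ℂ V] {A : Set (Uq D)} {β : M →ₗ[ℂ] Fun D →ₗ[ℂ] V}
    (hβ : ∀ m (ψ : Fun D), (∀ X ∈ A, ψ.1 X = 0) → β m ψ = 0) {T : M ⊗[ℂ] Fun D}
    (hT : ∀ X ∈ A, evalRight D M X T = 0) : TensorProduct.lift β T = 0 := by
  let e := Module.Basis.ofVectorSpace ℂ M
  obtain ⟨c, rfl⟩ := TensorProduct.eq_repr_basis_left e T
  rw [Finsupp.sum, map_sum]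
  refine Finset.sum_eq_zero fun k hk => ?_
  rw [TensorProduct.lift.tmul]
  refine hβ _ _ fun X hX => ?_
  have h := hT X hX
  rw [Finsupp.sum, map_sum] at h
  simp only [evalRight_tmul] at h
  exact linearIndependent_iff'.1 e.linearIndependent c.support (fun k => (c k).1 X) h k hk

/-- The functionals vanishing on a set. -/
def vanishing (A : Set (Uq D)) : Submodule ℂ (Fun D) where
  carrier := {φ | ∀ X ∈ A, φ.1 X = 0}
  zero_mem' _ _ := rfl
  add_mem' h1 h2 X hX := by simp [h1 X hX, h2 X hX]
  smul_mem' c _ h X hX := by simp [h X hX]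

/-- The version with both legs restricted to `A`. Dividing the first leg by the functionals
vanishing on `A` reduces it to restriction in the second leg alone. -/
lemma lift_eq_zero_of_pairDual {V : Type*} [AddCommGroup V] [Module ℂ V] {A : Set (Uq D)}
    {β : Fun D →ₗ[ℂ] Fun D →ₗ[ℂ] V} (hβ₁ : ∀ φ ∈ vanishing A, β φ = 0)
    (hβ₂ : ∀ φ, ∀ ψ ∈ vanishing A, β φ ψ = 0) {T : Fun D ⊗[ℂ] Fun D}
    (hT : ∀ X ∈ A, ∀ Y ∈ A, pairDual D T X Y = 0) : TensorProduct.lift β T = 0 := by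
  let K : Submodule ℂ (Fun D) := vanishing A
  have hK : K ≤ LinearMap.ker β := hβ₁
  -- `β` descends to the quotient in its first argument. Evaluating the second leg of `T` at `Y ∈ A`
  -- gives a functional that vanishes on `A`, which is zero in the quotient.
  have h : TensorProduct.lift (K.liftQ β hK) (K.mkQ.rTensor (Fun D) T) = 0 := by
    refine lift_eq_zero_of_evalRight (A := A) ?_ ?_
    · intro m ψ hψ
      obtain ⟨φ, rfl⟩ := K.mkQ_surjective m
      exact hβ₂ φ ψ hψ
    · intro Y hY
      rw [evalRight_map, Submodule.mkQ_apply, Submodule.Quotient.mk_eq_zero]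
      intro X hX
      rw [evalRight_apply, hT X hX Y hY]
  rw [← h, ← LinearMap.comp_apply]
  congr 1
  ext φ ψ
  rfl

/-! ### The unit of the function algebra and the effect of Levi invariance. -/

variable (D)

/-- The trivial representation. -/
def trivRep : Uq D →ₐ[ℂ] Module.End ℂ (Fin 1 → ℂ) := (Algebra.ofId ℂ _).comp (Uq.counit D)

lemma trivRep_apply (X : Uq D) (v : Fin 1 → ℂ) : trivRep D X v = Uq.counit D X • v := rfl

/-- `Fun` admits only coefficients of irreducible representations with weights in `P`; this and the
next lemma are what places `ε` among them. -/
lemma trivRep_isIrred : IsIrred (trivRep D) := by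
  refine ⟨inferInstance, fun W _ => ?_⟩
  have : IsSimpleOrder (Submodule ℂ (Fin 1 → ℂ)) :=
    (isSimpleModule_iff ℂ _).1 (isSimpleModule_iff_finrank_eq_one.2 (by simp))
  exact eq_bot_or_eq_top W

lemma trivRep_isPWeighted : IsPWeighted (trivRep D) := by
  rw [IsPWeighted, eq_top_iff]
  refine le_trans (fun v _ => ?_) (le_iSup _ (0 : ι → ℤ))
  refine (Submodule.mem_iInf _).2 fun i => Module.End.mem_eigenspace_iff.2 ?_
  rw [trivRep_apply]
  simp

/-- The counit of the quantized universal enveloping algebra is the unit of the function algebra. -/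
def funOne : Fun D :=
  funCoeff (trivRep_isIrred D) (trivRep_isPWeighted D) (LinearMap.proj 0) 1

@[simp] lemma funOne_apply (X : Uq D) : (funOne D).1 X = Uq.counit D X := by
  change (trivRep D X 1) 0 = _
  rw [trivRep_apply]
  simp

/-- The functional `ε` is multiplicative, hence group-like. -/
lemma comul_funOne : comul D (funOne D) = funOne D ⊗ₜ funOne D := by
  refine pairDual_injective D ?_
  ext X Y
  rw [pairDual_comul, pairDual_tmul]
  simp

variable {D}

/-- The defining invariance of `a` says that `Δ(a) - a ⊗ ε` vanishes when its second leg is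
evaluated on the Levi subalgebra. A `β` which depends on its second argument only through the
restriction to that subalgebra therefore annihilates the difference. -/
lemma lift_comul_of_mem_flagFun {V : Type*} [AddCommGroup V] [Module ℂ V] {S : Set ι}
    {a : Fun D} (ha : a ∈ flagFun D S) {β : Fun D →ₗ[ℂ] Fun D →ₗ[ℂ] V}
    (hβ : ∀ φ, ∀ ψ ∈ vanishing (levi D S : Set (Uq D)), β φ ψ = 0) :
    TensorProduct.lift β (comul D a) = β a (funOne D) := by
  have h : β a (funOne D) = TensorProduct.lift β (a ⊗ₜ funOne D) := rfl
  rw [← sub_eq_zero, h, ← map_sub]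
  refine lift_eq_zero_of_evalRight (A := (levi D S : Set (Uq D))) hβ fun X hX => ?_
  ext Y
  rw [evalRight_apply, map_sub, LinearMap.sub_apply, LinearMap.sub_apply, pairDual_comul,
    pairDual_tmul, ha X hX Y, funOne_apply, mul_comm, sub_self]
  rfl

/-! ### Representations of the Levi factor -/

lemma gen_K_mem_levi (S : Set ι) (i : ι) : Uq.gen D (.K i) ∈ levi D S :=
  Algebra.subset_adjoin ⟨.K i, trivial, rfl⟩

lemma gen_Kinv_mem_levi (S : Set ι) (i : ι) : Uq.gen D (.Kinv i) ∈ levi D S :=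
  Algebra.subset_adjoin ⟨.Kinv i, trivial, rfl⟩

variable (D) in
lemma nodeHom_Kinv (i : ι) : nodeHom D i (Uq.gen _ (.Kinv ())) = Uq.gen D (.Kinv i) :=
  sl2Lift_Kinv _

variable (D) in
lemma nodeHom_E (i : ι) : nodeHom D i (Uq.gen _ (.E ())) = Uq.gen D (.E i) := sl2Lift_E _

variable (D) in
lemma nodeHom_F (i : ι) : nodeHom D i (Uq.gen _ (.F ())) = Uq.gen D (.F i) := sl2Lift_F _

lemma nodeHom_mem_levi {S : Set ι} {i : ι} (hi : i ∈ S) (X : Uq (sl2 (D.q i))) :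
    nodeHom D i X ∈ levi D S := by
  refine sl2_mem ((levi D S).comap (nodeHom D i)) ?_ ?_ ?_ ?_ X <;> rw [Subalgebra.mem_comap]
  · rw [nodeHom_K]; exact gen_K_mem_levi S i
  · rw [nodeHom_Kinv]; exact gen_Kinv_mem_levi S i
  · rw [nodeHom_E]; exact Algebra.subset_adjoin ⟨.E i, hi, rfl⟩
  · rw [nodeHom_F]; exact Algebra.subset_adjoin ⟨.F i, hi, rfl⟩

/-- `π_i` factors through restriction along `φ_i`, and for `i ∈ S` the image of `φ_i` lies in the
Levi subalgebra. -/
lemma piNode_eq_zero {S : Set ι} {i : ι} (hi : i ∈ S) {ψ : Fun D}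
    (hψ : ψ ∈ vanishing (levi D S : Set (Uq D))) : piNode D i ψ = 0 := by
  have : nodeStar D i ψ = 0 := by
    refine Subtype.ext ?_
    ext X
    exact hψ _ (nodeHom_mem_levi hi X)
  rw [piNode, LinearMap.comp_apply, this, map_zero]

variable (D) in
-- `φ_i` intertwines the counits, and the counit is the unit of `ℂ_{q_i}[SU(2)]`.
lemma piNode_funOne (i : ι) : piNode D i (funOne D) = 1 := by
  have : nodeStar D i (funOne D) = 1 := by
    refine Subtype.ext ?_
    ext X
    have h : (Uq.counit D).comp (nodeHom D i) = Uq.counit _ := by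
      apply sl2_hom_ext <;> simp [nodeHom_K, nodeHom_Kinv, nodeHom_E, nodeHom_F]
    change (funOne D).1 (nodeHom D i X) = Uq.counit _ X
    rw [funOne_apply, ← h]
    rfl
  rw [piNode, LinearMap.comp_apply, this]
  exact map_one (piQ (D.q i))

/-- `π_w` depends only on the restriction to the Levi subalgebra. This passes to tensor products
because that subalgebra is closed under multiplication: if `ψ` vanishes on it, then `Δ(ψ)` vanishes
on pairs of its elements. For the empty word it is enough that `1` belongs to it. -/
lemma piWord_eq_zero {S : Set ι} {w : List ι} (hw : ∀ i ∈ w, i ∈ S) {ψ : Fun D}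
    (hψ : ψ ∈ vanishing (levi D S : Set (Uq D))) : piWord D w ψ = 0 := by
  induction w generalizing ψ with
  | nil =>
    have : funCounit D ψ = 0 := hψ 1 (one_mem _)
    rw [piWord, LinearMap.comp_apply, this, map_zero]
  | cons i w ih =>
    change TensorProduct.lift ((opTensorMap ℕ (Idx w)).compl₁₂ (piNode D i) (piWord D w))
      (comul D ψ) = 0
    refine lift_eq_zero_of_pairDual (A := (levi D S : Set (Uq D))) ?_ ?_ ?_
    · intro φ hφ
      ext1 χ
      rw [LinearMap.compl₁₂_apply, piNode_eq_zero (hw i (by simp)) hφ, map_zero]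
      rfl
    · intro φ χ hχ
      rw [LinearMap.compl₁₂_apply, ih (fun j hj => hw j (by simp [hj])) hχ, map_zero]
    · intro X hX Y hY
      rw [pairDual_comul]
      exact hψ _ (mul_mem hX hY)

variable (D) in
-- The functional `ε` is group-like, so its image is a tensor product of identities.
lemma piWord_funOne (w : List ι) : piWord D w (funOne D) = ContinuousLinearMap.id ℂ _ := by
  induction w with
  | nil =>
    have : funCounit D (funOne D) = 1 := (funOne_apply D 1).trans (map_one _)
    rw [piWord, LinearMap.comp_apply, this]
    exact one_smul ℂ _
  | cons i w ih =>
    change TensorProduct.lift ((opTensorMap ℕ (Idx w)).compl₁₂ (piNode D i) (piWord D w))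
      (comul D (funOne D)) = _
    rw [comul_funOne, TensorProduct.lift.tmul, LinearMap.compl₁₂_apply, piNode_funOne, ih]
    exact opTensor_id_id ℕ (Idx w)

/-! ### The characters `τ_t`. -/

section torus
variable [Fintype ι]

lemma torusHom_mem_levi (S : Set ι) (g : ι → Multiplicative ℤ) : torusHom D g ∈ levi D S := by
  -- Negative powers of the `K_i` occur in `K^σ`, so the argument runs in the group of units that
  -- lie in the Levi subalgebra together with their inverses.
  let H : Subgroup (Uq D)ˣ := (levi D S).toSubmonoid.units
  have hK : ∀ i, Uq.Kunit D i ∈ H := fun i =>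
    Submonoid.mem_units_iff _ _ |>.2 ⟨gen_K_mem_levi S i, gen_Kinv_mem_levi S i⟩
  have h : MonoidHom.noncommPiCoprod (fun i => zpowersHom (Uq D)ˣ (Uq.Kunit D i))
      (Uq.commute_Kunit D) g ∈ H := by
    have h1 : (MonoidHom.noncommPiCoprod (fun i => zpowersHom (Uq D)ˣ (Uq.Kunit D i))
        (Uq.commute_Kunit D)).range ≤ H := by
      rw [MonoidHom.noncommPiCoprod_range]
      refine iSup_le fun i => ?_
      rintro _ ⟨n, rfl⟩
      exact H.zpow_mem (hK i) _
    exact h1 ⟨g, rfl⟩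
  exact (Submonoid.mem_units_iff _ _ |>.1 h).1

/-- `τ_t` factors through restriction to the elements `K^σ`, all of which lie in the Levi subalgebra
whatever `S` is. -/
lemma tau_eq_zero {S : Set ι} (t : ι → Circle) {ψ : Fun D}
    (hψ : ψ ∈ vanishing (levi D S : Set (Uq D))) : tau D t ψ = 0 := by
  have : resTorus D ψ = 0 := by
    refine Subtype.ext ?_
    funext g
    exact hψ _ (torusHom_mem_levi S g)
  rw [tau, LinearMap.comp_apply, this, map_zero]

variable (D) in
lemma tau_funOne (t : ι → Circle) : tau D t (funOne D) = 1 := by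
  -- The trivial representation has weight `0`, so `K^σ` acts in it by `φ_0(K^σ) = 1`.
  have h1 : ∀ g, Uq.counit D (torusHom D g) = 1 := by
    intro g
    have hv : (1 : Fin 1 → ℂ) ∈ weightSpace (trivRep D) (0 : ι → ℤ) := by
      refine (Submodule.mem_iInf _).2 fun i => Module.End.mem_eigenspace_iff.2 ?_
      rw [trivRep_apply]
      simp
    have := congrFun (torusHom_apply_weight D (trivRep D) hv g) 0
    rw [trivRep_apply] at this
    simpa [torusChar] using this
  -- The evaluation at `t` is defined by its values on the basis of characters, so the restriction
  -- of `ε` has to be recognised as the basis vector `φ_0`, whose image is `t^0 = 1`.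
  have h2 : resTorus D (funOne D) =
      Module.Basis.span (linearIndependent_torusChar D) (0 : ι → ℤ) := by
    refine Subtype.ext ?_
    rw [Module.Basis.span_apply]
    funext g
    refine ((funOne_apply D _).trans (h1 g)).trans ?_
    simp [torusChar]
  rw [tau, LinearMap.comp_apply, h2]
  refine (Module.Basis.constr_basis (Module.Basis.span (linearIndependent_torusChar D)) ℂ
    (fun μ : ι → ℤ => ∏ i, (t i : ℂ) ^ μ i) 0).trans ?_
  simp

/-- `τ_t` sees only the restriction to the Levi subalgebra and sends `ε` to `1`. No property of `π`
is involved, so this applies to `π_u ⊗ π_v` as a whole. -/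
lemma convTau_of_mem_flagFun {S : Set ι} {a : Fun D} (ha : a ∈ flagFun D S) {X : Type}
    (π : Fun D →ₗ[ℂ] (L2 X →L[ℂ] L2 X)) (t : ι → Circle) : convTau D π t a = π a := by
  rw [convTau, LinearMap.comp_apply, lift_comul_of_mem_flagFun ha]
  · rw [LinearMap.compl₁₂_apply, tau_funOne]
    exact one_smul ℂ _
  · intro φ ψ hψ
    rw [LinearMap.compl₁₂_apply, tau_eq_zero t hψ, map_zero]

end torus

/-- The same argument, with a word in the letters of `S` in place of `τ_t`. -/
lemma convTensor_of_mem_flagFun {S : Set ι} {a : Fun D} (ha : a ∈ flagFun D S) {X : Type}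
    (π : Fun D →ₗ[ℂ] (L2 X →L[ℂ] L2 X)) {w : List ι} (hw : ∀ i ∈ w, i ∈ S) :
    convTensor D π (piWord D w) a = opTensor (π a) (ContinuousLinearMap.id ℂ (L2 (Idx w))) := by
  rw [convTensor, LinearMap.comp_apply, lift_comul_of_mem_flagFun ha]
  · rw [LinearMap.compl₁₂_apply, piWord_funOne]
    rfl
  · intro φ ψ hψ
    rw [LinearMap.compl₁₂_apply, piWord_eq_zero hw hψ, map_zero]

end restriction

end QFlag

end

/-! ### The proposition. -/

open QFlag

theorem mainTheorem6 {𝔤 : Type*} [LieRing 𝔤] [LieAlgebra ℂ 𝔤] [FiniteDimensional ℂ 𝔤]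
    [LieAlgebra.IsSimple ℂ 𝔤] (𝔥 : LieSubalgebra ℂ 𝔤) [𝔥.IsCartanSubalgebra]
    (b : (LieAlgebra.IsKilling.rootSystem 𝔥).Base) (q : Set.Ioo (0 : ℝ) 1) (S : Set b.support)
    (σ u v : (LieAlgebra.IsKilling.rootSystem 𝔥).weylGroup)
    (hσ : σ = u * v) (hu : u ∈ minimalReps b S) (hv : v ∈ parabolic b S)
    (wu wv : List b.support) (hwu : IsReducedWord b u wu) (hwv : IsReducedWord b v wv) :
    IsReducedWord b σ (wu ++ wv) ∧
    (∀ a : Fun (lieDatum b q), piWord (lieDatum b q) (wu ++ wv) a =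
      ((L2.reindex (idxAppend wu wv)).symm : L2 (Idx wu × Idx wv) →L[ℂ] L2 (Idx (wu ++ wv))) ∘L
        convTensor (lieDatum b q) (piWord _ wu) (piWord _ wv) a ∘L
          (L2.reindex (idxAppend wu wv) : L2 (Idx (wu ++ wv)) →L[ℂ] L2 (Idx wu × Idx wv))) ∧
    (∀ (t : b.support → Circle), ∀ a ∈ flagFun (lieDatum b q) S,
      convTau (lieDatum b q) (convTensor (lieDatum b q) (piWord _ wu) (piWord _ wv)) t a =
        opTensor (piWord _ wu a) (ContinuousLinearMap.id ℂ (L2 (Idx wv)))) ∧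
    ∃ Θ : (L2 (Idx wu) →L[ℂ] L2 (Idx wu)) →⋆ₐ[ℂ]
        (L2 (Idx wu × Idx wv) →L[ℂ] L2 (Idx wu × Idx wv)),
      ∀ (t : b.support → Circle), ∀ a ∈ flagFun (lieDatum b q) S,
        convTau (lieDatum b q) (convTensor (lieDatum b q) (piWord _ wu) (piWord _ wv)) t a =
          Θ (piWord _ wu a) := by
  have key : ∀ (t : b.support → Circle), ∀ a ∈ flagFun (lieDatum b q) S,
      convTau (lieDatum b q) (convTensor (lieDatum b q) (piWord _ wu) (piWord _ wv)) t a =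
        opTensor (piWord _ wu a) (ContinuousLinearMap.id ℂ (L2 (Idx wv))) := fun t a ha => by
    -- First `τ_t` is absorbed, then `π_v`; the latter requires that the letters of the reduced word
    -- of `v` lie in `S`.
    rw [convTau_of_mem_flagFun ha, convTensor_of_mem_flagFun ha _ (hwv.mem_of_mem_parabolic b hv)]
  -- `Θ` is the amplification `A ↦ A ⊗ id`. Its value is by definition the right-hand side of `key`,
  -- so the same proof serves twice.
  refine ⟨?_, ?_, key, amplify (Idx wu) (Idx wv), key⟩
  · rw [hσ]
    exact hwu.append b hu hv hwv
  · exact LinearMap.congr_fun (piWord_append _ wu wv)
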